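/- Let $k\ge 1$ be an integer. There is $\eta=\eta(k)>0$ such that the following holds. Let $\varepsilon,c,A,B>0$ and $K\in\mathbb{N}$ be fixed, and let $\psi:\mathbb{R}\to\mathbb{C}$ be a fixed $C^\infty$-smooth compactly supported function. Let $M,L,D\ge c$ be real numbers, let $\chi$ be a primitive quadratic Dirichlet character modulo $q>1$ (equivalently, the character associated to a fundamental discriminant $\pm q$), and put $\mathcal{L}:=\log(3+MLDq)$. Let $\lambda_\ell\in\mathbb{C}$ satisfy $|\lambda_\ell|\le 1$ if $\ell=n^k$ for some integer $n$ and $\lambda_\ell=0$ otherwise. Let $\alpha(d)\in\mathbb{C}$ be divisor bounded, in the sense that $|\alpha(d)|\le B\,\tau(d)^K\log^{B}(d+2)$ for all $d\ge 1$, where $\tau(d)$ is the number of divisors of $d$. Let $m_0$ be a real number with $|m_0|\le A M\mathcal{L}^{A}$. Then $$\Bigg|\sum_{D<d\le 2D}\alpha(d)\sum_{\substack{L<\ell\le 2L,\ m\in\mathbb{Z}\\ (\ell,m)=1\\ \ell^2+m^2\equiv 0\ (\mathrm{mod}\ d)}}\lambda_\ell\,\psi\Big(\frac{m-m_0}{M}\Big)\chi(\ell^2+m^2)\Bigg|\le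 C\,\mathcal{L}^{C}\Big(q^2M^{\varepsilon}(L+M)^{1/2}D^{1/2}L^{1/(2k)}+q^{-\eta}ML^{1/k}\Big),$$ where $C>0$ depends only on $k,\varepsilon,c,A,B,K$ and $\psi$. -/

import Mathlib

noncomputable section

/-- The logarithm of the size of the parameters `M, L, D, q`. Factors that are a fixed power of
this quantity are the "logarithmic factors" that bounds are allowed to lose. It is at least `1`
for non-negative parameters. -/
def paramLog (M L D : ℝ) (q : ℕ) : ℝ :=
  Real.log (3 + M * L * D * (q : ℝ))

/-- `α` is divisor bounded, with explicit constants: `|α(n)| ≤ B τ(n)^K (log (n + 2))^B` for all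
`n ≥ 1`, where `τ` is the number of divisors. -/
def IsDivisorBounded (K : ℕ) (B : ℝ) (α : ℕ → ℂ) : Prop :=
  ∀ n : ℕ, 1 ≤ n →
    ‖α n‖ ≤ B * (n.divisors.card : ℝ) ^ K * Real.log ((n : ℝ) + 2) ^ B

/-- `|lam ℓ| ≤ 1` if `ℓ` is a perfect `k`-th power, and `lam ℓ = 0` otherwise. -/
def IsPowerCoefficient (k : ℕ) (lam : ℕ → ℂ) : Prop :=
  ∀ l : ℕ, ‖lam l‖ ≤ Set.indicator {l : ℕ | ∃ n : ℕ, l = n ^ k} (fun _ => (1 : ℝ)) l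

/-- The integers `n` with `X < n ≤ 2 X`. -/
def dyadic (X : ℝ) : Finset ℕ :=
  Finset.Ioc ⌊X⌋₊ ⌊2 * X⌋₊

theorem mem_dyadic {X : ℝ} (hX : 0 ≤ X) (n : ℕ) :
    n ∈ dyadic X ↔ X < (n : ℝ) ∧ (n : ℝ) ≤ 2 * X := by
  rw [dyadic, Finset.mem_Ioc, Nat.floor_lt hX, Nat.le_floor_iff (by positivity)]

open Classical in
/-- The twisted sum over `D < d ≤ 2 D`, `L < ℓ ≤ 2 L` and all integers `m` with `(ℓ, m) = 1` and
`d ∣ ℓ² + m²` of `α(d) lam(ℓ) ψ((m - m₀) / M) χ(ℓ² + m²)`. For `M > 0` and compactly supported `ψ`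
the sum over `m` has only finitely many non-zero terms. -/
def twistedSum (α lam : ℕ → ℂ) (ψ : ℝ → ℂ) {q : ℕ} (χ : DirichletCharacter ℂ q)
    (M L D m₀ : ℝ) : ℂ :=
  ∑ d ∈ dyadic D, α d * ∑ l ∈ dyadic L, ∑' m : ℤ,
    if IsCoprime (l : ℤ) m ∧ (d : ℤ) ∣ (l : ℤ) ^ 2 + m ^ 2 then
      lam l * ψ (((m : ℝ) - m₀) / M) * χ ((((l : ℤ) ^ 2 + m ^ 2 : ℤ)) : ZMod q)
    else 0

end

noncomputable section
open scoped FourierTransform ArithmeticFunction.Moebius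

theorem card_divisors_mul_le (m n : ℕ) :
    (m * n).divisors.card ≤ m.divisors.card * n.divisors.card := by
  classical
  rw [Nat.divisors_mul]
  exact Finset.card_mul_le

theorem card_divisors_pow_le (n k : ℕ) : (n ^ k).divisors.card ≤ n.divisors.card ^ k := by
  induction k with
  | zero => simp
  | succ k ih =>
    rw [pow_succ, pow_succ]
    exact (card_divisors_mul_le _ _).trans (Nat.mul_le_mul_right _ ih)

theorem sum_Icc_sum_divisors (F : ℕ → ℕ → ℝ) (N : ℕ) :
    ∑ n ∈ Finset.Icc 1 N, ∑ b ∈ n.divisors, F b (n / b) =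
      ∑ b ∈ Finset.Icc 1 N, ∑ m ∈ Finset.Icc 1 (N / b), F b m := by
  rw [Finset.sum_sigma', Finset.sum_sigma']
  refine Finset.sum_bij' (fun x _ => ⟨x.2, x.1 / x.2⟩) (fun x _ => ⟨x.1 * x.2, x.1⟩) ?_ ?_ ?_ ?_ ?_
  · rintro ⟨n, b⟩ h
    simp only [Finset.mem_sigma, Finset.mem_Icc, Nat.mem_divisors] at h ⊢
    obtain ⟨⟨h1, h2⟩, h3, h4⟩ := h
    have hb : 0 < b := Nat.pos_of_dvd_of_pos h3 h1
    exact ⟨⟨hb, (Nat.le_of_dvd h1 h3).trans h2⟩, Nat.div_pos (Nat.le_of_dvd h1 h3) hb,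
      Nat.div_le_div_right h2⟩
  · rintro ⟨b, m⟩ h
    simp only [Finset.mem_sigma, Finset.mem_Icc, Nat.mem_divisors] at h ⊢
    obtain ⟨⟨h1, h2⟩, h3, h4⟩ := h
    have := (Nat.le_div_iff_mul_le (by omega)).1 h4
    have h0 : 0 < b * m := Nat.mul_pos h1 h3
    exact ⟨⟨h0, by rw [mul_comm]; exact this⟩, dvd_mul_right _ _, h0.ne'⟩
  · rintro ⟨n, b⟩ h
    simp only [Finset.mem_sigma, Finset.mem_Icc, Nat.mem_divisors] at h
    simp [Nat.mul_div_cancel' h.2.1]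
  · rintro ⟨b, m⟩ h
    simp only [Finset.mem_sigma, Finset.mem_Icc] at h
    simp [Nat.mul_div_cancel_left m (show 0 < b by omega)]
  · rintro ⟨n, b⟩ h
    rfl

theorem one_le_one_add_log (N : ℕ) : (1 : ℝ) ≤ 1 + Real.log N := by
  linarith [Real.log_natCast_nonneg N]

theorem sum_Icc_inv_le (N : ℕ) : ∑ n ∈ Finset.Icc 1 N, (n : ℝ)⁻¹ ≤ 1 + Real.log N := by
  have := harmonic_le_one_add_log N
  rw [harmonic_eq_sum_Icc] at this
  push_cast at this
  exact this

theorem card_divisors_mul_pow_le (b m j : ℕ) :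
    (((b * m).divisors.card : ℝ)) ^ j ≤ (b.divisors.card : ℝ) ^ j * (m.divisors.card : ℝ) ^ j := by
  rw [← mul_pow]
  gcongr
  exact_mod_cast card_divisors_mul_le b m

theorem sum_card_divisors_pow_succ_le (w : ℕ → ℝ) (hw : ∀ n, 0 ≤ w n) (j N : ℕ) :
    ∑ n ∈ Finset.Icc 1 N, (n.divisors.card : ℝ) ^ (j + 1) * w n ≤
      ∑ b ∈ Finset.Icc 1 N, ∑ m ∈ Finset.Icc 1 (N / b),
        (b.divisors.card : ℝ) ^ j * (m.divisors.card : ℝ) ^ j * w (b * m) := by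
  rw [← sum_Icc_sum_divisors
    (fun b m => (b.divisors.card : ℝ) ^ j * (m.divisors.card : ℝ) ^ j * w (b * m))]
  refine Finset.sum_le_sum fun n hn => ?_
  have : (n.divisors.card : ℝ) ^ (j + 1) * w n =
      ∑ b ∈ n.divisors, (n.divisors.card : ℝ) ^ j * w n := by
    rw [Finset.sum_const, nsmul_eq_mul]; ring
  rw [this]
  refine Finset.sum_le_sum fun b hb => ?_
  have h := Nat.mul_div_cancel' (Nat.dvd_of_mem_divisors hb)
  have h2 := card_divisors_mul_pow_le b (n / b) j
  rw [h] at h2 ⊢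
  exact mul_le_mul_of_nonneg_right h2 (hw n)

theorem sum_card_divisors_pow_div_le (j N : ℕ) :
    ∑ n ∈ Finset.Icc 1 N, (n.divisors.card : ℝ) ^ j * (n : ℝ)⁻¹ ≤
      (1 + Real.log N) ^ 2 ^ j := by
  induction j with
  | zero => simpa using sum_Icc_inv_le N
  | succ j ih =>
    refine (sum_card_divisors_pow_succ_le (fun n => (n : ℝ)⁻¹) (fun n => by positivity) j N).trans ?_
    calc _ ≤ ∑ b ∈ Finset.Icc 1 N, ∑ m ∈ Finset.Icc 1 N,
          ((b.divisors.card : ℝ) ^ j * (b : ℝ)⁻¹) * ((m.divisors.card : ℝ) ^ j * (m : ℝ)⁻¹) := by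
          refine Finset.sum_le_sum fun b hb => ?_
          refine (Finset.sum_le_sum_of_subset_of_nonneg
            (Finset.Icc_subset_Icc_right (Nat.div_le_self N b)) ?_).trans (le_of_eq ?_)
          · intros; positivity
          · refine Finset.sum_congr rfl fun m _ => ?_
            push_cast
            rw [mul_inv]; ring
      _ = (∑ b ∈ Finset.Icc 1 N, (b.divisors.card : ℝ) ^ j * (b : ℝ)⁻¹) ^ 2 := by
          rw [sq, Finset.sum_mul_sum]
      _ ≤ ((1 + Real.log N) ^ 2 ^ j) ^ 2 := by
          gcongr
      _ = _ := by rw [← pow_mul, pow_succ]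

theorem sum_card_divisors_pow_le (j N : ℕ) :
    ∑ n ∈ Finset.Icc 1 N, (n.divisors.card : ℝ) ^ j ≤ N * (1 + Real.log N) ^ 2 ^ j := by
  induction j generalizing N with
  | zero =>
    have := one_le_one_add_log N
    simp
    nlinarith [Nat.cast_nonneg (α := ℝ) N]
  | succ j ih =>
    have h := sum_card_divisors_pow_succ_le (fun _ => 1) (fun _ => zero_le_one) j N
    simp only [mul_one] at h
    refine h.trans ?_
    have h1 := one_le_one_add_log N
    calc _ ≤ ∑ b ∈ Finset.Icc 1 N, ((b.divisors.card : ℝ) ^ j * (b : ℝ)⁻¹) *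
          (N * (1 + Real.log N) ^ 2 ^ j) := by
          refine Finset.sum_le_sum fun b hb => ?_
          rw [← Finset.mul_sum, mul_assoc]
          refine mul_le_mul_of_nonneg_left ((ih (N / b)).trans ?_) (by positivity)
          rw [← mul_assoc]
          have h2 : ((N / b : ℕ) : ℝ) ≤ (b : ℝ)⁻¹ * N := by
            rw [mul_comm]; exact Nat.cast_div_le
          have h3 : Real.log ((N / b : ℕ) : ℝ) ≤ Real.log N := by
            rcases Nat.eq_zero_or_pos (N / b) with h0 | h0
            · rw [h0]; simpa using Real.log_natCast_nonneg N
            · exact Real.log_le_log (by exact_mod_cast h0) (by exact_mod_cast Nat.div_le_self N b)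
          have h4 := one_le_one_add_log (N / b)
          gcongr
      _ = (∑ b ∈ Finset.Icc 1 N, (b.divisors.card : ℝ) ^ j * (b : ℝ)⁻¹) *
          (N * (1 + Real.log N) ^ 2 ^ j) := by rw [Finset.sum_mul]
      _ ≤ (1 + Real.log N) ^ 2 ^ j * (N * (1 + Real.log N) ^ 2 ^ j) := by
          gcongr
          exact sum_card_divisors_pow_div_le j N
      _ = _ := by rw [pow_succ 2 j, pow_mul]; ring

theorem card_divisors_sq_le (q : ℕ) : (q.divisors.card) ^ 2 ≤ 4 * q := by
  rcases Nat.eq_zero_or_pos q with rfl | hq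
  · simp
  have h1 : q.divisors ⊆ (Finset.Icc 1 q.sqrt) ∪ (Finset.Icc 1 q.sqrt).image (fun d => q / d) := by
    intro d hd
    have hdq := Nat.dvd_of_mem_divisors hd
    have hd0 : 0 < d := Nat.pos_of_mem_divisors hd
    rw [Finset.mem_union]
    by_cases h : d ≤ q.sqrt
    · left; exact Finset.mem_Icc.2 ⟨hd0, h⟩
    · right
      refine Finset.mem_image.2 ⟨q / d, Finset.mem_Icc.2
        ⟨Nat.div_pos (Nat.le_of_dvd hq hdq) hd0, ?_⟩, Nat.div_div_self hdq hq.ne'⟩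
      rw [not_le, Nat.sqrt_lt'] at h
      rw [Nat.le_sqrt']
      obtain ⟨e, rfl⟩ := hdq
      rw [Nat.mul_div_cancel_left e hd0]
      have : e < d := by nlinarith
      nlinarith
  have h2 : q.divisors.card ≤ 2 * q.sqrt := by
    refine (Finset.card_le_card h1).trans ((Finset.card_union_le _ _).trans ?_)
    have := Finset.card_image_le (s := Finset.Icc 1 q.sqrt) (f := fun d => q / d)
    simp only [Nat.card_Icc, Nat.add_sub_cancel] at this ⊢
    omega
  calc q.divisors.card ^ 2 ≤ (2 * q.sqrt) ^ 2 := Nat.pow_le_pow_left h2 2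
    _ = 4 * q.sqrt ^ 2 := by ring
    _ ≤ 4 * q := Nat.mul_le_mul_left 4 (Nat.sqrt_le' q)

theorem sum_gcd_le (q N : ℕ) (hq : 0 < q) :
    ∑ n ∈ Finset.Icc 1 N, Nat.gcd n q ≤ N * q.divisors.card := by
  calc ∑ n ∈ Finset.Icc 1 N, Nat.gcd n q
      ≤ ∑ n ∈ Finset.Icc 1 N, ∑ g ∈ q.divisors, (if g ∣ n then g else 0) := by
        refine Finset.sum_le_sum fun n _ => ?_
        refine le_trans (le_of_eq ?_) (Finset.single_le_sum
          (f := fun g => if g ∣ n then g else 0) (fun _ _ => Nat.zero_le _)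
          (Nat.mem_divisors.2 ⟨Nat.gcd_dvd_right n q, hq.ne'⟩))
        simp [Nat.gcd_dvd_left]
    _ = ∑ g ∈ q.divisors, ∑ n ∈ Finset.Icc 1 N, (if g ∣ n then g else 0) := Finset.sum_comm
    _ ≤ ∑ g ∈ q.divisors, N := by
        refine Finset.sum_le_sum fun g _ => ?_
        rw [← Finset.sum_filter, Finset.sum_const, smul_eq_mul]
        have : ((Finset.Icc 1 N).filter (fun n => g ∣ n)).card = N / g := by
          rw [← Nat.Ioc_filter_dvd_card_eq_div]; rfl
        rw [this]
        exact Nat.div_mul_le_self N g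
    _ = N * q.divisors.card := by rw [Finset.sum_const, smul_eq_mul, mul_comm]

/-- The residues `ω` modulo `d` for which `q ω` is a square root of `-1` modulo `d`. -/
def rootSet (q d : ℕ) : Finset ℕ :=
  (Finset.range d).filter fun ω => d ∣ (q * ω) ^ 2 + 1

theorem mem_rootSet {q d ω : ℕ} : ω ∈ rootSet q d ↔ ω < d ∧ d ∣ (q * ω) ^ 2 + 1 := by
  simp [rootSet]

/-- Two square roots of `-1` modulo `d` with the same greatest common divisor of `d` and the
difference to a third one agree up to multiples of `d / 2`. -/
theorem dvd_two_mul_sub_of_gcd_eq {d v v' w : ℤ} (hv : d ∣ v ^ 2 + 1) (hv' : d ∣ v' ^ 2 + 1)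
    (hw : d ∣ w ^ 2 + 1) (hd : d ≠ 0) (h : Int.gcd d (v - w) = Int.gcd d (v' - w)) :
    d ∣ 2 * (v - v') := by
  have key : ∀ u : ℤ, d ∣ u ^ 2 + 1 → ∃ e : ℤ, d = (Int.gcd d (u - w) : ℤ) * e ∧
      (Int.gcd d (u - w) : ℤ) ∣ u - w ∧ e ∣ u + w := by
    intro u hu
    obtain ⟨e, he⟩ := Int.gcd_dvd_left d (u - w)
    obtain ⟨k, hk⟩ := Int.gcd_dvd_right d (u - w)
    have hg : (Int.gcd d (u - w) : ℤ) ≠ 0 := by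
      exact_mod_cast (Int.gcd_pos_of_ne_zero_left _ hd).ne'
    have hco : IsCoprime e k := by
      rw [Int.isCoprime_iff_gcd_eq_one]
      have h1 := Int.gcd_mul_left (Int.gcd d (u - w) : ℤ) e k
      rw [← he, ← hk, Int.natAbs_natCast] at h1
      have h2 : 0 < Int.gcd d (u - w) := Int.gcd_pos_of_ne_zero_left _ hd
      exact Nat.eq_of_mul_eq_mul_left h2 (by rw [mul_one]; exact h1.symm)
    refine ⟨e, he, ⟨k, hk⟩, ?_⟩
    have h3 : d ∣ (u - w) * (u + w) := by
      have : (u - w) * (u + w) = (u ^ 2 + 1) - (w ^ 2 + 1) := by ring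
      rw [this]; exact dvd_sub hu hw
    have h4 : (Int.gcd d (u - w) : ℤ) * e ∣ (Int.gcd d (u - w) : ℤ) * (k * (u + w)) := by
      rw [← he, ← mul_assoc, ← hk]; exact h3
    exact hco.dvd_of_dvd_mul_left ((mul_dvd_mul_iff_left hg).1 h4)
  obtain ⟨e, he, hg1, he1⟩ := key v hv
  obtain ⟨e', he', hg2, he2⟩ := key v' hv'
  rw [← h] at he' hg2
  set g : ℤ := (Int.gcd d (v - w) : ℤ) with hgdef
  have hg : g ≠ 0 := by
    rintro h0
    rw [h0, zero_mul] at he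
    exact hd he
  have hee : e = e' := mul_left_cancel₀ hg (he.symm.trans he')
  subst hee
  have hgv : g ∣ v - v' := by
    have : v - v' = (v - w) - (v' - w) := by ring
    rw [this]; exact dvd_sub hg1 hg2
  have hev : e ∣ v - v' := by
    have : v - v' = (v + w) - (v' + w) := by ring
    rw [this]; exact dvd_sub he1 he2
  have hcop : IsCoprime (Int.gcd g e : ℤ) w := by
    have h1 : (Int.gcd g e : ℤ) ∣ w ^ 2 + 1 :=
      (Int.gcd_dvd_left g e).trans ((Dvd.intro _ he.symm).trans hw)
    obtain ⟨t, ht⟩ := h1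
    exact ⟨t, -w, by linear_combination -ht⟩
  have h2 : (Int.gcd g e : ℤ) ∣ 2 := by
    have h3 : (Int.gcd g e : ℤ) ∣ w * 2 := by
      have : w * 2 = (v + w) - (v - w) := by ring
      rw [this]
      exact dvd_sub ((Int.gcd_dvd_right g e).trans he1) ((Int.gcd_dvd_left g e).trans hg1)
    exact hcop.dvd_of_dvd_mul_left h3
  obtain ⟨s, hs⟩ := h2
  obtain ⟨a, ha⟩ := hgv
  obtain ⟨b, hb⟩ := hev
  have hbez := Int.gcd_eq_gcd_ab g e
  rw [hs, he, hbez]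
  exact ⟨s * (g.gcdA e * b + g.gcdB e * a), by
    linear_combination s * g * g.gcdA e * hb + s * e * g.gcdB e * ha⟩

theorem card_rootSet_le {q d : ℕ} (hd : 0 < d) (hq : d.Coprime q) :
    (rootSet q d).card ≤ 2 * d.divisors.card := by
  rcases (rootSet q d).eq_empty_or_nonempty with h0 | ⟨w, hw⟩
  · simp [h0]
  refine Finset.card_le_mul_card_image_of_maps_to
    (f := fun ω : ℕ => Int.gcd d ((q * ω : ℤ) - q * w)) (fun ω _ => ?_) 2 fun g _ => ?_
  · refine Nat.mem_divisors.2 ⟨?_, hd.ne'⟩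
    exact_mod_cast Int.gcd_dvd_left (d : ℤ) ((q * ω : ℤ) - q * w)
  by_contra! hcard
  obtain ⟨a, ha, b, hb, c, hc, hab, hac, hbc⟩ := Finset.two_lt_card.1 hcard
  have key : ∀ x y : ℕ, x ∈ (rootSet q d).filter
      (fun ω : ℕ => Int.gcd d ((q * ω : ℤ) - q * w) = g) → y ∈ (rootSet q d).filter
      (fun ω : ℕ => Int.gcd d ((q * ω : ℤ) - q * w) = g) → x ≠ y →
      2 * ((x : ℤ) - y) = d ∨ 2 * ((x : ℤ) - y) = -d := by
    intro x y hx hy hxy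
    rw [Finset.mem_filter, mem_rootSet] at hx hy
    have hw' := (mem_rootSet.1 hw).2
    have h1 : (d : ℤ) ∣ 2 * ((q * x : ℤ) - q * y) :=
      dvd_two_mul_sub_of_gcd_eq (by exact_mod_cast hx.1.2) (by exact_mod_cast hy.1.2)
        (w := (q * w : ℤ)) (by exact_mod_cast hw') (by exact_mod_cast hd.ne')
        (hx.2.trans hy.2.symm)
    have h2 : (d : ℤ) ∣ q * (2 * ((x : ℤ) - y)) := by
      convert h1 using 1; ring
    obtain ⟨t, ht⟩ := (Nat.isCoprime_iff_coprime.2 hq).dvd_of_dvd_mul_left h2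
    have hx1 := hx.1.1
    have hy1 := hy.1.1
    have ht1 : t < 2 := by
      by_contra! h
      have : (d : ℤ) * 2 ≤ d * t := mul_le_mul_of_nonneg_left h (by omega)
      omega
    have ht2 : -2 < t := by
      by_contra! h
      have : (d : ℤ) * t ≤ d * (-2) := mul_le_mul_of_nonneg_left h (by omega)
      omega
    have ht3 : t = -1 ∨ t = 0 ∨ t = 1 := by omega
    rcases ht3 with rfl | rfl | rfl <;> omega
  have h1 := key a b ha hb hab
  have h2 := key b c hb hc hbc
  have h3 := key a c ha hc hac
  omega

theorem le_abs_sub_of_mem_rootSet {q d d' ω ω' : ℕ} {D : ℝ} (hD : 0 < D) (hq : 0 < q)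
    (hd : D < d) (hd2 : d ≤ 2 * D) (hd' : D < d') (hd2' : d' ≤ 2 * D)
    (hω : ω ∈ rootSet q d) (hω' : ω' ∈ rootSet q d') (hne : ¬(d = d' ∧ ω = ω')) (r : ℤ) :
    1 / (3 * D * q) ≤ |(ω : ℝ) / d - ω' / d' - r| := by
  rw [mem_rootSet] at hω hω'
  have h0 : (0 : ℝ) < d := hD.trans hd
  have h0' : (0 : ℝ) < d' := hD.trans hd'
  have hqr : (0 : ℝ) < q := by exact_mod_cast hq
  set v : ℤ := q * (ω - r * d) with hv
  set v' : ℤ := q * ω' with hv'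
  have hv1 : (d : ℤ) ∣ v ^ 2 + 1 := by
    have h1 : (d : ℤ) ∣ (q * ω) ^ 2 + 1 := by exact_mod_cast hω.2
    have h2 : v ^ 2 + 1 = ((q * ω) ^ 2 + 1) + d * (q ^ 2 * (-2 * ω * r + r ^ 2 * d)) := by
      rw [hv]; ring
    rw [h2]
    exact dvd_add h1 (dvd_mul_right _ _)
  have hv1' : (d' : ℤ) ∣ v' ^ 2 + 1 := by rw [hv']; exact_mod_cast hω'.2
  obtain ⟨s, hs⟩ := hv1
  obtain ⟨s', hs'⟩ := hv1'
  set A : ℤ := v * d' - v' * d with hA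
  have hK : A ^ 2 + ((d : ℤ) - d') ^ 2 =
      d * d' * (d' * s + d * s' - 2 * (v * v' + 1)) := by
    rw [hA]
    linear_combination (d' : ℤ) ^ 2 * hs + (d : ℤ) ^ 2 * hs'
  have hdz : (0 : ℤ) < d := by exact_mod_cast h0
  have hdz' : (0 : ℤ) < d' := by exact_mod_cast h0'
  have hpos : 0 < A ^ 2 + ((d : ℤ) - d') ^ 2 := by
    by_contra! hle
    have h1 : (d : ℤ) - d' = 0 := by nlinarith [sq_nonneg A, sq_nonneg ((d : ℤ) - d')]
    have h2 : A = 0 := by nlinarith [sq_nonneg A, sq_nonneg ((d : ℤ) - d')]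
    have h3 : (d : ℤ) = d' := by omega
    have h4 : d = d' := by exact_mod_cast h3
    subst h4
    have h5 : v = v' := by
      have : d * (v - v') = 0 := by rw [← h2, hA]; ring
      rcases mul_eq_zero.1 this with h | h <;> omega
    rw [hv, hv'] at h5
    have h6 : (ω : ℤ) - r * d = ω' := mul_left_cancel₀ (by exact_mod_cast hq.ne') h5
    have h7 : r = 0 := by
      have h8 : r * d < 1 * d := by have := hω.1; omega
      have h9 : (-1) * (d : ℤ) < r * d := by have := hω'.1; omega
      have := lt_of_mul_lt_mul_right h8 hdz.le
      have := lt_of_mul_lt_mul_right h9 hdz.le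
      omega
    rw [h7] at h6
    exact hne ⟨rfl, by omega⟩
  have hge : (d : ℤ) * d' ≤ A ^ 2 + ((d : ℤ) - d') ^ 2 := by
    rw [hK] at hpos ⊢
    have h1 := (mul_pos_iff_of_pos_left (mul_pos hdz hdz')).1 hpos
    nlinarith [mul_pos hdz hdz']
  have hger : (d : ℝ) * d' ≤ (A : ℝ) ^ 2 + ((d : ℝ) - d') ^ 2 := by exact_mod_cast hge
  have hA2 : (d : ℝ) * d' ≤ 2 * (A : ℝ) ^ 2 := by nlinarith
  have hid : (ω : ℝ) / d - ω' / d' - r = A / (q * (d * d')) := by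
    rw [hA, hv, hv']
    push_cast
    field_simp
    ring
  rw [hid]
  apply abs_le_of_sq_le_sq' _ (abs_nonneg _) |>.2
  rw [sq_abs, div_pow, div_pow, div_le_div_iff₀ (by positivity) (by positivity)]
  have h4 : (d : ℝ) * d' ≤ 4 * D ^ 2 := by nlinarith
  have h5 : ((d : ℝ) * d') ^ 2 ≤ 9 * D ^ 2 * A ^ 2 := by nlinarith [mul_pos h0 h0']
  nlinarith [mul_le_mul_of_nonneg_left h5 (sq_nonneg (q : ℝ))]

/-- The additive character `θ ↦ exp (2 π i θ)` of the real numbers. -/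
def ex (θ : ℝ) : ℂ := Complex.exp (2 * Real.pi * θ * Complex.I)

theorem ex_add (a b : ℝ) : ex (a + b) = ex a * ex b := by
  rw [ex, ex, ex, ← Complex.exp_add]
  congr 1
  push_cast
  ring

theorem norm_ex (a : ℝ) : ‖ex a‖ = 1 := by
  rw [ex]
  have : (2 * Real.pi * a * Complex.I : ℂ) = ((2 * Real.pi * a : ℝ) : ℂ) * Complex.I := by
    push_cast; ring
  rw [this, Complex.norm_exp_ofReal_mul_I]

theorem ex_intCast (n : ℤ) : ex n = 1 := by
  rw [ex, Complex.exp_eq_one_iff]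
  exact ⟨n, by push_cast; ring⟩

theorem ex_zero : ex 0 = 1 := by simp [ex]

theorem ex_nat_mul (n : ℕ) (a : ℝ) : ex (n * a) = ex a ^ n := by
  rw [ex, ex, ← Complex.exp_nat_mul]
  congr 1
  push_cast
  ring

theorem ex_add_intCast (a : ℝ) (n : ℤ) : ex (a + n) = ex a := by
  rw [ex_add, ex_intCast, mul_one]

theorem conj_ex (a : ℝ) : (starRingEnd ℂ) (ex a) = ex (-a) := by
  rw [ex, ex, ← Complex.exp_conj]
  congr 1
  simp [map_ofNat]

theorem four_mul_abs_le_norm_ex_sub_one {y : ℝ} (hy : |y| ≤ 1 / 2) : 4 * |y| ≤ ‖ex y - 1‖ := by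
  have h1 : ex y = Complex.exp (Complex.I * ((2 * Real.pi * y : ℝ) : ℂ)) := by
    rw [ex]; congr 1; push_cast; ring
  rw [h1, Complex.norm_exp_I_mul_ofReal_sub_one]
  have h2 : 2 * Real.pi * y / 2 = Real.pi * y := by ring
  rw [h2, norm_mul, Real.norm_eq_abs, Real.norm_eq_abs, abs_two]
  have h3 : |Real.sin (Real.pi * y)| = Real.sin (Real.pi * |y|) := by
    rcases le_total 0 y with h | h
    · rw [abs_of_nonneg h, abs_of_nonneg]
      rw [abs_of_nonneg h] at hy
      exact Real.sin_nonneg_of_nonneg_of_le_pi (by positivity) (by nlinarith [Real.pi_pos])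
    · rw [abs_of_nonpos h] at hy ⊢
      have : Real.pi * -y = -(Real.pi * y) := by ring
      rw [this, Real.sin_neg, abs_of_nonpos]
      have h4 : 0 ≤ Real.sin (Real.pi * -y) :=
        Real.sin_nonneg_of_nonneg_of_le_pi (by nlinarith [Real.pi_pos]) (by nlinarith [Real.pi_pos])
      rw [this, Real.sin_neg] at h4
      linarith
  rw [h3]
  have h5 := Real.mul_le_sin (x := Real.pi * |y|) (by positivity) (by nlinarith [Real.pi_pos])
  have h6 : 2 / Real.pi * (Real.pi * |y|) = 2 * |y| := by field_simp
  linarith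

theorem norm_sum_range_ex_le {θ y : ℝ} {r : ℤ} (hθ : θ = y + r) (hy : |y| ≤ 1 / 2) (hy0 : y ≠ 0)
    (K : ℕ) : ‖∑ n ∈ Finset.range K, ex (n * θ)‖ ≤ 1 / 2 * |y|⁻¹ := by
  have h1 : ∀ n ∈ Finset.range K, ex (n * θ) = ex y ^ n := fun n _ => by
    rw [ex_nat_mul, hθ, ex_add_intCast]
  rw [Finset.sum_congr rfl h1]
  have h2 := four_mul_abs_le_norm_ex_sub_one hy
  have h3 : 0 < |y| := abs_pos.2 hy0
  have h4 := geom_sum_mul (ex y) K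
  have h5 : ‖∑ n ∈ Finset.range K, ex y ^ n‖ * ‖ex y - 1‖ ≤ 2 := by
    rw [← norm_mul, h4]
    refine (norm_sub_le _ _).trans ?_
    rw [norm_pow, norm_ex, one_pow, norm_one]
    norm_num
  have h6 : ‖∑ n ∈ Finset.range K, ex y ^ n‖ * (4 * |y|) ≤ 2 :=
    (mul_le_mul_of_nonneg_left h2 (norm_nonneg _)).trans h5
  rw [← div_eq_mul_inv, le_div_iff₀ h3]
  linarith

theorem sum_le_mul_one_add_log {ι : Type*} (S : Finset ι) (m : ι → ℕ) (f : ι → ℝ) (C : ℝ) (M : ℕ)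
    (hC : 0 ≤ C) (hm : Set.InjOn m S) (hM : ∀ j ∈ S, m j ∈ Finset.Icc 1 M)
    (hf : ∀ j ∈ S, f j ≤ C * (m j : ℝ)⁻¹) : ∑ j ∈ S, f j ≤ C * (1 + Real.log M) := by
  classical
  calc ∑ j ∈ S, f j ≤ ∑ j ∈ S, C * (m j : ℝ)⁻¹ := Finset.sum_le_sum hf
    _ = ∑ n ∈ S.image m, C * (n : ℝ)⁻¹ := (Finset.sum_image (f := fun n : ℕ => C * (n : ℝ)⁻¹) hm).symm
    _ ≤ ∑ n ∈ Finset.Icc 1 M, C * (n : ℝ)⁻¹ := by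
        refine Finset.sum_le_sum_of_subset_of_nonneg ?_ fun _ _ _ => by positivity
        intro n hn
        obtain ⟨j, hj, rfl⟩ := Finset.mem_image.1 hn
        exact hM j hj
    _ = C * ∑ n ∈ Finset.Icc 1 M, (n : ℝ)⁻¹ := by rw [Finset.mul_sum]
    _ ≤ _ := mul_le_mul_of_nonneg_left (sum_Icc_inv_le M) hC

/-- The points `x i`, `i ∈ s`, have distance at least `Δ` from each other modulo `1`. -/
def IsSpacedMod {ι : Type*} (s : Finset ι) (x : ι → ℝ) (Δ : ℝ) : Prop :=
  ∀ i ∈ s, ∀ j ∈ s, i ≠ j → ∀ r : ℤ, Δ ≤ |x i - x j - r|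

theorem sum_inv_abs_sub_round_le {ι : Type*} [DecidableEq ι] {s : Finset ι} {x : ι → ℝ} {Δ : ℝ}
    (hΔ : 0 < Δ) (hΔ2 : Δ ≤ 1 / 2) (hs : IsSpacedMod s x Δ) {i : ι} (hi : i ∈ s) :
    ∑ j ∈ s.erase i, |x i - x j - round (x i - x j)|⁻¹ ≤ 4 / Δ * (1 + Real.log (1 / Δ)) := by
  set y : ι → ℝ := fun j => x i - x j - round (x i - x j) with hy
  set M : ℕ := ⌈1 / (2 * Δ)⌉₊ with hM
  have hM0 : (0 : ℝ) < M := by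
    exact_mod_cast Nat.ceil_pos.2 (by positivity)
  have hMle : (M : ℝ) ≤ 1 / Δ := by
    have h1 := Nat.ceil_lt_add_one (show 0 ≤ 1 / (2 * Δ) by positivity)
    have h2 : 1 / Δ = 1 / (2 * Δ) + 1 / (2 * Δ) := by field_simp; norm_num
    have h3 : 1 ≤ 1 / (2 * Δ) := by rw [le_div_iff₀ (by positivity)]; linarith
    linarith
  have hyΔ : ∀ j ∈ s.erase i, Δ ≤ |y j| := fun j hj =>
    hs i hi j (Finset.mem_of_mem_erase hj) (Finset.ne_of_mem_erase hj).symm _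
  have hy2 : ∀ j, |y j| ≤ 1 / 2 := fun j => abs_sub_round _
  set m : ι → ℕ := fun j => ⌊|y j| / Δ⌋₊ with hm
  have hm1 : ∀ j ∈ s.erase i, m j ∈ Finset.Icc 1 M := by
    intro j hj
    rw [Finset.mem_Icc]
    constructor
    · rw [hm, Nat.one_le_floor_iff, le_div_iff₀ hΔ, one_mul]
      exact hyΔ j hj
    · refine (Nat.floor_le_ceil _).trans (Nat.ceil_mono ?_)
      rw [div_le_div_iff₀ hΔ (by positivity)]
      nlinarith [hy2 j]
  have hf : ∀ j ∈ s.erase i, |y j|⁻¹ ≤ 1 / Δ * (m j : ℝ)⁻¹ := by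
    intro j hj
    have h1 : (1 : ℝ) ≤ m j := by exact_mod_cast (Finset.mem_Icc.1 (hm1 j hj)).1
    have h2 : (m j : ℝ) ≤ |y j| / Δ := Nat.floor_le (by positivity)
    rw [le_div_iff₀ hΔ] at h2
    rw [one_div, ← mul_inv]
    exact inv_anti₀ (by positivity) (by linarith)
  have hinj : ∀ j ∈ s.erase i, ∀ k ∈ s.erase i, (0 < y j ↔ 0 < y k) → m j = m k → j = k := by
    intro j hj k hk hsign hmm
    by_contra hne
    have h1 : m j ≤ |y j| / Δ := Nat.floor_le (by positivity)
    have h2 : |y j| / Δ < m j + 1 := Nat.lt_floor_add_one _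
    have h3 : m k ≤ |y k| / Δ := Nat.floor_le (by positivity)
    have h4 : |y k| / Δ < m k + 1 := Nat.lt_floor_add_one _
    rw [hmm] at h1 h2
    have h5 : |(|y j| - |y k|)| < Δ := by
      rw [le_div_iff₀ hΔ] at h1 h3
      rw [div_lt_iff₀ hΔ] at h2 h4
      rw [abs_lt]
      constructor <;> linarith
    have h6 : |y k - y j| < Δ := by
      by_cases hp : 0 < y j
      · have hp' := hsign.1 hp
        rw [abs_of_pos hp, abs_of_pos hp'] at h5
        rwa [abs_sub_comm]
      · have hp' : ¬ 0 < y k := fun h => hp (hsign.2 h)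
        rw [not_lt] at hp hp'
        rw [abs_of_nonpos hp, abs_of_nonpos hp'] at h5
        convert h5 using 2; ring
    have h7 := hs j (Finset.mem_of_mem_erase hj) k (Finset.mem_of_mem_erase hk) hne
      (round (x i - x k) - round (x i - x j))
    have h8 : x j - x k - ((round (x i - x k) - round (x i - x j) : ℤ) : ℝ) = y k - y j := by
      rw [hy]; push_cast; ring
    rw [h8] at h7
    linarith
  have hlog : 1 + Real.log M ≤ 1 + Real.log (1 / Δ) := by
    gcongr
  have hpos := sum_le_mul_one_add_log ((s.erase i).filter (fun j => 0 < y j)) m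
    (fun j => |y j|⁻¹) (1 / Δ) M (by positivity)
    (fun j hj k hk h => by
      rw [Finset.mem_coe, Finset.mem_filter] at hj hk
      exact hinj j hj.1 k hk.1 (by simp [hj.2, hk.2]) h)
    (fun j hj => hm1 j (Finset.mem_filter.1 hj).1) (fun j hj => hf j (Finset.mem_filter.1 hj).1)
  have hneg := sum_le_mul_one_add_log ((s.erase i).filter (fun j => ¬ 0 < y j)) m
    (fun j => |y j|⁻¹) (1 / Δ) M (by positivity)
    (fun j hj k hk h => by
      rw [Finset.mem_coe, Finset.mem_filter] at hj hk
      exact hinj j hj.1 k hk.1 (by simp [hj.2, hk.2]) h)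
    (fun j hj => hm1 j (Finset.mem_filter.1 hj).1) (fun j hj => hf j (Finset.mem_filter.1 hj).1)
  rw [← Finset.sum_filter_add_sum_filter_not (s.erase i) (fun j => 0 < y j)]
  have hL : (0 : ℝ) ≤ 1 + Real.log M := by linarith [one_le_one_add_log M]
  have h9 : 1 / Δ * (1 + Real.log M) ≤ 1 / Δ * (1 + Real.log (1 / Δ)) := by gcongr
  have h10 : 0 ≤ 1 / Δ * (1 + Real.log M) := by positivity
  have h11 : 4 / Δ * (1 + Real.log (1 / Δ)) = 4 * (1 / Δ * (1 + Real.log (1 / Δ))) := by ring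
  rw [h11]
  linarith

/-- The large sieve inequality in its dual form, with a logarithmic loss. -/
theorem sum_range_norm_sq_le {ι : Type*} {s : Finset ι} {x : ι → ℝ} {Δ : ℝ}
    (hΔ : 0 < Δ) (hΔ2 : Δ ≤ 1 / 2) (hs : IsSpacedMod s x Δ) (c : ι → ℂ) (K : ℕ) :
    ∑ n ∈ Finset.range K, ‖∑ i ∈ s, c i * ex (n * x i)‖ ^ 2 ≤
      (K + 2 / Δ * (1 + Real.log (1 / Δ))) * ∑ i ∈ s, ‖c i‖ ^ 2 := by
  classical
  set G : ι → ι → ℂ := fun i j => ∑ n ∈ Finset.range K, ex (n * (x i - x j)) with hG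
  have h1 : (((∑ n ∈ Finset.range K, ‖∑ i ∈ s, c i * ex (n * x i)‖ ^ 2 : ℝ)) : ℂ) =
      ∑ i ∈ s, ∑ j ∈ s, c i * (starRingEnd ℂ) (c j) * G i j := by
    push_cast
    have h2 : ∀ n ∈ Finset.range K, ((‖∑ i ∈ s, c i * ex (n * x i)‖ : ℂ)) ^ 2 =
        ∑ i ∈ s, ∑ j ∈ s, c i * (starRingEnd ℂ) (c j) * ex (n * (x i - x j)) := by
      intro n _
      rw [← Complex.mul_conj', map_sum, Finset.sum_mul_sum]
      refine Finset.sum_congr rfl fun i _ => Finset.sum_congr rfl fun j _ => ?_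
      have h3 : (n : ℝ) * (x i - x j) = n * x i + -(n * x j) := by ring
      rw [map_mul, conj_ex, h3, ex_add]
      ring
    rw [Finset.sum_congr rfl h2, Finset.sum_comm]
    refine Finset.sum_congr rfl fun i _ => ?_
    rw [Finset.sum_comm]
    refine Finset.sum_congr rfl fun j _ => ?_
    rw [hG, Finset.mul_sum]
  have h4 : ∑ n ∈ Finset.range K, ‖∑ i ∈ s, c i * ex (n * x i)‖ ^ 2 ≤
      ∑ i ∈ s, ∑ j ∈ s, ‖c i‖ * ‖c j‖ * ‖G i j‖ := by
    have h5 : ∑ n ∈ Finset.range K, ‖∑ i ∈ s, c i * ex (n * x i)‖ ^ 2 =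
        ‖(((∑ n ∈ Finset.range K, ‖∑ i ∈ s, c i * ex (n * x i)‖ ^ 2 : ℝ)) : ℂ)‖ := by
      rw [Complex.norm_real, Real.norm_of_nonneg (by positivity)]
    rw [h5, h1]
    refine (norm_sum_le _ _).trans (Finset.sum_le_sum fun i _ => (norm_sum_le _ _).trans
      (Finset.sum_le_sum fun j _ => ?_))
    rw [norm_mul, norm_mul, RCLike.norm_conj]
  have hGsymm : ∀ i j, ‖G i j‖ = ‖G j i‖ := by
    intro i j
    rw [← RCLike.norm_conj]
    congr 1
    rw [hG, map_sum]
    refine Finset.sum_congr rfl fun n _ => ?_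
    rw [conj_ex]
    congr 1
    ring
  have hrow : ∀ i ∈ s, ∑ j ∈ s, ‖G i j‖ ≤ K + 2 / Δ * (1 + Real.log (1 / Δ)) := by
    intro i hi
    rw [← Finset.add_sum_erase s _ hi]
    refine add_le_add ?_ ?_
    · rw [hG]
      simp [ex_zero]
    · calc ∑ j ∈ s.erase i, ‖G i j‖
          ≤ ∑ j ∈ s.erase i, 1 / 2 * |x i - x j - round (x i - x j)|⁻¹ := by
            refine Finset.sum_le_sum fun j hj => ?_
            have h6 := hs i hi j (Finset.mem_of_mem_erase hj) (Finset.ne_of_mem_erase hj).symm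
              (round (x i - x j))
            refine norm_sum_range_ex_le (r := round (x i - x j)) (by ring) (abs_sub_round _) ?_ K
            intro h0
            rw [h0, abs_zero] at h6
            linarith
        _ = 1 / 2 * ∑ j ∈ s.erase i, |x i - x j - round (x i - x j)|⁻¹ := by
            rw [Finset.mul_sum]
        _ ≤ 1 / 2 * (4 / Δ * (1 + Real.log (1 / Δ))) := by
            gcongr
            exact sum_inv_abs_sub_round_le hΔ hΔ2 hs hi
        _ = _ := by ring
  refine h4.trans ?_
  calc ∑ i ∈ s, ∑ j ∈ s, ‖c i‖ * ‖c j‖ * ‖G i j‖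
      ≤ ∑ i ∈ s, ∑ j ∈ s, (1 / 2 * (‖c i‖ ^ 2 * ‖G i j‖) + 1 / 2 * (‖c j‖ ^ 2 * ‖G j i‖)) := by
        refine Finset.sum_le_sum fun i _ => Finset.sum_le_sum fun j _ => ?_
        rw [hGsymm j i]
        have : 0 ≤ (‖c i‖ - ‖c j‖) ^ 2 * ‖G i j‖ := by positivity
        nlinarith
    _ = ∑ i ∈ s, ∑ j ∈ s, ‖c i‖ ^ 2 * ‖G i j‖ := by
        have h7 : ∑ i ∈ s, ∑ j ∈ s, 1 / 2 * (‖c j‖ ^ 2 * ‖G j i‖) =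
            ∑ i ∈ s, ∑ j ∈ s, 1 / 2 * (‖c i‖ ^ 2 * ‖G i j‖) := Finset.sum_comm
        simp_rw [Finset.sum_add_distrib]
        rw [h7]
        simp_rw [← Finset.mul_sum]
        ring
    _ = ∑ i ∈ s, ‖c i‖ ^ 2 * ∑ j ∈ s, ‖G i j‖ := by simp_rw [Finset.mul_sum]
    _ ≤ ∑ i ∈ s, ‖c i‖ ^ 2 * (K + 2 / Δ * (1 + Real.log (1 / Δ))) :=
        Finset.sum_le_sum fun i hi => mul_le_mul_of_nonneg_left (hrow i hi) (by positivity)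
    _ = _ := by rw [← Finset.sum_mul, mul_comm]

theorem sum_Icc_norm_sq_le {ι : Type*} {s : Finset ι} {x : ι → ℝ} {Δ : ℝ}
    (hΔ : 0 < Δ) (hΔ2 : Δ ≤ 1 / 2) (hs : IsSpacedMod s x Δ) (c : ι → ℂ) (Z : ℕ) :
    ∑ n ∈ Finset.Icc (-Z : ℤ) Z, ‖∑ i ∈ s, c i * ex (n * x i)‖ ^ 2 ≤
      (2 * Z + 1 + 2 / Δ * (1 + Real.log (1 / Δ))) * ∑ i ∈ s, ‖c i‖ ^ 2 := by
  have h := sum_range_norm_sq_le hΔ hΔ2 hs (fun i => c i * ex (-Z * x i)) (2 * Z + 1)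
  simp only [norm_mul, norm_ex, mul_one] at h
  push_cast at h
  refine le_trans (le_of_eq ?_) h
  refine Finset.sum_bij' (fun n _ => (n + Z).toNat) (fun n _ => (n : ℤ) - Z) ?_ ?_ ?_ ?_ ?_
  · intro n hn
    rw [Finset.mem_Icc] at hn
    rw [Finset.mem_range]
    omega
  · intro n hn
    rw [Finset.mem_range] at hn
    rw [Finset.mem_Icc]
    omega
  · intro n hn
    rw [Finset.mem_Icc] at hn
    omega
  · intro n hn
    omega
  · intro n hn
    rw [Finset.mem_Icc] at hn
    have h1 : (((n + Z).toNat : ℕ) : ℝ) = n + Z := by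
      have : (((n + Z).toNat : ℕ) : ℤ) = n + Z := Int.toNat_of_nonneg (by omega)
      exact_mod_cast this
    rw [h1]
    congr 2
    refine Finset.sum_congr rfl fun i _ => ?_
    rw [mul_assoc, ← ex_add]
    congr 2
    ring

theorem sum_card_divisors_natAbs_le (B : Finset ℤ) (Z : ℕ) (hB : ∀ h ∈ B, h ≠ 0 ∧ |h| ≤ Z) :
    ∑ h ∈ B, (h.natAbs.divisors.card : ℝ) ≤ 2 * (Z * (1 + Real.log Z) ^ 2) := by
  have h1 := sum_card_divisors_pow_le 1 Z
  simp only [pow_one] at h1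
  have key : ∀ S : Finset ℤ, S ⊆ B → Set.InjOn Int.natAbs (S : Set ℤ) →
      ∑ h ∈ S, (h.natAbs.divisors.card : ℝ) ≤ Z * (1 + Real.log Z) ^ 2 := by
    intro S hS hinj
    rw [← Finset.sum_image (f := fun n : ℕ => (n.divisors.card : ℝ)) hinj]
    refine (Finset.sum_le_sum_of_subset_of_nonneg ?_ fun _ _ _ => by positivity).trans h1
    intro n hn
    obtain ⟨h, hh, rfl⟩ := Finset.mem_image.1 hn
    have h0 := hB h (hS hh)
    have h00 := h0.2
    rw [Int.abs_eq_natAbs] at h00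
    rw [Finset.mem_Icc]
    omega
  have h2 := key (B.filter (fun h => 0 < h)) (Finset.filter_subset _ _) (by
    intro a ha b hb hab
    rw [Finset.mem_coe, Finset.mem_filter] at ha hb
    omega)
  have h3 := key (B.filter (fun h => ¬ 0 < h)) (Finset.filter_subset _ _) (by
    intro a ha b hb hab
    rw [Finset.mem_coe, Finset.mem_filter] at ha hb
    omega)
  rw [← Finset.sum_filter_add_sum_filter_not B (fun h => 0 < h)]
  linarith

theorem card_filter_mul_eq_le (P : Finset ℕ) (w : ℕ → ℕ) (hw : ∀ n ∈ P, 0 < w n)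
    (hinj : Set.InjOn w P) (B : Finset ℤ) {N : ℤ} (hN : N ≠ 0) :
    ((B ×ˢ P).filter (fun p => p.1 * (w p.2 : ℤ) = N)).card ≤ N.natAbs.divisors.card := by
  refine Finset.card_le_card_of_injOn (fun p => w p.2) ?_ ?_
  · intro p hp
    rw [Finset.mem_coe, Finset.mem_filter] at hp
    refine Finset.mem_coe.2 (Nat.mem_divisors.2 ⟨?_, by omega⟩)
    exact Int.natCast_dvd.1 ⟨p.1, by rw [← hp.2, mul_comm]⟩
  · rintro ⟨h, n⟩ hp ⟨h', n'⟩ hp' heq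
    rw [Finset.mem_coe, Finset.mem_filter, Finset.mem_product] at hp hp'
    have hn : n = n' := hinj hp.1.2 hp'.1.2 heq
    subst hn
    have h0 : ((w n : ℕ) : ℤ) ≠ 0 := by exact_mod_cast (hw n hp.1.2).ne'
    have : h = h' := mul_right_cancel₀ h0 (hp.2.trans hp'.2.symm)
    rw [this]

theorem sieve_length_nonneg {Δ : ℝ} (hΔ : 0 < Δ) (hΔ2 : Δ ≤ 1 / 2) (Z W : ℕ) :
    (0 : ℝ) ≤ 2 * Z * W + 1 + 2 / Δ * (1 + Real.log (1 / Δ)) := by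
  have : 0 ≤ Real.log (1 / Δ) := by
    refine Real.log_nonneg ?_
    rw [le_div_iff₀ hΔ]
    linarith
  positivity

/-- The bilinear large sieve: frequencies of the form `h w(n)`. -/
theorem norm_sum_bilinear_sq_le {ι : Type*} {s : Finset ι} {x : ι → ℝ} {Δ : ℝ}
    (hΔ : 0 < Δ) (hΔ2 : Δ ≤ 1 / 2) (hs : IsSpacedMod s x Δ) (c : ι → ℂ)
    (P : Finset ℕ) (w : ℕ → ℕ) (hw : ∀ n ∈ P, 0 < w n) (hinj : Set.InjOn w P)
    (W : ℕ) (hW : ∀ n ∈ P, w n ≤ W)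
    (B : Finset ℤ) (Z : ℕ) (hB : ∀ h ∈ B, h ≠ 0 ∧ |h| ≤ Z)
    (a : ℤ → ℕ → ℂ) (v : ℝ) (ha : ∀ h ∈ B, ∀ n ∈ P, ‖a h n‖ ≤ v) :
    ‖∑ i ∈ s, c i * ∑ h ∈ B, ∑ n ∈ P, a h n * ex (h * w n * x i)‖ ^ 2 ≤
      v ^ 2 * ((∑ i ∈ s, ‖c i‖ ^ 2) * (2 * Z * W + 1 + 2 / Δ * (1 + Real.log (1 / Δ))) *
        (2 * (Z * (1 + Real.log Z) ^ 2) * ∑ n ∈ P, ((w n).divisors.card : ℝ))) := by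
  classical
  set E : ℤ → ℂ := fun N => ∑ i ∈ s, c i * ex (N * x i) with hE
  set τ : ℤ → ℝ := fun N => (N.natAbs.divisors.card : ℝ) with hτ
  set f : ℤ × ℕ → ℤ := fun p => p.1 * (w p.2 : ℤ) with hf
  have hf0 : ∀ p ∈ B ×ˢ P, f p ≠ 0 := by
    rintro ⟨h, n⟩ hp
    rw [Finset.mem_product] at hp
    exact mul_ne_zero (hB h hp.1).1 (by exact_mod_cast (hw n hp.2).ne')
  have hτpos : ∀ N : ℤ, N ≠ 0 → 0 < τ N := by
    intro N hN
    have : 0 < N.natAbs.divisors.card :=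
      Finset.card_pos.2 ⟨1, Nat.one_mem_divisors.2 (Int.natAbs_ne_zero.2 hN)⟩
    exact Nat.cast_pos.2 this
  have h1 : ∑ i ∈ s, c i * ∑ h ∈ B, ∑ n ∈ P, a h n * ex (h * w n * x i) =
      ∑ p ∈ B ×ˢ P, a p.1 p.2 * E (f p) := by
    rw [Finset.sum_product]
    simp_rw [hE, hf, Finset.mul_sum]
    rw [Finset.sum_comm]
    refine Finset.sum_congr rfl fun h _ => ?_
    rw [Finset.sum_comm]
    refine Finset.sum_congr rfl fun n _ => Finset.sum_congr rfl fun i _ => ?_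
    push_cast
    ring
  have h2 : ‖∑ p ∈ B ×ˢ P, a p.1 p.2 * E (f p)‖ ^ 2 ≤
      (∑ p ∈ B ×ˢ P, (Real.sqrt (τ (f p)) * (‖E (f p)‖ / Real.sqrt (τ (f p)))) * v) ^ 2 := by
    refine pow_le_pow_left₀ (norm_nonneg _) ((norm_sum_le _ _).trans
      (Finset.sum_le_sum fun p hp => ?_)) 2
    have h3 : 0 < Real.sqrt (τ (f p)) := Real.sqrt_pos.2 (hτpos _ (hf0 p hp))
    rw [mul_div_cancel₀ _ h3.ne', norm_mul, mul_comm]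
    rw [Finset.mem_product] at hp
    exact mul_le_mul_of_nonneg_left (ha _ hp.1 _ hp.2) (norm_nonneg _)
  rw [h1]
  refine h2.trans ?_
  rw [← Finset.sum_mul, mul_pow, mul_comm]
  refine mul_le_mul_of_nonneg_left ?_ (sq_nonneg v)
  refine (Finset.sum_mul_sq_le_sq_mul_sq _ _ _).trans ?_
  rw [mul_comm]
  refine mul_le_mul ?_ ?_ (Finset.sum_nonneg fun p _ => sq_nonneg _) ?_
  · calc ∑ p ∈ B ×ˢ P, (‖E (f p)‖ / Real.sqrt (τ (f p))) ^ 2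
        = ∑ p ∈ B ×ˢ P, ‖E (f p)‖ ^ 2 / τ (f p) := by
          refine Finset.sum_congr rfl fun p _ => ?_
          rw [div_pow, Real.sq_sqrt (by rw [hτ]; positivity)]
      _ = ∑ N ∈ Finset.Icc (-(Z * W : ℕ) : ℤ) (Z * W : ℕ),
          ∑ p ∈ (B ×ˢ P).filter (fun p => f p = N), ‖E (f p)‖ ^ 2 / τ (f p) := by
          refine (Finset.sum_fiberwise_of_maps_to (fun p hp => ?_) _).symm
          rw [Finset.mem_product] at hp
          rw [Finset.mem_Icc, ← abs_le, hf, abs_mul, Nat.abs_cast]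
          push_cast
          exact mul_le_mul (hB _ hp.1).2 (by exact_mod_cast hW _ hp.2) (by positivity)
            (by positivity)
      _ ≤ ∑ N ∈ Finset.Icc (-(Z * W : ℕ) : ℤ) (Z * W : ℕ), ‖E N‖ ^ 2 := by
          refine Finset.sum_le_sum fun N _ => ?_
          rw [Finset.sum_congr rfl (g := fun _ => ‖E N‖ ^ 2 / τ N) (fun p hp => by
            rw [(Finset.mem_filter.1 hp).2]), Finset.sum_const, nsmul_eq_mul]
          by_cases hN : N = 0
          · have : (B ×ˢ P).filter (fun p => f p = N) = ∅ := by
              rw [Finset.filter_eq_empty_iff]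
              intro p hp h
              exact hf0 p hp (h.trans hN)
            rw [this]
            simp
          · rw [mul_div_assoc', div_le_iff₀ (hτpos N hN), mul_comm]
            refine mul_le_mul_of_nonneg_left ?_ (by positivity)
            exact Nat.cast_le.2 (card_filter_mul_eq_le P w hw hinj B hN)
      _ ≤ _ := by
          have h4 := sum_Icc_norm_sq_le hΔ hΔ2 hs c (Z * W)
          push_cast at h4 ⊢
          rw [mul_comm (∑ i ∈ s, ‖c i‖ ^ 2), mul_assoc (2 : ℝ)]
          exact h4
  · calc ∑ p ∈ B ×ˢ P, Real.sqrt (τ (f p)) ^ 2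
        = ∑ h ∈ B, ∑ n ∈ P, τ (h * (w n : ℤ)) := by
          rw [Finset.sum_product]
          refine Finset.sum_congr rfl fun h _ => Finset.sum_congr rfl fun n _ => ?_
          rw [Real.sq_sqrt (by rw [hτ]; positivity)]
      _ ≤ ∑ h ∈ B, ∑ n ∈ P, τ h * ((w n).divisors.card : ℝ) := by
          refine Finset.sum_le_sum fun h _ => Finset.sum_le_sum fun n _ => ?_
          rw [hτ]
          simp only [Int.natAbs_mul, Int.natAbs_natCast]
          exact_mod_cast card_divisors_mul_le _ _
      _ = (∑ h ∈ B, τ h) * ∑ n ∈ P, ((w n).divisors.card : ℝ) := by rw [Finset.sum_mul_sum]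
      _ ≤ _ := mul_le_mul_of_nonneg_right (sum_card_divisors_natAbs_le B Z hB)
          (Finset.sum_nonneg fun _ _ => Nat.cast_nonneg _)
  · exact mul_nonneg (Finset.sum_nonneg fun i _ => sq_nonneg _) (sieve_length_nonneg hΔ hΔ2 Z W)

theorem norm_sum_bilinear_integral_le {ι : Type*} {s : Finset ι} {x : ι → ℝ} {Δ : ℝ}
    (hΔ : 0 < Δ) (hΔ2 : Δ ≤ 1 / 2) (hs : IsSpacedMod s x Δ) (c : ι → ℂ)
    (P : Finset ℕ) (w : ℕ → ℕ) (hw : ∀ n ∈ P, 0 < w n) (hinj : Set.InjOn w P)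
    (W : ℕ) (hW : ∀ n ∈ P, w n ≤ W)
    (B : Finset ℤ) (Z : ℕ) (hB : ∀ h ∈ B, h ≠ 0 ∧ |h| ≤ Z)
    (a : ℤ → ℕ → ℂ) (v : ℝ) (hv : 0 ≤ v) (ha : ∀ h ∈ B, ∀ n ∈ P, ‖a h n‖ ≤ v)
    (g : ι → ℝ → ℂ) (hg : ∀ i, Continuous (g i)) (G : ℝ) (hG : 0 ≤ G) (hgG : ∀ i u, ‖g i u‖ ≤ G)
    (U : ℝ) (hU : 0 ≤ U) :
    ‖∑ i ∈ s, c i * ∑ h ∈ B, ∑ n ∈ P, a h n * ex (h * w n * x i) *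
        ∫ u in (-U)..U, g i u * ex (-(h * u))‖ ≤
      2 * U * G * v * Real.sqrt ((∑ i ∈ s, ‖c i‖ ^ 2) *
        (2 * Z * W + 1 + 2 / Δ * (1 + Real.log (1 / Δ))) *
        (2 * (Z * (1 + Real.log Z) ^ 2) * ∑ n ∈ P, ((w n).divisors.card : ℝ))) := by
  have hex : ∀ h : ℤ, Continuous fun u : ℝ => ex (-(h * u)) := by
    intro h
    unfold ex
    fun_prop
  have h1 : ∑ i ∈ s, c i * ∑ h ∈ B, ∑ n ∈ P, a h n * ex (h * w n * x i) *
        ∫ u in (-U)..U, g i u * ex (-(h * u)) =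
      ∫ u in (-U)..U, ∑ i ∈ s, (c i * g i u) * ∑ h ∈ B, ∑ n ∈ P,
        (a h n * ex (-(h * u))) * ex (h * w n * x i) := by
    rw [intervalIntegral.integral_finsetSum]
    · refine Finset.sum_congr rfl fun i _ => ?_
      simp_rw [Finset.mul_sum]
      rw [intervalIntegral.integral_finsetSum]
      · refine Finset.sum_congr rfl fun h _ => ?_
        rw [intervalIntegral.integral_finsetSum]
        · refine Finset.sum_congr rfl fun n _ => ?_
          rw [← intervalIntegral.integral_const_mul, ← intervalIntegral.integral_const_mul]
          refine intervalIntegral.integral_congr fun u _ => ?_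
          ring
        · intro n _
          have := hg i
          have := hex h
          exact Continuous.intervalIntegrable (by fun_prop) _ _
      · intro h _
        have := hg i
        have := hex h
        exact Continuous.intervalIntegrable (by fun_prop) _ _
    · intro i _
      have := hg i
      exact Continuous.intervalIntegrable (by fun_prop) _ _
  rw [h1]
  set R : ℝ := (2 * Z * W + 1 + 2 / Δ * (1 + Real.log (1 / Δ))) *
        (2 * (Z * (1 + Real.log Z) ^ 2) * ∑ n ∈ P, ((w n).divisors.card : ℝ)) with hR
  have hR0 : 0 ≤ R := mul_nonneg (sieve_length_nonneg hΔ hΔ2 Z W)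
    (mul_nonneg (by positivity) (Finset.sum_nonneg fun _ _ => Nat.cast_nonneg _))
  have hc0 : 0 ≤ ∑ i ∈ s, ‖c i‖ ^ 2 := Finset.sum_nonneg fun i _ => sq_nonneg _
  clear_value R
  have h2 : ∀ u ∈ Set.uIoc (-U) U, ‖∑ i ∈ s, (c i * g i u) * ∑ h ∈ B, ∑ n ∈ P,
        (a h n * ex (-(h * u))) * ex (h * w n * x i)‖ ≤
        G * v * Real.sqrt ((∑ i ∈ s, ‖c i‖ ^ 2) * R) := by
    intro u _
    have h3 := norm_sum_bilinear_sq_le hΔ hΔ2 hs (fun i => c i * g i u) P w hw hinj W hW B Z hB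
      (fun h n => a h n * ex (-(h * u))) v (fun h hh n hn => by
        rw [norm_mul, norm_ex, mul_one]; exact ha h hh n hn)
    rw [mul_assoc (∑ i ∈ s, _), ← hR] at h3
    refine abs_le_of_sq_le_sq' ?_ (mul_nonneg (mul_nonneg hG hv) (Real.sqrt_nonneg _)) |>.2
    refine h3.trans ?_
    rw [mul_pow, mul_pow, Real.sq_sqrt (mul_nonneg hc0 hR0)]
    have h4 : ∑ i ∈ s, ‖c i * g i u‖ ^ 2 ≤ G ^ 2 * ∑ i ∈ s, ‖c i‖ ^ 2 := by
      rw [Finset.mul_sum]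
      refine Finset.sum_le_sum fun i _ => ?_
      rw [norm_mul, mul_pow, mul_comm]
      gcongr
      exact hgG i u
    calc v ^ 2 * ((∑ i ∈ s, ‖c i * g i u‖ ^ 2) * R)
        ≤ v ^ 2 * ((G ^ 2 * ∑ i ∈ s, ‖c i‖ ^ 2) * R) := by gcongr
      _ = _ := by ring
  refine (intervalIntegral.norm_integral_le_of_norm_le_const h2).trans (le_of_eq ?_)
  have h5 : |U - -U| = 2 * U := by rw [abs_of_nonneg] <;> linarith
  rw [h5, mul_assoc (∑ i ∈ s, ‖c i‖ ^ 2), ← hR]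
  ring

/-- The Fourier coefficient `∫ f(u) exp (-2 π i h u) du`. -/
def fcoeff (f : ℝ → ℂ) (h : ℤ) : ℂ := ∫ u : ℝ, f u * ex (-(h * u))

theorem fcoeff_eq_fourier (f : ℝ → ℂ) (h : ℤ) : fcoeff f h = 𝓕 f (h : ℝ) := by
  rw [fcoeff, Real.fourier_real_eq_integral_exp_smul]
  refine MeasureTheory.integral_congr_ae (Filter.Eventually.of_forall fun u => ?_)
  simp only [smul_eq_mul, ex]
  rw [mul_comm]
  congr 2
  push_cast
  ring

theorem summable_norm_fcoeff {f : ℝ → ℂ} (hf : ContDiff ℝ ((⊤ : ℕ∞) : WithTop ℕ∞) f)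
    (hfc : HasCompactSupport f) : Summable fun h : ℤ => ‖fcoeff f h‖ := by
  have h1 : Summable fun h : ℤ => fcoeff f h := by
    have h2 := (𝓕 (hfc.toSchwartzMap hf)).isBigO_cocompact_rpow (-2)
    have h3 : Summable fun h : ℤ => (𝓕 (hfc.toSchwartzMap hf)) (h : ℝ) :=
      summable_of_isBigO (Real.summable_abs_int_rpow one_lt_two)
        (h2.comp_tendsto Int.tendsto_coe_cofinite)
    refine h3.congr fun h => ?_
    rw [fcoeff_eq_fourier, SchwartzMap.fourier_coe]
    rfl
  exact h1.norm

theorem tsum_comp_add_eq_tsum_fcoeff {f : ℝ → ℂ} (hf : ContDiff ℝ ((⊤ : ℕ∞) : WithTop ℕ∞) f)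
    (hfc : HasCompactSupport f) (y : ℝ) :
    ∑' j : ℤ, f (y + j) = ∑' h : ℤ, fcoeff f h * ex (h * y) := by
  have h1 := SchwartzMap.tsum_eq_tsum_fourier (hfc.toSchwartzMap hf) y
  simp only [SchwartzMap.fourier_coe] at h1
  refine (show ∑' j : ℤ, f (y + j) = _ from h1).trans (tsum_congr fun h => ?_)
  rw [fcoeff_eq_fourier, fourier_coe_apply]
  refine congrArg₂ _ rfl ?_
  rw [ex]
  congr 1
  push_cast
  ring

theorem fcoeff_eq_intervalIntegral {f : ℝ → ℂ} {U : ℝ} (hU : 0 ≤ U) (hf : ∀ u, U < |u| → f u = 0)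
    (h : ℤ) : fcoeff f h = ∫ u in (-U)..U, f u * ex (-(h * u)) := by
  rw [intervalIntegral.integral_of_le (by linarith), fcoeff,
    ← MeasureTheory.integral_Icc_eq_integral_Ioc, MeasureTheory.setIntegral_eq_integral_of_forall_compl_eq_zero]
  intro u hu
  rw [hf u, zero_mul]
  by_contra! hle
  exact hu ⟨by linarith [neg_abs_le u], by linarith [le_abs_self u]⟩

theorem continuous_iteratedDeriv_of_smooth {f : ℝ → ℂ}
    (hf : ContDiff ℝ ((⊤ : ℕ∞) : WithTop ℕ∞) f) (n : ℕ) : Continuous (iteratedDeriv n f) :=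
  hf.continuous_iteratedDeriv n (by exact_mod_cast le_top)

theorem fcoeff_iteratedDeriv {f : ℝ → ℂ} (hf : ContDiff ℝ ((⊤ : ℕ∞) : WithTop ℕ∞) f)
    (hfc : HasCompactSupport f) (n : ℕ) (h : ℤ) :
    fcoeff (iteratedDeriv n f) h = (2 * Real.pi * Complex.I * h) ^ n * fcoeff f h := by
  rw [fcoeff_eq_fourier, fcoeff_eq_fourier,
    Real.fourier_iteratedDeriv (N := (⊤ : ℕ∞)) hf (fun m _ => ?_) le_top]
  · simp
  · refine Continuous.integrable_of_hasCompactSupport ?_ ?_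
    · exact continuous_iteratedDeriv_of_smooth hf m
    · rw [iteratedDeriv_eq_equiv_comp]
      exact (hfc.iteratedFDeriv m).comp_left (map_zero _)

/-- The function `ψ`, dilated and translated. -/
def dilate (ψ : ℝ → ℂ) (t M m₀ : ℝ) (u : ℝ) : ℂ := ψ ((t * u - m₀) / M)

theorem dilate_eq (ψ : ℝ → ℂ) (t M m₀ : ℝ) :
    dilate ψ t M m₀ = fun u => (fun v => ψ (v + -(m₀ / M))) (t / M * u) := by
  ext u
  rw [dilate]
  congr 1
  ring

theorem contDiff_dilate {ψ : ℝ → ℂ} (hψ : ContDiff ℝ ((⊤ : ℕ∞) : WithTop ℕ∞) ψ) (t M m₀ : ℝ) :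
    ContDiff ℝ ((⊤ : ℕ∞) : WithTop ℕ∞) (dilate ψ t M m₀) := by
  unfold dilate
  fun_prop

theorem iteratedDeriv_dilate {ψ : ℝ → ℂ} (hψ : ContDiff ℝ ((⊤ : ℕ∞) : WithTop ℕ∞) ψ)
    (t M m₀ : ℝ) (n : ℕ) :
    iteratedDeriv n (dilate ψ t M m₀) =
      fun u => ((t / M : ℝ) : ℂ) ^ n * dilate (iteratedDeriv n ψ) t M m₀ u := by
  rw [dilate_eq, iteratedDeriv_comp_const_smul (f := fun v => ψ (v + -(m₀ / M)))
    ((hψ.of_le (by exact_mod_cast le_top)).comp (contDiff_id.add contDiff_const)), iteratedDeriv_comp_add_const]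
  ext u
  rw [dilate_eq, Complex.real_smul]
  push_cast
  rfl

theorem dilate_eq_zero {ψ : ℝ → ℂ} {R : ℝ} (hR : ∀ u, R < |u| → ψ u = 0) {t M m₀ U u : ℝ}
    (ht : 0 < t) (hM : 0 < M) (hU : (|m₀| + R * M) / t ≤ U) (hu : U < |u|) :
    dilate ψ t M m₀ u = 0 := by
  refine hR _ ?_
  rw [abs_div, abs_of_pos hM, lt_div_iff₀ hM]
  rw [div_le_iff₀ ht] at hU
  have h1 : |t * u| ≤ |t * u - m₀| + |m₀| := by
    have := abs_add_le (t * u - m₀) m₀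
    simpa using this
  rw [abs_mul, abs_of_pos ht] at h1
  nlinarith

theorem hasCompactSupport_dilate {ψ : ℝ → ℂ} {R : ℝ} (hR : ∀ u, R < |u| → ψ u = 0) {t M m₀ : ℝ}
    (ht : 0 < t) (hM : 0 < M) : HasCompactSupport (dilate ψ t M m₀) := by
  refine HasCompactSupport.of_support_subset_isCompact
    (isCompact_closedBall (0 : ℝ) ((|m₀| + R * M) / t)) ?_
  intro u hu
  by_contra h
  rw [Metric.mem_closedBall, dist_zero_right, Real.norm_eq_abs, not_le] at h
  exact hu (dilate_eq_zero hR ht hM le_rfl h)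

theorem fcoeff_dilate_zero (ψ : ℝ → ℂ) {t M m₀ : ℝ} (ht : 0 < t) (hM : 0 < M) :
    fcoeff (dilate ψ t M m₀) 0 = ((M / t : ℝ) : ℂ) * ∫ u, ψ u := by
  rw [fcoeff]
  simp only [Int.cast_zero, zero_mul, neg_zero, ex_zero, mul_one]
  rw [dilate_eq]
  rw [MeasureTheory.Measure.integral_comp_mul_left (fun v => ψ (v + -(m₀ / M))) (t / M),
    MeasureTheory.integral_add_right_eq_self ψ, Complex.real_smul, abs_of_pos (by positivity),
    inv_div]

/-- Compactly supported smooth functions vanish outside some interval, and they and their third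
derivatives are bounded. -/
theorem exists_support_bound {ψ : ℝ → ℂ} (hψ : ContDiff ℝ ((⊤ : ℕ∞) : WithTop ℕ∞) ψ)
    (hψc : HasCompactSupport ψ) :
    ∃ R G : ℝ, 1 ≤ R ∧ 1 ≤ G ∧ (∀ u, R < |u| → ψ u = 0) ∧ (∀ u, R < |u| → iteratedDeriv 3 ψ u = 0) ∧
      (∀ u, ‖ψ u‖ ≤ G) ∧ (∀ u, ‖iteratedDeriv 3 ψ u‖ ≤ G) ∧ ‖∫ u, ψ u‖ ≤ G := by
  have h3c : Continuous (iteratedDeriv 3 ψ) :=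
    continuous_iteratedDeriv_of_smooth hψ 3
  have h3s : HasCompactSupport (iteratedDeriv 3 ψ) := by
    rw [iteratedDeriv_eq_equiv_comp]
    exact (hψc.iteratedFDeriv 3).comp_left (map_zero _)
  have key : ∀ f : ℝ → ℂ, HasCompactSupport f → ∃ R : ℝ, ∀ u, R < |u| → f u = 0 := by
    intro f hf
    obtain ⟨R, hR⟩ := hf.isCompact.isBounded.subset_closedBall 0
    refine ⟨R, fun u hu => ?_⟩
    by_contra h
    have h1 := hR (subset_tsupport f h)
    rw [Metric.mem_closedBall, dist_zero_right, Real.norm_eq_abs] at h1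
    linarith
  obtain ⟨R1, hR1⟩ := key ψ hψc
  obtain ⟨R2, hR2⟩ := key _ h3s
  obtain ⟨G1, hG1⟩ := hψc.exists_bound_of_continuous hψ.continuous
  obtain ⟨G2, hG2⟩ := h3s.exists_bound_of_continuous h3c
  refine ⟨max 1 (max R1 R2), max (max 1 (max G1 G2)) ‖∫ u, ψ u‖, le_max_left _ _,
    (le_max_left _ _).trans (le_max_left _ _), fun u hu => hR1 u ?_, fun u hu => hR2 u ?_,
    fun u => (hG1 u).trans ?_, fun u => (hG2 u).trans ?_, le_max_right _ _⟩
  · exact ((le_max_left _ _).trans (le_max_right _ _)).trans_lt hu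
  · exact ((le_max_right _ _).trans (le_max_right _ _)).trans_lt hu
  · exact ((le_max_left _ _).trans (le_max_right _ _)).trans (le_max_left _ _)
  · exact ((le_max_right _ _).trans (le_max_right _ _)).trans (le_max_left _ _)

theorem fcoeff_dilate_eq {ψ : ℝ → ℂ} (hψ : ContDiff ℝ ((⊤ : ℕ∞) : WithTop ℕ∞) ψ) {R : ℝ}
    (hR : ∀ u, R < |u| → ψ u = 0) (hR3 : ∀ u, R < |u| → iteratedDeriv 3 ψ u = 0) (hR0 : 0 ≤ R)
    {t M m₀ U : ℝ} (ht : 0 < t) (hM : 0 < M) (hU : (|m₀| + R * M) / t ≤ U) {h : ℤ} (hh : h ≠ 0) :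
    fcoeff (dilate ψ t M m₀) h = ((t / M : ℝ) : ℂ) ^ 3 * ((2 * Real.pi * Complex.I * h) ^ 3)⁻¹ *
      ∫ u in (-U)..U, dilate (iteratedDeriv 3 ψ) t M m₀ u * ex (-(h * u)) := by
  have hU0 : 0 ≤ U := le_trans (by positivity) hU
  have h1 := fcoeff_iteratedDeriv (contDiff_dilate hψ t M m₀)
    (hasCompactSupport_dilate hR ht hM) 3 h
  have h2 : (2 * Real.pi * Complex.I * h : ℂ) ^ 3 ≠ 0 := by
    refine pow_ne_zero _ (mul_ne_zero Complex.two_pi_I_ne_zero (by exact_mod_cast hh))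
  have h3 : fcoeff (dilate ψ t M m₀) h = ((2 * Real.pi * Complex.I * h) ^ 3)⁻¹ *
      fcoeff (iteratedDeriv 3 (dilate ψ t M m₀)) h := by
    rw [h1, inv_mul_cancel_left₀ h2]
  rw [h3, iteratedDeriv_dilate hψ, fcoeff_eq_intervalIntegral hU0
    (fun u hu => by rw [dilate_eq_zero hR3 ht hM hU hu, mul_zero])]
  simp_rw [mul_assoc]
  rw [intervalIntegral.integral_const_mul]
  ring

/-- The nonzero integers `h` with `|h| ≤ X`. -/
def punctured (X : ℝ) : Finset ℤ := (Finset.Icc (-(⌊X⌋₊ : ℤ)) ⌊X⌋₊).erase 0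

theorem mem_punctured {X : ℝ} {h : ℤ} : h ∈ punctured X ↔ h ≠ 0 ∧ |h| ≤ ⌊X⌋₊ := by
  rw [punctured, Finset.mem_erase, Finset.mem_Icc, abs_le]

theorem sqrt_sieve_le {Δ H Λ S C : ℝ} (hΔ : 0 < Δ) (hΔ2 : Δ ≤ 1 / 2) (hH : 0 < H)
    (hS : 0 ≤ S) (hC : 0 ≤ C) (hΛ : 1 ≤ Λ) (hΛΔ : 1 + Real.log (1 / Δ) ≤ Λ)
    (hΛH : 1 + Real.log H ≤ Λ) (W k : ℕ) :
    Real.sqrt (C * (2 * (⌊2 ^ k * H⌋₊ : ℝ) * W + 1 + 2 / Δ * (1 + Real.log (1 / Δ))) *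
        (2 * ((⌊2 ^ k * H⌋₊ : ℝ) * (1 + Real.log (⌊2 ^ k * H⌋₊ : ℝ)) ^ 2) * S)) ≤
      4 ^ k * Λ * Real.sqrt (2 * H * (2 * H * W + 3 * Λ / Δ) * (C * S)) := by
  set Z : ℝ := (⌊2 ^ k * H⌋₊ : ℝ) with hZ
  have hZ0 : 0 ≤ Z := Nat.cast_nonneg _
  have hZle : Z ≤ 2 ^ k * H := Nat.floor_le (by positivity)
  rw [show (4 : ℝ) ^ k * Λ = Real.sqrt ((4 ^ k * Λ) ^ 2) from (Real.sqrt_sq (by positivity)).symm,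
    ← Real.sqrt_mul (by positivity)]
  refine Real.sqrt_le_sqrt ?_
  have h1 : (1 : ℝ) ≤ 2 ^ k := one_le_pow₀ (by norm_num)
  have hL0 : 0 ≤ Real.log (1 / Δ) := by
    refine Real.log_nonneg ?_
    rw [le_div_iff₀ hΔ]
    linarith
  have h2 : 2 * Z * W + 1 + 2 / Δ * (1 + Real.log (1 / Δ)) ≤ 2 ^ k * (2 * H * W + 3 * Λ / Δ) := by
    have h3 : 1 + 2 / Δ * (1 + Real.log (1 / Δ)) ≤ 3 * Λ / Δ := by
      have h4 : 1 ≤ Λ / Δ := by rw [le_div_iff₀ hΔ]; linarith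
      have h5 : 2 / Δ * (1 + Real.log (1 / Δ)) ≤ 2 / Δ * Λ := by gcongr
      have h6 : 3 * Λ / Δ = Λ / Δ + 2 / Δ * Λ := by ring
      linarith
    have h4 : 0 ≤ 3 * Λ / Δ := by positivity
    have h5 : 2 * Z * W ≤ 2 * (2 ^ k * H) * W := by gcongr
    nlinarith
  have h3 : Z * (1 + Real.log Z) ^ 2 ≤ 2 ^ k * H * (2 ^ k * Λ) ^ 2 := by
    rcases Nat.eq_zero_or_pos ⌊2 ^ k * H⌋₊ with h0 | h0
    · rw [hZ, h0]
      simp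
      positivity
    · have hZ1 : 1 ≤ Z := by rw [hZ]; exact_mod_cast h0
      have h4 : 0 ≤ Real.log Z := Real.log_nonneg hZ1
      have h5 : 1 + Real.log Z ≤ 2 ^ k * Λ := by
        have h6 : Real.log Z ≤ k * Real.log 2 + Real.log H := by
          refine (Real.log_le_log (by linarith) hZle).trans (le_of_eq ?_)
          rw [Real.log_mul (by positivity) hH.ne', Real.log_pow]
        have h7 : (k : ℝ) + 1 ≤ 2 ^ k := by exact_mod_cast Nat.lt_two_pow_self (n := k)
        have h8 : (k : ℝ) * Real.log 2 ≤ k := by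
          have := Real.log_two_lt_d9
          have : (0 : ℝ) ≤ k := Nat.cast_nonneg _
          nlinarith
        have : (0 : ℝ) ≤ k := Nat.cast_nonneg _
        nlinarith
      gcongr
  have h4 : 0 ≤ 2 * Z * W + 1 + 2 / Δ * (1 + Real.log (1 / Δ)) := by positivity
  calc C * (2 * Z * W + 1 + 2 / Δ * (1 + Real.log (1 / Δ))) * (2 * (Z * (1 + Real.log Z) ^ 2) * S)
      ≤ C * (2 ^ k * (2 * H * W + 3 * Λ / Δ)) * (2 * (2 ^ k * H * (2 ^ k * Λ) ^ 2) * S) := by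
        refine mul_le_mul (mul_le_mul_of_nonneg_left h2 hC)
          (mul_le_mul_of_nonneg_right (by linarith) hS) ?_ (by positivity)
        have : 0 ≤ Z * (1 + Real.log Z) ^ 2 := mul_nonneg hZ0 (sq_nonneg _)
        positivity
    _ = (4 ^ k * Λ) ^ 2 * (2 * H * (2 * H * W + 3 * Λ / Δ) * (C * S)) := by
        have : (4 : ℝ) ^ k = 2 ^ k * 2 ^ k := by rw [← mul_pow]; norm_num
        rw [this]
        ring


theorem norm_sum_punctured_zero_le
    {ι : Type*} {s : Finset ι} {x : ι → ℝ} {Δ : ℝ}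
    (hΔ : 0 < Δ) (hΔ2 : Δ ≤ 1 / 2) (hs : IsSpacedMod s x Δ) (c : ι → ℂ)
    (P : Finset ℕ) (w : ℕ → ℕ) (hw : ∀ n ∈ P, 0 < w n) (hinj : Set.InjOn w P)
    (W : ℕ) (hW : ∀ n ∈ P, w n ≤ W) (a : ℤ → ℕ → ℂ) (ha : ∀ h n, ‖a h n‖ ≤ 1)
    {ψ : ℝ → ℂ} (hψ : ContDiff ℝ ((⊤ : ℕ∞) : WithTop ℕ∞) ψ) {R G : ℝ} (hR0 : 0 ≤ R) (hG0 : 0 ≤ G)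
    (hR : ∀ u, R < |u| → ψ u = 0)
    (hG : ∀ u, ‖ψ u‖ ≤ G)
    {T M m₀ V Λ : ℝ} (hT : 0 < T) (hM : 0 < M) (t : ι → ℝ) (ht : ∀ i ∈ s, T ≤ t i ∧ t i ≤ 2 * T)
    (hV : |m₀| + R * M ≤ V * M)
    (hΛ : 1 ≤ Λ) (hΛΔ : 1 + Real.log (1 / Δ) ≤ Λ) (hΛH : 1 + Real.log (T / M) ≤ Λ) :
    ‖∑ i ∈ s, c i * ∑ h ∈ punctured (T / M), ∑ n ∈ P, a h n * ex (h * w n * x i) *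
        fcoeff (dilate ψ (t i) M m₀) h‖ ≤
      2 * (V * M / T) * G * (Λ * Real.sqrt (2 * (T / M) * (2 * (T / M) * W + 3 * Λ / Δ) *
        ((∑ i ∈ s, ‖c i‖ ^ 2) * ∑ n ∈ P, ((w n).divisors.card : ℝ)))) := by
  have hV0 : 0 ≤ V * M := le_trans (by positivity) hV
  have hU0 : 0 ≤ V * M / T := by positivity
  have hU : ∀ i ∈ s, (|m₀| + R * M) / t i ≤ V * M / T := fun i hi =>
    div_le_div₀ hV0 hV hT (ht i hi).1
  have h1 := norm_sum_bilinear_integral_le hΔ hΔ2 hs c P w hw hinj W hW (punctured (T / M))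
    ⌊T / M⌋₊ (fun h hh => mem_punctured.1 hh) a 1 zero_le_one (fun h _ n _ => ha h n)
    (fun i => dilate ψ (t i) M m₀) (fun i => (contDiff_dilate hψ _ _ _).continuous) G hG0
    (fun i u => hG _) (V * M / T) hU0
  have h2 := sqrt_sieve_le hΔ hΔ2 (div_pos hT hM)
    (Finset.sum_nonneg fun n _ => Nat.cast_nonneg _ : 0 ≤ ∑ n ∈ P, ((w n).divisors.card : ℝ))
    (Finset.sum_nonneg fun i _ => sq_nonneg _ : 0 ≤ ∑ i ∈ s, ‖c i‖ ^ 2) hΛ hΛΔ hΛH W 0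
  simp only [pow_zero, one_mul] at h2
  refine le_trans (le_of_eq ?_) (h1.trans ?_)
  · congr 1
    refine Finset.sum_congr rfl fun i hi => ?_
    congr 1
    refine Finset.sum_congr rfl fun h _ => Finset.sum_congr rfl fun n _ => ?_
    rw [fcoeff_eq_intervalIntegral hU0 (fun u hu => dilate_eq_zero hR (hT.trans_le (ht i hi).1) hM
      (hU i hi) hu)]
  · rw [mul_one]
    exact mul_le_mul_of_nonneg_left h2 (by positivity)

theorem norm_sum_punctured_sdiff_le
    {ι : Type*} {s : Finset ι} {x : ι → ℝ} {Δ : ℝ}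
    (hΔ : 0 < Δ) (hΔ2 : Δ ≤ 1 / 2) (hs : IsSpacedMod s x Δ) (c : ι → ℂ)
    (P : Finset ℕ) (w : ℕ → ℕ) (hw : ∀ n ∈ P, 0 < w n) (hinj : Set.InjOn w P)
    (W : ℕ) (hW : ∀ n ∈ P, w n ≤ W) (a : ℤ → ℕ → ℂ) (ha : ∀ h n, ‖a h n‖ ≤ 1)
    {ψ : ℝ → ℂ} (hψ : ContDiff ℝ ((⊤ : ℕ∞) : WithTop ℕ∞) ψ) {R G : ℝ} (hR0 : 0 ≤ R) (hG0 : 0 ≤ G)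
    (hR : ∀ u, R < |u| → ψ u = 0) (hR3 : ∀ u, R < |u| → iteratedDeriv 3 ψ u = 0)
    (hG3 : ∀ u, ‖iteratedDeriv 3 ψ u‖ ≤ G)
    {T M m₀ V Λ : ℝ} (hT : 0 < T) (hM : 0 < M) (t : ι → ℝ) (ht : ∀ i ∈ s, T ≤ t i ∧ t i ≤ 2 * T)
    (hV : |m₀| + R * M ≤ V * M)
    (hΛ : 1 ≤ Λ) (hΛΔ : 1 + Real.log (1 / Δ) ≤ Λ) (hΛH : 1 + Real.log (T / M) ≤ Λ) (k : ℕ) :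
    ‖∑ i ∈ s, c i * ∑ h ∈ punctured (2 ^ (k + 1) * (T / M)) \ punctured (2 ^ k * (T / M)),
        ∑ n ∈ P, a h n * ex (h * w n * x i) * fcoeff (dilate ψ (t i) M m₀) h‖ ≤
      2 * (V * M / T) * G * (Λ * Real.sqrt (2 * (T / M) * (2 * (T / M) * W + 3 * Λ / Δ) *
        ((∑ i ∈ s, ‖c i‖ ^ 2) * ∑ n ∈ P, ((w n).divisors.card : ℝ)))) * (1 / 2) ^ (k + 1) := by
  have hV0 : 0 ≤ V * M := le_trans (by positivity) hV
  have hU0 : 0 ≤ V * M / T := by positivity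
  have hU : ∀ i ∈ s, (|m₀| + R * M) / t i ≤ V * M / T := fun i hi =>
    div_le_div₀ hV0 hV hT (ht i hi).1
  have hS0 : 0 ≤ ∑ n ∈ P, ((w n).divisors.card : ℝ) := Finset.sum_nonneg fun n _ => Nat.cast_nonneg _
  have hH : 0 < T / M := div_pos hT hM
  set H := T / M with hHdef
  set B := punctured (2 ^ (k + 1) * H) \ punctured (2 ^ k * H) with hB
  set c' : ι → ℂ := fun i => c i * ((t i / T : ℝ) : ℂ) ^ 3 with hc'
  have hc'sum : ∑ i ∈ s, ‖c' i‖ ^ 2 ≤ 8 ^ 2 * ∑ i ∈ s, ‖c i‖ ^ 2 := by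
    rw [Finset.mul_sum]
    refine Finset.sum_le_sum fun i hi => ?_
    have h0 : 0 < t i := hT.trans_le (ht i hi).1
    have h1 : t i / T ≤ 2 := by rw [div_le_iff₀ hT]; exact (ht i hi).2
    rw [hc', norm_mul, norm_pow, Complex.norm_real, Real.norm_of_nonneg (by positivity), mul_pow,
      mul_comm]
    have h2 : (t i / T) ^ 3 ≤ 8 := by
      calc (t i / T) ^ 3 ≤ 2 ^ 3 := by gcongr
        _ = 8 := by norm_num
    gcongr
  set b : ℤ → ℕ → ℂ := fun h n => a h n * ((H : ℂ) ^ 3 * ((2 * Real.pi * Complex.I * h) ^ 3)⁻¹)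
    with hb
  have hbound : ∀ h ∈ B, ∀ n ∈ P, ‖b h n‖ ≤ 1 / 8 * (1 / 8) ^ (k + 1) := by
    intro h hh n _
    rw [hB, Finset.mem_sdiff, mem_punctured, mem_punctured, not_and, not_le] at hh
    have h1 := hh.2 hh.1.1
    have h2 : 2 ^ k * H < |(h : ℝ)| := by
      have h3 := Nat.lt_floor_add_one (2 ^ k * H)
      have h4 : ((⌊2 ^ k * H⌋₊ : ℕ) : ℤ) + 1 ≤ |h| := h1
      have h5 : ((⌊2 ^ k * H⌋₊ : ℕ) : ℝ) + 1 ≤ |(h : ℝ)| := by exact_mod_cast h4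
      linarith
    have h0 : 0 < |(h : ℝ)| := lt_trans (by positivity) h2
    have h3 : ‖((H : ℂ) ^ 3 * ((2 * Real.pi * Complex.I * h) ^ 3)⁻¹)‖ =
        (H / (2 * Real.pi * |(h : ℝ)|)) ^ 3 := by
      rw [norm_mul, norm_inv, norm_pow, norm_pow, Complex.norm_real, Real.norm_of_nonneg hH.le,
        norm_mul, norm_mul, norm_mul, Complex.norm_I, Complex.norm_real, Complex.norm_ofNat,
        Real.norm_of_nonneg Real.pi_pos.le, Complex.norm_intCast, mul_one]
      ring
    have h4 : H / (2 * Real.pi * |(h : ℝ)|) ≤ 1 / 2 * (1 / 2) ^ (k + 1) := by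
      rw [div_le_iff₀ (by positivity)]
      have h5 : (1 / 2 : ℝ) * (1 / 2) ^ (k + 1) * (2 * Real.pi * (2 ^ k * H)) = Real.pi / 2 * H := by
        have : ((1 : ℝ) / 2) ^ (k + 1) * 2 ^ k = 1 / 2 := by
          rw [pow_succ, mul_right_comm, ← mul_pow]; norm_num
        linear_combination Real.pi * H * this
      have h6 : (1 / 2 : ℝ) * (1 / 2) ^ (k + 1) * (2 * Real.pi * (2 ^ k * H)) ≤
          1 / 2 * (1 / 2) ^ (k + 1) * (2 * Real.pi * |(h : ℝ)|) := by gcongr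
      have := Real.pi_gt_three
      nlinarith
    rw [hb, norm_mul, h3]
    calc ‖a h n‖ * (H / (2 * Real.pi * |(h : ℝ)|)) ^ 3
        ≤ 1 * (1 / 2 * (1 / 2) ^ (k + 1)) ^ 3 := by
          gcongr
          exact ha h n
      _ = 1 / 8 * (1 / 8) ^ (k + 1) := by
          rw [one_mul, mul_pow, ← pow_mul, mul_comm (k + 1), pow_mul]; norm_num
  have h1 := norm_sum_bilinear_integral_le hΔ hΔ2 hs c' P w hw hinj W hW B
    ⌊2 ^ (k + 1) * H⌋₊ (fun h hh => mem_punctured.1 (Finset.mem_sdiff.1 hh).1) b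
    (1 / 8 * (1 / 8) ^ (k + 1)) (by positivity) hbound
    (fun i => dilate (iteratedDeriv 3 ψ) (t i) M m₀) (fun i => ?_) G hG0
    (fun i u => hG3 _) (V * M / T) hU0
  swap
  · have : Continuous (iteratedDeriv 3 ψ) :=
      continuous_iteratedDeriv_of_smooth hψ 3
    unfold dilate
    fun_prop
  have h2 := sqrt_sieve_le hΔ hΔ2 hH hS0
    (Finset.sum_nonneg fun i _ => sq_nonneg _ : 0 ≤ ∑ i ∈ s, ‖c' i‖ ^ 2) hΛ hΛΔ hΛH W (k + 1)
  refine le_trans (le_of_eq ?_) (h1.trans ?_)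
  · congr 1
    refine Finset.sum_congr rfl fun i hi => ?_
    rw [hc', mul_assoc (c i)]
    congr 1
    rw [Finset.mul_sum]
    refine Finset.sum_congr rfl fun h hh => ?_
    rw [Finset.mul_sum]
    refine Finset.sum_congr rfl fun n _ => ?_
    have hh0 : h ≠ 0 := (mem_punctured.1 (Finset.mem_sdiff.1 hh).1).1
    rw [fcoeff_dilate_eq hψ hR hR3 hR0 (hT.trans_le (ht i hi).1) hM (hU i hi) hh0, hb]
    have h3 : ((t i / M : ℝ) : ℂ) = ((t i / T : ℝ) : ℂ) * (H : ℂ) := by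
      rw [← Complex.ofReal_mul, hHdef]
      congr 1
      field_simp
    rw [h3, mul_pow]
    ring
  · set Q := 2 * H * (2 * H * W + 3 * Λ / Δ) with hQ
    have hQ0 : 0 ≤ Q := by positivity
    set S := ∑ n ∈ P, ((w n).divisors.card : ℝ)
    have h3 : Real.sqrt (Q * ((∑ i ∈ s, ‖c' i‖ ^ 2) * S)) ≤
        8 * Real.sqrt (Q * ((∑ i ∈ s, ‖c i‖ ^ 2) * S)) := by
      rw [show (8 : ℝ) = Real.sqrt (8 ^ 2) from (Real.sqrt_sq (by norm_num)).symm,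
        ← Real.sqrt_mul (by positivity)]
      refine Real.sqrt_le_sqrt ?_
      have := mul_le_mul_of_nonneg_left (mul_le_mul_of_nonneg_right hc'sum hS0) hQ0
      linarith
    calc _ ≤ 2 * (V * M / T) * G * (1 / 8 * (1 / 8) ^ (k + 1)) *
          (4 ^ (k + 1) * Λ * (8 * Real.sqrt (Q * ((∑ i ∈ s, ‖c i‖ ^ 2) * S)))) := by
          refine mul_le_mul_of_nonneg_left (h2.trans ?_) (by positivity)
          exact mul_le_mul_of_nonneg_left h3 (by positivity)
      _ = _ := by
          have : ((1 : ℝ) / 8) ^ (k + 1) * 4 ^ (k + 1) = (1 / 2) ^ (k + 1) := by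
            rw [← mul_pow]; norm_num
          linear_combination 2 * (V * M / T) * G * Λ *
            Real.sqrt (Q * ((∑ i ∈ s, ‖c i‖ ^ 2) * S)) * this

/-- The contribution of the nonzero frequencies after Poisson summation. -/
theorem norm_tsum_nonzero_frequencies_le
    {ι : Type*} {s : Finset ι} {x : ι → ℝ} {Δ : ℝ}
    (hΔ : 0 < Δ) (hΔ2 : Δ ≤ 1 / 2) (hs : IsSpacedMod s x Δ) (c : ι → ℂ)
    (P : Finset ℕ) (w : ℕ → ℕ) (hw : ∀ n ∈ P, 0 < w n) (hinj : Set.InjOn w P)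
    (W : ℕ) (hW : ∀ n ∈ P, w n ≤ W) (a : ℤ → ℕ → ℂ) (ha : ∀ h n, ‖a h n‖ ≤ 1)
    {ψ : ℝ → ℂ} (hψ : ContDiff ℝ ((⊤ : ℕ∞) : WithTop ℕ∞) ψ) {R G : ℝ} (hR0 : 0 ≤ R) (hG0 : 0 ≤ G)
    (hR : ∀ u, R < |u| → ψ u = 0) (hR3 : ∀ u, R < |u| → iteratedDeriv 3 ψ u = 0)
    (hG : ∀ u, ‖ψ u‖ ≤ G) (hG3 : ∀ u, ‖iteratedDeriv 3 ψ u‖ ≤ G)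
    {T M m₀ V Λ : ℝ} (hT : 0 < T) (hM : 0 < M) (t : ι → ℝ) (ht : ∀ i ∈ s, T ≤ t i ∧ t i ≤ 2 * T)
    (hV : |m₀| + R * M ≤ V * M)
    (hΛ : 1 ≤ Λ) (hΛΔ : 1 + Real.log (1 / Δ) ≤ Λ) (hΛH : 1 + Real.log (T / M) ≤ Λ) :
    ‖∑' h : ℤ, if h = 0 then 0 else ∑ i ∈ s, c i * ∑ n ∈ P, a h n * ex (h * w n * x i) *
        fcoeff (dilate ψ (t i) M m₀) h‖ ≤
      4 * (V * M / T) * G * (Λ * Real.sqrt (2 * (T / M) * (2 * (T / M) * W + 3 * Λ / Δ) *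
        ((∑ i ∈ s, ‖c i‖ ^ 2) * ∑ n ∈ P, ((w n).divisors.card : ℝ)))) := by
  set Q : ℝ := 2 * (V * M / T) * G * (Λ * Real.sqrt (2 * (T / M) * (2 * (T / M) * W + 3 * Λ / Δ) *
        ((∑ i ∈ s, ‖c i‖ ^ 2) * ∑ n ∈ P, ((w n).divisors.card : ℝ)))) with hQ
  have hV0 : 0 ≤ V * M := le_trans (by positivity) hV
  have hQ0 : 0 ≤ Q := mul_nonneg (mul_nonneg (mul_nonneg zero_le_two (div_nonneg hV0 hT.le)) hG0)
    (mul_nonneg (zero_le_one.trans hΛ) (Real.sqrt_nonneg _))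
  have hQ2 : 4 * (V * M / T) * G * (Λ * Real.sqrt (2 * (T / M) * (2 * (T / M) * W + 3 * Λ / Δ) *
        ((∑ i ∈ s, ‖c i‖ ^ 2) * ∑ n ∈ P, ((w n).divisors.card : ℝ)))) = 2 * Q := by
    rw [hQ]; ring
  rw [hQ2]
  set F : ℤ → ℂ := fun h => ∑ i ∈ s, c i * ∑ n ∈ P, a h n * ex (h * w n * x i) *
        fcoeff (dilate ψ (t i) M m₀) h with hF
  have hswap : ∀ B : Finset ℤ, ∑ h ∈ B, F h = ∑ i ∈ s, c i * ∑ h ∈ B, ∑ n ∈ P,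
      a h n * ex (h * w n * x i) * fcoeff (dilate ψ (t i) M m₀) h := by
    intro B
    rw [hF, Finset.sum_comm]
    refine Finset.sum_congr rfl fun i _ => ?_
    rw [Finset.mul_sum]
  have hmono : Monotone fun k : ℕ => punctured (2 ^ k * (T / M)) := by
    intro k l hkl h hh
    simp only [mem_punctured] at hh ⊢
    refine ⟨hh.1, hh.2.trans ?_⟩
    have : ⌊2 ^ k * (T / M)⌋₊ ≤ ⌊2 ^ l * (T / M)⌋₊ := by
      refine Nat.floor_mono ?_
      have : (2 : ℝ) ^ k ≤ 2 ^ l := pow_le_pow_right₀ (by norm_num) hkl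
      gcongr
    exact_mod_cast this
  have hpart : ∀ k : ℕ, ‖∑ h ∈ punctured (2 ^ k * (T / M)), F h‖ ≤ Q * (2 - (1 / 2) ^ k) := by
    intro k
    induction k with
    | zero =>
      have := norm_sum_punctured_zero_le hΔ hΔ2 hs c P w hw hinj W hW a ha hψ hR0 hG0 hR hG hT hM
        t ht hV hΛ hΛΔ hΛH
      rw [hswap, pow_zero, one_mul, pow_zero]
      linarith
    | succ k ih =>
      have h1 := norm_sum_punctured_sdiff_le hΔ hΔ2 hs c P w hw hinj W hW a ha hψ hR0 hG0 hR hR3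
        hG3 hT hM t ht hV hΛ hΛΔ hΛH k
      rw [← hswap] at h1
      rw [← Finset.sum_sdiff (hmono (Nat.le_succ k))]
      refine (norm_add_le _ _).trans ((add_le_add h1 ih).trans (le_of_eq ?_))
      rw [pow_succ]
      ring
  by_cases hsum : Summable fun h : ℤ => if h = 0 then 0 else F h
  swap
  · rw [tsum_eq_zero_of_not_summable hsum, norm_zero]
    exact mul_nonneg zero_le_two hQ0
  -- Exhaust the nonzero integers by the sets `punctured (2 ^ k * (T / M))`.
  have htend : Filter.Tendsto (fun k : ℕ => insert 0 (punctured (2 ^ k * (T / M))))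
      Filter.atTop Filter.atTop := by
    refine Filter.tendsto_atTop_finset_of_monotone (fun k l hkl => Finset.insert_subset_insert _
      (hmono hkl)) fun h => ?_
    by_cases h0 : h = 0
    · exact ⟨0, by simp [h0]⟩
    · obtain ⟨k, hk⟩ := pow_unbounded_of_one_lt ((|(h : ℝ)|) / (T / M)) (one_lt_two (α := ℝ))
      refine ⟨k, Finset.mem_insert_of_mem (mem_punctured.2 ⟨h0, ?_⟩)⟩
      rw [div_lt_iff₀ (div_pos hT hM)] at hk
      have h1 : h.natAbs ≤ ⌊2 ^ k * (T / M)⌋₊ := by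
        refine Nat.le_floor ?_
        rw [Nat.cast_natAbs, Int.cast_abs]
        exact hk.le
      rw [Int.abs_eq_natAbs]
      exact_mod_cast h1
  have hlim := (hsum.hasSum.comp htend).norm
  refine le_of_tendsto hlim (Filter.Eventually.of_forall fun k => ?_)
  have h2 : ∑ h ∈ insert 0 (punctured (2 ^ k * (T / M))), (if h = 0 then 0 else F h) =
      ∑ h ∈ punctured (2 ^ k * (T / M)), F h := by
    rw [Finset.sum_insert (by simp [mem_punctured]), if_pos rfl, zero_add]
    exact Finset.sum_congr rfl fun h hh => if_neg (mem_punctured.1 hh).1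
  simp only [Function.comp]
  rw [h2]
  refine (hpart k).trans ?_
  have : (0 : ℝ) < (1 / 2) ^ k := by positivity
  nlinarith

theorem isQuadratic_apply_eq_quadraticChar {F : Type*} [Field F] [Fintype F] [DecidableEq F]
    {χ : MulChar F ℂ} (hχ : χ.IsQuadratic) (h1 : χ ≠ 1) (t : F) :
    χ t = ((quadraticChar F t : ℤ) : ℂ) := by
  have hsq : ∀ u : F, u ≠ 0 → IsSquare u → χ u = 1 := by
    rintro u hu ⟨v, rfl⟩
    have hv : v ≠ 0 := left_ne_zero_of_mul hu
    have h2 : χ v ≠ 0 := ((Ne.isUnit hv).map χ).ne_zero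
    rw [map_mul]
    rcases hχ v with h | h | h
    · exact absurd h h2
    · rw [h, mul_one]
    · rw [h]; norm_num
  rcases eq_or_ne t 0 with rfl | ht
  · rw [MulChar.map_zero, MulChar.map_zero, Int.cast_zero]
  by_cases hs : IsSquare t
  · rw [hsq t ht hs, (quadraticChar_one_iff_isSquare ht).2 hs, Int.cast_one]
  · rw [quadraticChar_neg_one_iff_not_isSquare.2 hs]
    obtain ⟨u, hu⟩ := (MulChar.ne_one_iff).1 h1
    have hu0 : (u : F) ≠ 0 := u.ne_zero
    have hus : ¬ IsSquare (u : F) := fun h => hu (hsq _ hu0 h)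
    have hprod : IsSquare (t * u) := by
      rw [← quadraticChar_one_iff_isSquare (mul_ne_zero ht hu0), map_mul,
        quadraticChar_neg_one_iff_not_isSquare.2 hs, quadraticChar_neg_one_iff_not_isSquare.2 hus]
      norm_num
    have h3 := hsq _ (mul_ne_zero ht hu0) hprod
    rw [map_mul] at h3
    have h4 : χ u = -1 := by
      rcases hχ u with h | h | h
      · exact absurd h (u.isUnit.map χ).ne_zero
      · exact absurd h hu
      · exact h
    rw [h4] at h3
    push_cast
    linear_combination -h3

/-- The character sum `∑ χ(ℓ² + a²)` over all residue classes `a`. -/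
def sumOfSquaresCharSum {R : Type*} [CommRing R] [Fintype R] (χ : MulChar R ℂ) (l : R) : ℂ :=
  ∑ a : R, χ (l ^ 2 + a ^ 2)

theorem norm_mulChar_le_one {R : Type*} [CommRing R] {χ : MulChar R ℂ}
    (hχ : χ.IsQuadratic) (a : R) : ‖χ a‖ ≤ 1 := by
  rcases hχ a with h | h | h <;> simp [h]

theorem norm_sumOfSquaresCharSum_le_card {R : Type*} [CommRing R] [Fintype R] {χ : MulChar R ℂ}
    (hχ : χ.IsQuadratic) (l : R) : ‖sumOfSquaresCharSum χ l‖ ≤ Fintype.card R := by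
  refine (norm_sum_le _ _).trans ?_
  refine (Finset.sum_le_sum fun a _ => norm_mulChar_le_one hχ _).trans ?_
  simp

theorem sumOfSquaresCharSum_field {F : Type*} [Field F] [Fintype F]
    (hF : ringChar F ≠ 2) {χ : MulChar F ℂ} (hχ : χ.IsQuadratic) (h1 : χ ≠ 1) {l : F}
    (hl : l ≠ 0) : sumOfSquaresCharSum χ l = -1 := by
  classical
  have hcard : ∀ t : F, ((Finset.univ.filter (fun a : F => a ^ 2 = t)).card : ℂ) = 1 + χ t := by
    intro t
    have h2 := quadraticChar_card_sqrts hF t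
    have h3 : {x : F | x ^ 2 = t}.toFinset = Finset.univ.filter (fun a : F => a ^ 2 = t) := by
      ext; simp
    rw [h3] at h2
    rw [isQuadratic_apply_eq_quadraticChar hχ h1, add_comm]
    exact_mod_cast h2
  have hc : l ^ 2 ≠ 0 := pow_ne_zero 2 hl
  set c := l ^ 2 with hcdef
  have hA : sumOfSquaresCharSum χ l = ∑ t : F, (1 + χ t) * χ (c + t) := by
    rw [sumOfSquaresCharSum, ← Finset.sum_fiberwise_of_maps_to (s := Finset.univ)
      (t := Finset.univ) (g := fun a : F => a ^ 2) (fun _ _ => Finset.mem_univ _)]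
    refine Finset.sum_congr rfl fun t _ => ?_
    rw [← hcard, Finset.sum_congr rfl (g := fun _ => χ (c + t)) (fun a ha => by
      rw [(Finset.mem_filter.1 ha).2]), Finset.sum_const, nsmul_eq_mul]
  have hB : ∑ t : F, χ (c + t) = 0 := by
    exact (Equiv.sum_comp (Equiv.addLeft c) (fun t => χ t)).trans (MulChar.sum_eq_zero_of_ne_one h1)
  have hC : ∑ t : F, χ t * χ (c + t) = -1 := by
    have e1 : ∑ t : F, χ t * χ (c + t) = ∑ t : F, χ (-c * t) * χ (c + -c * t) :=
      (Equiv.sum_comp (Equiv.mulLeft₀ (-c) (neg_ne_zero.2 hc)) (fun t => χ t * χ (c + t))).symm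
    have e2 : ∀ t : F, χ (-c * t) * χ (c + -c * t) = χ (-1) * (χ c * χ c) * (χ t * χ (1 - t)) := by
      intro t
      have h3 : -c * t = -1 * (c * t) := by ring
      have h4 : c + -1 * (c * t) = c * (1 - t) := by ring
      rw [h3, h4, map_mul, map_mul, map_mul]
      ring
    have hsqr : ∀ u : F, u ≠ 0 → χ u * χ u = 1 := by
      intro u hu
      rcases hχ u with h | h | h
      · exact absurd h ((Ne.isUnit hu).map χ).ne_zero
      · rw [h, mul_one]
      · rw [h]; norm_num
    rw [e1, Finset.sum_congr rfl fun t _ => e2 t, ← Finset.mul_sum, hsqr c hc]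
    have h5 := jacobiSum_nontrivial_inv h1
    rw [hχ.inv, jacobiSum] at h5
    rw [h5]
    linear_combination -(hsqr (-1) (neg_ne_zero.2 one_ne_zero))
  rw [hA]
  simp_rw [add_mul, one_mul]
  rw [Finset.sum_add_distrib, hB, hC, zero_add]

section ChineseRemainder
variable {m n : ℕ} (e : ZMod (m * n) ≃+* ZMod m × ZMod n)

/-- The component of a multiplicative character at the first of two coprime moduli. -/
def leftChar (χ : MulChar (ZMod (m * n)) ℂ) : MulChar (ZMod m) ℂ where
  toFun x := χ (e.symm (x, 1))
  map_one' := by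
    rw [show ((1 : ZMod m), (1 : ZMod n)) = 1 from rfl, map_one, map_one]
  map_mul' x y := by
    rw [← map_mul, ← map_mul, Prod.mk_mul_mk, mul_one]
  map_nonunit' x hx := by
    refine χ.map_nonunit fun h => hx ?_
    have h1 := h.map e
    rw [RingEquiv.apply_symm_apply, Prod.isUnit_iff] at h1
    exact h1.1

/-- The component of a multiplicative character at the second of two coprime moduli. -/
def rightChar (χ : MulChar (ZMod (m * n)) ℂ) : MulChar (ZMod n) ℂ where
  toFun x := χ (e.symm (1, x))
  map_one' := by
    rw [show ((1 : ZMod m), (1 : ZMod n)) = 1 from rfl, map_one, map_one]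
  map_mul' x y := by
    rw [← map_mul, ← map_mul, Prod.mk_mul_mk, mul_one]
  map_nonunit' x hx := by
    refine χ.map_nonunit fun h => hx ?_
    have h1 := h.map e
    rw [RingEquiv.apply_symm_apply, Prod.isUnit_iff] at h1
    exact h1.2

theorem leftChar_apply (χ : MulChar (ZMod (m * n)) ℂ) (x : ZMod m) :
    leftChar e χ x = χ (e.symm (x, 1)) := rfl

theorem rightChar_apply (χ : MulChar (ZMod (m * n)) ℂ) (x : ZMod n) :
    rightChar e χ x = χ (e.symm (1, x)) := rfl

theorem leftChar_mul_rightChar (χ : MulChar (ZMod (m * n)) ℂ) (x : ZMod m) (y : ZMod n) :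
    leftChar e χ x * rightChar e χ y = χ (e.symm (x, y)) := by
  rw [leftChar_apply, rightChar_apply, ← map_mul, ← map_mul, Prod.mk_mul_mk, mul_one, one_mul]

theorem sumOfSquaresCharSum_mul [NeZero m] [NeZero n] (χ : MulChar (ZMod (m * n)) ℂ)
    (l : ℕ) : sumOfSquaresCharSum χ (l : ZMod (m * n)) =
      sumOfSquaresCharSum (leftChar e χ) (l : ZMod m) *
        sumOfSquaresCharSum (rightChar e χ) (l : ZMod n) := by
  rw [sumOfSquaresCharSum, sumOfSquaresCharSum, sumOfSquaresCharSum, Finset.sum_mul_sum,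
    ← Fintype.sum_prod_type', ← e.symm.toEquiv.sum_comp]
  refine Finset.sum_congr rfl fun p _ => ?_
  rw [leftChar_mul_rightChar]
  congr 1
  apply e.injective
  rw [RingEquiv.apply_symm_apply]
  simp only [map_add, map_pow, map_natCast, RingEquiv.toEquiv_eq_coe, EquivLike.coe_coe,
    RingEquiv.apply_symm_apply]
  rfl

end ChineseRemainder

/-- For every odd prime `p ∣ q`, the character is nontrivial on the units that are `1` modulo
`q / p`. -/
def IsLocallyNontrivial {q : ℕ} (χ : MulChar (ZMod q) ℂ) : Prop :=
  ∀ p : ℕ, p.Prime → p ∣ q →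
    ∃ t : ZMod q, IsUnit (1 + ((q / p : ℕ) : ZMod q) * t) ∧ χ (1 + ((q / p : ℕ) : ZMod q) * t) ≠ 1

theorem isLocallyNontrivial_of_isPrimitive {q : ℕ} [NeZero q] {χ : DirichletCharacter ℂ q}
    (hχ : χ.IsPrimitive) : IsLocallyNontrivial χ := by
  intro p hp hpq
  obtain ⟨d, rfl⟩ := hpq
  have hq0 : p * d ≠ 0 := NeZero.ne _
  have hd0 : 0 < d := Nat.pos_of_ne_zero (right_ne_zero_of_mul hq0)
  rw [Nat.mul_div_cancel_left d hp.pos]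
  have hd : d ∣ p * d := dvd_mul_left d p
  have hnot : ¬ DirichletCharacter.FactorsThrough χ d := by
    intro h
    have h1 : χ.conductor ≤ d := Nat.sInf_le ((DirichletCharacter.mem_conductorSet_iff χ).2 h)
    rw [DirichletCharacter.isPrimitive_def] at hχ
    rw [hχ] at h1
    nlinarith [hp.two_le]
  rw [DirichletCharacter.factorsThrough_iff_ker_unitsMap hd, SetLike.not_le_iff_exists] at hnot
  obtain ⟨u, hu, hu2⟩ := hnot
  rw [MonoidHom.mem_ker] at hu hu2
  have h2 : ZMod.castHom hd (ZMod d) ((u : ZMod (p * d)) - 1) = 0 := by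
    rw [map_sub, map_one]
    have h3 := congrArg (Units.val) hu
    rw [ZMod.unitsMap_def, Units.coe_map, Units.val_one] at h3
    rw [sub_eq_zero]
    exact h3
  have h4 : ∃ t : ZMod (p * d), (u : ZMod (p * d)) - 1 = (d : ZMod (p * d)) * t := by
    set y := (u : ZMod (p * d)) - 1
    have h5 : ((y.val : ℕ) : ZMod d) = 0 := by
      rw [← map_natCast (ZMod.castHom hd (ZMod d)), ZMod.natCast_zmod_val]
      exact h2
    obtain ⟨s, hs⟩ := (ZMod.natCast_eq_zero_iff _ _).1 h5
    refine ⟨s, ?_⟩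
    rw [← Nat.cast_mul, ← hs, ZMod.natCast_zmod_val]
  obtain ⟨t, ht⟩ := h4
  have h6 : 1 + (d : ZMod (p * d)) * t = u := by rw [← ht]; ring
  refine ⟨t, by rw [h6]; exact u.isUnit, ?_⟩
  rw [h6]
  intro h7
  apply hu2
  rw [← Units.val_inj, MulChar.coe_toUnitHom, h7, Units.val_one]

theorem isQuadratic_apply_sq_eq_one {R : Type*} [CommRing R] {χ : MulChar R ℂ} (hχ : χ.IsQuadratic)
    {u : R} (hu : IsUnit u) : χ u ^ 2 = 1 := by
  rcases hχ u with h | h | h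
  · exact absurd h (hu.map χ).ne_zero
  · rw [h, one_pow]
  · rw [h]; norm_num

theorem one_add_pow_of_sq_eq_zero {R : Type*} [CommRing R] {y : R} (hy : y ^ 2 = 0) (n : ℕ) :
    (1 + y) ^ n = 1 + n * y := by
  induction n with
  | zero => simp
  | succ n ih =>
    rw [pow_succ, ih]
    push_cast
    linear_combination (n : R) * hy

theorem natCast_mul_sq_eq_zero {q a : ℕ} (h : q ∣ a ^ 2) (t : ZMod q) :
    ((a : ZMod q) * t) ^ 2 = 0 := by
  rw [mul_pow, ← Nat.cast_pow, (ZMod.natCast_eq_zero_iff _ _).2 h, zero_mul]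

theorem not_sq_dvd_of_isLocallyNontrivial {q : ℕ} {χ : MulChar (ZMod q) ℂ}
    (hχ : χ.IsQuadratic) (hloc : IsLocallyNontrivial χ) {p : ℕ} (hp : p.Prime) (hp2 : p ≠ 2) :
    ¬ p ^ 2 ∣ q := by
  rintro ⟨r, rfl⟩
  have hpq : p ∣ p ^ 2 * r := ⟨p * r, by ring⟩
  obtain ⟨t, hu, ht⟩ := hloc p hp hpq
  have hdiv : p ^ 2 * r / p = p * r := by
    rw [show p ^ 2 * r = p * (p * r) by ring, Nat.mul_div_cancel_left _ hp.pos]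
  rw [hdiv] at hu ht
  set y : ZMod (p ^ 2 * r) := ((p * r : ℕ) : ZMod (p ^ 2 * r)) * t with hy
  have hy2 : y ^ 2 = 0 := natCast_mul_sq_eq_zero ⟨r, by ring⟩ t
  have hpy : (p : ZMod (p ^ 2 * r)) * y = 0 := by
    rw [hy, ← mul_assoc, ← Nat.cast_mul, (ZMod.natCast_eq_zero_iff _ _).2 ⟨1, by ring⟩, zero_mul]
  have h1 := one_add_pow_of_sq_eq_zero hy2 p
  rw [hpy, add_zero] at h1
  have h2 : χ (1 + y) ^ p = 1 := by rw [← map_pow, h1, map_one]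
  have key : ∀ (z : ℂ) (n : ℕ), z ^ 2 = 1 → Odd n → z ^ n = 1 → z = 1 := by
    rintro z _ hz ⟨j, rfl⟩ h
    rwa [pow_succ, pow_mul, hz, one_pow, one_mul] at h
  exact ht (key _ p (isQuadratic_apply_sq_eq_one hχ hu) (hp.odd_of_ne_two hp2) h2)

theorem not_sixteen_dvd_of_isLocallyNontrivial {q : ℕ} {χ : MulChar (ZMod q) ℂ}
    (hχ : χ.IsQuadratic) (hloc : IsLocallyNontrivial χ) : ¬ 16 ∣ q := by
  rintro ⟨r, rfl⟩
  obtain ⟨t, hu, ht⟩ := hloc 2 Nat.prime_two ⟨8 * r, by ring⟩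
  have hdiv : 16 * r / 2 = 8 * r := by omega
  rw [hdiv] at hu ht
  have h1 : (((4 * r : ℕ) : ZMod (16 * r)) * t) ^ 2 = 0 :=
    natCast_mul_sq_eq_zero ⟨r, by ring⟩ t
  have h2 : 1 + ((8 * r : ℕ) : ZMod (16 * r)) * t = (1 + ((4 * r : ℕ) : ZMod (16 * r)) * t) ^ 2 := by
    rw [one_add_pow_of_sq_eq_zero h1]
    push_cast
    ring
  rw [h2] at hu ht
  rw [isUnit_pow_iff two_ne_zero] at hu
  rw [map_pow, isQuadratic_apply_sq_eq_one hχ hu] at ht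
  exact ht rfl

theorem norm_sumOfSquaresCharSum_le {l n : ℕ} (hn : ∀ p : ℕ, p.Prime → p ∣ l → p ∣ n) (q : ℕ) :
    ∀ [NeZero q] {χ : MulChar (ZMod q) ℂ}, χ.IsQuadratic → IsLocallyNontrivial χ →
      ‖sumOfSquaresCharSum χ (l : ZMod q)‖ ≤ 8 * (Nat.gcd n q : ℝ) := by
  induction q using Nat.strong_induction_on with
  | _ q ih =>
  intro _ χ hχ hloc
  have hq0 : q ≠ 0 := NeZero.ne q
  by_cases hex : ∃ p : ℕ, p.Prime ∧ p ≠ 2 ∧ p ∣ q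
  · obtain ⟨p, hp, hp2, m, rfl⟩ := hex
    have hm0 : m ≠ 0 := right_ne_zero_of_mul hq0
    have : NeZero m := ⟨hm0⟩
    have : NeZero p := ⟨hp.ne_zero⟩
    have : Fact p.Prime := ⟨hp⟩
    have hcop : p.Coprime m := by
      rw [hp.coprime_iff_not_dvd]
      rintro ⟨r, rfl⟩
      exact not_sq_dvd_of_isLocallyNontrivial hχ hloc hp hp2 ⟨r, by ring⟩
    set e := ZMod.chineseRemainder hcop
    have hLq : (leftChar e χ).IsQuadratic := fun a => hχ _
    have hRq : (rightChar e χ).IsQuadratic := fun a => hχ _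
    have hL1 : leftChar e χ ≠ 1 := by
      intro h1
      obtain ⟨t, hu, ht⟩ := hloc p hp (dvd_mul_right p m)
      rw [Nat.mul_div_cancel_left m hp.pos] at hu ht
      have h2 : e (1 + (m : ZMod (p * m)) * t) = ((e (1 + (m : ZMod (p * m)) * t)).1, 1) := by
        refine Prod.ext rfl ?_
        simp
      have h3 : leftChar e χ (e (1 + (m : ZMod (p * m)) * t)).1 =
          χ (1 + (m : ZMod (p * m)) * t) := by
        rw [leftChar_apply, ← h2, RingEquiv.symm_apply_apply]
      apply ht
      rw [← h3, h1, MulChar.one_apply]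
      exact (Prod.isUnit_iff.1 (hu.map e)).1
    have hRloc : IsLocallyNontrivial (rightChar e χ) := by
      intro p' hp' hp'm
      obtain ⟨r, rfl⟩ := hp'm
      obtain ⟨t, hu, ht⟩ := hloc p' hp' ⟨p * r, by ring⟩
      have hdiv : p * (p' * r) / p' = p * r := by
        rw [show p * (p' * r) = p' * (p * r) by ring, Nat.mul_div_cancel_left _ hp'.pos]
      rw [hdiv] at hu ht
      rw [Nat.mul_div_cancel_left r hp'.pos]
      have h2 : e (1 + ((p * r : ℕ) : ZMod (p * (p' * r))) * t) =
          (1, 1 + (r : ZMod (p' * r)) * (p * (e t).2)) := by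
        refine Prod.ext ?_ ?_
        · simp
        · simp
          ring
      refine ⟨p * (e t).2, ?_, ?_⟩
      · have h3 := (Prod.isUnit_iff.1 (hu.map e)).2
        rw [h2] at h3
        exact h3
      · rw [rightChar_apply, ← h2, RingEquiv.symm_apply_apply]
        exact ht
    have hmlt : m < p * m := by nlinarith [hp.two_le, Nat.pos_of_ne_zero hm0]
    have hR := ih m hmlt hRq hRloc
    rw [sumOfSquaresCharSum_mul e, norm_mul]
    by_cases hpl : p ∣ l
    · have h1 := norm_sumOfSquaresCharSum_le_card hLq (l : ZMod p)
      rw [ZMod.card] at h1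
      have h2 : p * Nat.gcd n m ∣ Nat.gcd n (p * m) := by
        refine Nat.dvd_gcd ?_ (Nat.mul_dvd_mul_left p (Nat.gcd_dvd_right n m))
        exact (Nat.Coprime.coprime_dvd_right (Nat.gcd_dvd_right n m) hcop).mul_dvd_of_dvd_of_dvd
          (hn p hp hpl) (Nat.gcd_dvd_left n m)
      have h3 : ((p * Nat.gcd n m : ℕ) : ℝ) ≤ Nat.gcd n (p * m) := by
        exact_mod_cast Nat.le_of_dvd (Nat.gcd_pos_of_pos_right n (Nat.pos_of_ne_zero hq0)) h2
      push_cast at h3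
      calc _ ≤ (p : ℝ) * (8 * (Nat.gcd n m : ℝ)) :=
            mul_le_mul h1 hR (norm_nonneg _) (Nat.cast_nonneg _)
        _ ≤ _ := by linarith
    · have hl0 : (l : ZMod p) ≠ 0 := by
        rwa [Ne, ZMod.natCast_eq_zero_iff]
      have h1 := sumOfSquaresCharSum_field (by rwa [ZMod.ringChar_zmod_n]) hLq hL1 hl0
      have h3 : (Nat.gcd n m : ℝ) ≤ Nat.gcd n (p * m) := by
        exact_mod_cast Nat.le_of_dvd (Nat.gcd_pos_of_pos_right n (Nat.pos_of_ne_zero hq0))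
          (Nat.gcd_dvd_gcd_mul_left_right n m p)
      rw [h1, norm_neg, norm_one, one_mul]
      linarith
  · push Not at hex
    have h2 : q = 2 ^ q.primeFactorsList.length :=
      Nat.eq_prime_pow_of_unique_prime_dvd hq0 fun {d} hd hdq => by
        by_contra h
        exact hex d hd h hdq
    have h16 := not_sixteen_dvd_of_isLocallyNontrivial hχ hloc
    have hlen : q.primeFactorsList.length < 4 := by
      by_contra! h
      apply h16
      rw [h2]
      exact (pow_dvd_pow 2 h)
    have hq8 : q ≤ 8 := by
      rw [h2]
      exact Nat.pow_le_pow_right (by norm_num) (show q.primeFactorsList.length ≤ 3 by omega)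
    have h1 := norm_sumOfSquaresCharSum_le_card hχ (l : ZMod q)
    rw [ZMod.card] at h1
    have h3 : (1 : ℝ) ≤ Nat.gcd n q := by
      exact_mod_cast Nat.gcd_pos_of_pos_right n (Nat.pos_of_ne_zero hq0)
    have h4 : (q : ℝ) ≤ 8 := by exact_mod_cast hq8
    linarith

theorem exists_mem_range_forall_dvd_sub_iff {a d : ℕ} (hd : 0 < d) (h : a.Coprime d) (y : ℤ) :
    ∃ x ∈ Finset.range d, ∀ x' ∈ Finset.range d, ((d : ℤ) ∣ y - a * x' ↔ x' = x) := by
  have : NeZero d := ⟨hd.ne'⟩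
  set u := ZMod.unitOfCoprime a h
  have hu : (u : ZMod d) = a := ZMod.coe_unitOfCoprime a h
  refine ⟨((u⁻¹ : (ZMod d)ˣ) * (y : ZMod d)).val, Finset.mem_range.2 (ZMod.val_lt _), ?_⟩
  intro x' hx'
  rw [Finset.mem_range] at hx'
  rw [← ZMod.intCast_zmod_eq_zero_iff_dvd]
  push_cast
  rw [sub_eq_zero, ← hu]
  constructor
  · intro h1
    rw [h1, Units.inv_mul_cancel_left, ZMod.val_natCast_of_lt hx']
  · intro h1
    rw [h1, ZMod.natCast_zmod_val, Units.mul_inv_cancel_left]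

theorem sum_moebius_divisors_filter {n m : ℕ} (hn : 0 < n) :
    ∑ b ∈ n.divisors, (if b ∣ m then (μ b : ℂ) else 0) = if n.Coprime m then 1 else 0 := by
  have h1 : (Nat.gcd n m).divisors = n.divisors.filter (fun b => b ∣ m) := by
    ext b
    simp only [Nat.mem_divisors, Finset.mem_filter, Nat.dvd_gcd_iff]
    have h0 : Nat.gcd n m ≠ 0 := (Nat.gcd_pos_of_pos_left m hn).ne'
    exact ⟨fun h => ⟨⟨h.1.1, hn.ne'⟩, h.1.2⟩, fun h => ⟨⟨h.1.1, h.2⟩, h0⟩⟩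
  rw [← Finset.sum_filter, ← h1, ← Int.cast_sum]
  have h2 := congrArg (fun f => f (Nat.gcd n m)) ArithmeticFunction.moebius_mul_coe_zeta
  simp only [ArithmeticFunction.coe_mul_zeta_apply, ArithmeticFunction.one_apply] at h2
  rw [h2]
  simp [Nat.Coprime]

theorem sum_rootSet_sum_range {d q l : ℕ} (hd : 0 < d) (hq : 0 < q) (hdq : d.Coprime q)
    (hl : l.Coprime d) (m : ℤ) (f : ZMod q → ℂ) :
    ∑ ω ∈ rootSet q d, ∑ z ∈ Finset.range q,
      (if (d * q : ℤ) ∣ m - (q * ω * l + d * z) then f ((d * z : ℕ) : ZMod q) else 0) =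
      if (d : ℤ) ∣ (l : ℤ) ^ 2 + m ^ 2 then f (m : ZMod q) else 0 := by
  obtain ⟨ω₀, hω₀, hω⟩ := exists_mem_range_forall_dvd_sub_iff (a := q * l) hd
    (Nat.Coprime.mul_left hdq.symm hl) m
  obtain ⟨z₀, hz₀, hz⟩ := exists_mem_range_forall_dvd_sub_iff (a := d) hq hdq m
  have hdqz : IsCoprime (d : ℤ) (q : ℤ) := Nat.isCoprime_iff_coprime.2 hdq
  have hiff : ∀ ω ∈ rootSet q d, ∀ z ∈ Finset.range q,
      ((d * q : ℤ) ∣ m - (q * ω * l + d * z) ↔ ω = ω₀ ∧ z = z₀) := by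
    intro ω hω1 z hz1
    rw [← hω ω (Finset.mem_range.2 (mem_rootSet.1 hω1).1), ← hz z hz1]
    have e1 : (d : ℤ) ∣ m - (q * ω * l + d * z) ↔ (d : ℤ) ∣ m - (q * l : ℕ) * ω := by
      have : m - (q * l : ℕ) * ω = (m - (q * ω * l + d * z)) + d * z := by push_cast; ring
      rw [this, dvd_add_left (dvd_mul_right _ _)]
    have e2 : (q : ℤ) ∣ m - (q * ω * l + d * z) ↔ (q : ℤ) ∣ m - d * z := by
      have : m - d * z = (m - (q * ω * l + d * z)) + q * (ω * l) := by ring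
      rw [this, dvd_add_left (dvd_mul_right _ _)]
    rw [← e1, ← e2]
    exact ⟨fun h => ⟨(dvd_mul_right _ _).trans h, (dvd_mul_left _ _).trans h⟩,
      fun h => hdqz.mul_dvd h.1 h.2⟩
  have hmω : (d : ℤ) ∣ m - (q * l : ℕ) * ω₀ := (hω ω₀ hω₀).2 rfl
  have hroot : ω₀ ∈ rootSet q d ↔ (d : ℤ) ∣ (l : ℤ) ^ 2 + m ^ 2 := by
    have h1 : (l : ℤ) ^ 2 + m ^ 2 = l ^ 2 * ((q * ω₀) ^ 2 + 1) +
        (m - (q * l : ℕ) * ω₀) * (m + (q * l : ℕ) * ω₀) := by push_cast; ring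
    rw [mem_rootSet, h1, dvd_add_left (hmω.mul_right _)]
    have hcop : IsCoprime (d : ℤ) ((l : ℤ) ^ 2) :=
      (Nat.isCoprime_iff_coprime.2 hl.symm).pow_right
    constructor
    · intro h
      have : (d : ℤ) ∣ (q * ω₀) ^ 2 + 1 := by exact_mod_cast h.2
      exact this.mul_left _
    · intro h
      refine ⟨Finset.mem_range.1 hω₀, ?_⟩
      exact_mod_cast hcop.dvd_of_dvd_mul_left h
  have hfz : f ((d * z₀ : ℕ) : ZMod q) = f (m : ZMod q) := by
    congr 1
    have h1 := (hz z₀ hz₀).2 rfl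
    rw [← ZMod.intCast_zmod_eq_zero_iff_dvd] at h1
    push_cast at h1 ⊢
    exact (sub_eq_zero.1 h1).symm
  calc _ = ∑ ω ∈ rootSet q d, ∑ z ∈ Finset.range q,
        (if ω = ω₀ then (if z = z₀ then f ((d * z : ℕ) : ZMod q) else 0) else 0) := by
        refine Finset.sum_congr rfl fun ω hω1 => Finset.sum_congr rfl fun z hz1 => ?_
        rw [← ite_and]
        exact if_congr (hiff ω hω1 z hz1) rfl rfl
    _ = ∑ ω ∈ rootSet q d, (if ω = ω₀ then f (m : ZMod q) else 0) := by
        refine Finset.sum_congr rfl fun ω _ => ?_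
        split_ifs with h
        · rw [Finset.sum_ite_eq', if_pos hz₀, hfz]
        · simp
    _ = _ := by
        rw [Finset.sum_ite_eq']
        exact if_congr hroot rfl rfl

open Classical in
/-- Detection of the conditions `(n ^ k, m) = 1` and `d ∣ n ^ (2 k) + m ^ 2` by arithmetic
progressions. -/
theorem sum_divisors_sum_rootSet {k n d q : ℕ} (hk : 1 ≤ k) (hn : 0 < n) (hd : 0 < d) (hq : 0 < q)
    (hdq : d.Coprime q) (hnd : n.Coprime d) (m : ℤ) (χ : MulChar (ZMod q) ℂ) :
    ∑ b ∈ n.divisors, (μ b : ℂ) * ∑ ω ∈ rootSet q d, ∑ z ∈ Finset.range q,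
      (if ∃ j : ℤ, m = b * (q * ω * (n ^ k / b : ℕ) + d * z + d * q * j) then
        χ ((b : ZMod q) ^ 2 * (((n ^ k / b : ℕ) : ZMod q) ^ 2 + ((d * z : ℕ) : ZMod q) ^ 2)) else 0) =
      if IsCoprime ((n ^ k : ℕ) : ℤ) m ∧ (d : ℤ) ∣ ((n ^ k : ℕ) : ℤ) ^ 2 + m ^ 2 then
        χ (((((n ^ k : ℕ) : ℤ) ^ 2 + m ^ 2 : ℤ)) : ZMod q) else 0 := by
  have hb : ∀ b ∈ n.divisors, (μ b : ℂ) * ∑ ω ∈ rootSet q d, ∑ z ∈ Finset.range q,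
      (if ∃ j : ℤ, m = b * (q * ω * (n ^ k / b : ℕ) + d * z + d * q * j) then
        χ ((b : ZMod q) ^ 2 * (((n ^ k / b : ℕ) : ZMod q) ^ 2 + ((d * z : ℕ) : ZMod q) ^ 2)) else 0) =
      (if b ∣ m.natAbs then (μ b : ℂ) else 0) *
        (if (d : ℤ) ∣ ((n ^ k : ℕ) : ℤ) ^ 2 + m ^ 2 then
          χ (((((n ^ k : ℕ) : ℤ) ^ 2 + m ^ 2 : ℤ)) : ZMod q) else 0) := by
    intro b hb
    have hbn := Nat.dvd_of_mem_divisors hb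
    have hb0 : 0 < b := Nat.pos_of_mem_divisors hb
    have hbz : (b : ℤ) ≠ 0 := by exact_mod_cast hb0.ne'
    have hbnk : b ∣ n ^ k := hbn.trans (dvd_pow_self n (by omega))
    obtain ⟨l, hl⟩ := hbnk
    have hdiv : n ^ k / b = l := by rw [hl, Nat.mul_div_cancel_left _ hb0]
    rw [hdiv]
    have hbd : b.Coprime d := Nat.Coprime.coprime_dvd_left hbn hnd
    have hld : l.Coprime d :=
      Nat.Coprime.coprime_dvd_left ⟨b, by rw [hl, mul_comm]⟩ (hnd.pow_left k)
    by_cases hbm : b ∣ m.natAbs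
    · rw [if_pos hbm]
      obtain ⟨m', rfl⟩ := Int.natCast_dvd.2 hbm
      congr 1
      have h1 := sum_rootSet_sum_range hd hq hdq hld m'
        (fun y => χ ((b : ZMod q) ^ 2 * ((l : ZMod q) ^ 2 + y ^ 2)))
      have h2 : ∀ ω z : ℕ, (∃ j : ℤ, (b : ℤ) * m' = b * (q * ω * l + d * z + d * q * j)) ↔
          (d * q : ℤ) ∣ m' - (q * ω * l + d * z) := by
        intro ω z
        constructor
        · rintro ⟨j, hj⟩
          exact ⟨j, by linear_combination mul_left_cancel₀ hbz hj⟩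
        · rintro ⟨j, hj⟩
          exact ⟨j, by linear_combination (b : ℤ) * hj⟩
      simp_rw [h2]
      rw [h1]
      have h3 : ((n ^ k : ℕ) : ℤ) ^ 2 + (b * m') ^ 2 = (b : ℤ) ^ 2 * ((l : ℤ) ^ 2 + m' ^ 2) := by
        rw [hl]; push_cast; ring
      rw [h3]
      have h4 : (d : ℤ) ∣ (b : ℤ) ^ 2 * ((l : ℤ) ^ 2 + m' ^ 2) ↔ (d : ℤ) ∣ (l : ℤ) ^ 2 + m' ^ 2 :=
        ⟨fun h => (Nat.isCoprime_iff_coprime.2 hbd.symm).pow_right.dvd_of_dvd_mul_left h,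
          fun h => h.mul_left _⟩
      rw [if_congr h4 rfl rfl]
      push_cast
      rfl
    · rw [if_neg hbm, zero_mul]
      have h2 : ∀ ω z : ℕ, ¬ ∃ j : ℤ, m = b * (q * ω * l + d * z + d * q * j) := by
        rintro ω z ⟨j, hj⟩
        exact hbm (Int.natCast_dvd.1 ⟨_, hj⟩)
      simp_rw [if_neg (h2 _ _)]
      simp
  rw [Finset.sum_congr rfl hb, ← Finset.sum_mul, sum_moebius_divisors_filter hn, ite_and]
  have hc : IsCoprime ((n ^ k : ℕ) : ℤ) m ↔ n.Coprime m.natAbs := by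
    rw [Int.isCoprime_iff_gcd_eq_one, Int.gcd_def, Int.natAbs_natCast, ← Nat.coprime_iff_gcd_eq_one,
      Nat.coprime_pow_left_iff (by omega)]
  by_cases h : n.Coprime m.natAbs
  · rw [if_pos h, if_pos (hc.2 h), one_mul]
  · rw [if_neg h, if_neg (fun h' => h (hc.1 h')), zero_mul]

theorem hasFiniteSupport_dilate_intCast {ψ : ℝ → ℂ} {R : ℝ} (hR : ∀ u, R < |u| → ψ u = 0)
    {M : ℝ} (hM : 0 < M) (m₀ : ℝ) :
    (Function.support fun m : ℤ => ψ (((m : ℝ) - m₀) / M)).Finite := by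
  refine (Set.finite_Icc ⌈m₀ - R * M⌉ ⌊m₀ + R * M⌋).subset ?_
  intro m hm
  have h1 : |((m : ℝ) - m₀) / M| ≤ R := by
    by_contra! h
    exact hm (hR _ h)
  rw [abs_div, abs_of_pos hM, div_le_iff₀ hM, abs_le] at h1
  rw [Set.mem_Icc, Int.ceil_le, Int.le_floor]
  constructor <;> linarith

theorem summable_ite_dilate {ψ : ℝ → ℂ} {R : ℝ} (hR : ∀ u, R < |u| → ψ u = 0)
    {M : ℝ} (hM : 0 < M) (m₀ : ℝ) (p : ℤ → Prop) [DecidablePred p] (v : ℂ) :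
    Summable fun m : ℤ => (if p m then v else 0) * ψ (((m : ℝ) - m₀) / M) := by
  refine summable_of_hasFiniteSupport
    ((hasFiniteSupport_dilate_intCast hR hM m₀).subset fun m hm => ?_)
  exact right_ne_zero_of_mul hm

open Classical in
/-- Poisson summation along an arithmetic progression. -/
theorem tsum_progression_eq {ψ : ℝ → ℂ} (hψ : ContDiff ℝ ((⊤ : ℕ∞) : WithTop ℕ∞) ψ)
    {R : ℝ} (hR : ∀ u, R < |u| → ψ u = 0) {M : ℝ} (hM : 0 < M) (m₀ : ℝ) {b d q : ℕ}
    (hb : 0 < b) (hd : 0 < d) (hq : 0 < q) (ω l z : ℕ) (v : ℂ) :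
    (∑' m : ℤ,
      (if ∃ j : ℤ, m = b * (q * ω * l + d * z + d * q * j) then v else 0) *
        ψ (((m : ℝ) - m₀) / M)) =
      v * ∑' h : ℤ, fcoeff (dilate ψ (b * d * q) M m₀) h *
        (ex (h * l * (ω / d)) * ex (h * (z / q))) := by
  have hbr : (0 : ℝ) < b := by exact_mod_cast hb
  have hdr : (0 : ℝ) < d := by exact_mod_cast hd
  have hqr : (0 : ℝ) < q := by exact_mod_cast hq
  have ht : (0 : ℝ) < b * d * q := by positivity
  set g : ℤ → ℤ := fun j => b * (q * ω * l + d * z + d * q * j) with hg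
  have hginj : Function.Injective g := by
    intro i j hij
    have h1 : (b : ℤ) * (d * q) ≠ 0 := by positivity
    refine mul_left_cancel₀ h1 ?_
    simp only [hg] at hij
    linear_combination hij
  rw [← hginj.tsum_eq]
  · have h2 := tsum_comp_add_eq_tsum_fcoeff (contDiff_dilate hψ (b * d * q) M m₀)
      (hasCompactSupport_dilate hR ht hM) ((q * ω * l + d * z) / (d * q))
    calc ∑' j : ℤ, (if ∃ i : ℤ, g j = b * (q * ω * l + d * z + d * q * i) then v else 0) *
          ψ (((g j : ℝ) - m₀) / M)
        = ∑' j : ℤ, v * dilate ψ (b * d * q) M m₀ ((q * ω * l + d * z) / (d * q) + j) := by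
          refine tsum_congr fun j => ?_
          rw [if_pos ⟨j, rfl⟩, dilate]
          congr 3
          simp only [hg]
          push_cast
          field_simp
      _ = v * ∑' h : ℤ, fcoeff (dilate ψ (b * d * q) M m₀) h *
            ex (h * ((q * ω * l + d * z) / (d * q))) := by rw [tsum_mul_left, h2]
      _ = _ := by
          congr 1
          refine tsum_congr fun h => ?_
          rw [← ex_add]
          congr 2
          field_simp
  · intro m hm
    have h1 := left_ne_zero_of_mul hm
    by_contra h2
    apply h1
    rw [if_neg]
    rintro ⟨j, hj⟩
    exact h2 ⟨j, hj.symm⟩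

/-- The value of the character `χ` at `b ^ 2 * ((n ^ k / b) ^ 2 + y ^ 2)`. -/
def progChar {q : ℕ} (χ : MulChar (ZMod q) ℂ) (k n b y : ℕ) : ℂ :=
  χ ((b : ZMod q) ^ 2 * (((n ^ k / b : ℕ) : ZMod q) ^ 2 + (y : ZMod q) ^ 2))

/-- The term of frequency `h` after Poisson summation. -/
def poissonTerm (ψ : ℝ → ℂ) (M m₀ : ℝ) (q d b l ω z : ℕ) (h : ℤ) : ℂ :=
  fcoeff (dilate ψ (b * d * q) M m₀) h * (ex (h * l * (ω / d)) * ex (h * (z / q)))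

open Classical in
/-- The inner sum of `twistedSum`. -/
def innerSum (ψ : ℝ → ℂ) {q : ℕ} (χ : DirichletCharacter ℂ q) (M m₀ : ℝ) (v : ℂ) (d l : ℕ) : ℂ :=
  ∑' m : ℤ, if IsCoprime (l : ℤ) m ∧ (d : ℤ) ∣ (l : ℤ) ^ 2 + m ^ 2 then
      v * ψ (((m : ℝ) - m₀) / M) * χ ((((l : ℤ) ^ 2 + m ^ 2 : ℤ)) : ZMod q)
    else 0

theorem summable_poissonTerm {ψ : ℝ → ℂ} (hψ : ContDiff ℝ ((⊤ : ℕ∞) : WithTop ℕ∞) ψ)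
    {R : ℝ} (hR : ∀ u, R < |u| → ψ u = 0) {M : ℝ} (hM : 0 < M) (m₀ : ℝ) {b d q : ℕ}
    (hb : 0 < b) (hd : 0 < d) (hq : 0 < q) (l ω z : ℕ) :
    Summable (poissonTerm ψ M m₀ q d b l ω z) := by
  have ht : (0 : ℝ) < b * d * q := by positivity
  refine Summable.of_norm ((summable_norm_fcoeff (contDiff_dilate hψ (b * d * q) M m₀)
    (hasCompactSupport_dilate hR ht hM)).congr fun h => ?_)
  rw [poissonTerm, norm_mul, norm_mul, norm_ex, norm_ex, mul_one, mul_one]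

theorem innerSum_eq_zero_of_not_coprime (ψ : ℝ → ℂ) {q : ℕ} [NeZero q]
    (χ : DirichletCharacter ℂ q)
    (M m₀ : ℝ) (v : ℂ) {d : ℕ} (l : ℕ) (hdq : ¬ d.Coprime q) : innerSum ψ χ M m₀ v d l = 0 := by
  rw [innerSum]
  refine (tsum_congr fun m => ?_).trans tsum_zero
  split_ifs with h
  · rw [MulChar.map_nonunit, mul_zero]
    obtain ⟨p, hp, hpd, hpq⟩ := Nat.Prime.not_coprime_iff_dvd.1 hdq
    intro hu
    have h1 := hu.map (ZMod.castHom hpq (ZMod p))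
    rw [map_intCast, (ZMod.intCast_zmod_eq_zero_iff_dvd _ _).2
      ((Int.natCast_dvd_natCast.2 hpd).trans h.2)] at h1
    have : Fact p.Prime := ⟨hp⟩
    exact not_isUnit_zero h1
  · rfl

theorem innerSum_pow_eq_zero_of_not_coprime (ψ : ℝ → ℂ) {q : ℕ} (χ : DirichletCharacter ℂ q)
    (M m₀ : ℝ) (v : ℂ) {d n k : ℕ} (hk : 1 ≤ k) (hnd : ¬ n.Coprime d) :
    innerSum ψ χ M m₀ v d (n ^ k) = 0 := by
  rw [innerSum]
  refine (tsum_congr fun m => if_neg ?_).trans tsum_zero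
  rintro ⟨h1, h2⟩
  obtain ⟨p, hp, hpn, hpd⟩ := Nat.Prime.not_coprime_iff_dvd.1 hnd
  have hpl : (p : ℤ) ∣ ((n ^ k : ℕ) : ℤ) :=
    Int.natCast_dvd_natCast.2 (hpn.trans (dvd_pow_self n (by omega)))
  have hpm : (p : ℤ) ∣ m ^ 2 := by
    have h3 := (Int.natCast_dvd_natCast.2 hpd).trans h2
    exact (dvd_add_right (hpl.trans (dvd_pow_self _ two_ne_zero))).1 h3
  have h4 := h1.isUnit_of_dvd' hpl ((Nat.prime_iff_prime_int.1 hp).dvd_of_dvd_pow hpm)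
  exact (Nat.prime_iff_prime_int.1 hp).not_isUnit h4

theorem innerSum_pow_eq {ψ : ℝ → ℂ} (hψ : ContDiff ℝ ((⊤ : ℕ∞) : WithTop ℕ∞) ψ)
    {R : ℝ} (hR : ∀ u, R < |u| → ψ u = 0) {M : ℝ} (hM : 0 < M) (m₀ : ℝ) {k n d q : ℕ}
    (hk : 1 ≤ k) (hn : 0 < n) (hd : 0 < d) (hq : 0 < q) (hdq : d.Coprime q) (hnd : n.Coprime d)
    (χ : DirichletCharacter ℂ q) (v : ℂ) :
    innerSum ψ χ M m₀ v d (n ^ k) =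
      v * ∑ b ∈ n.divisors, (μ b : ℂ) * ∑ ω ∈ rootSet q d, ∑ z ∈ Finset.range q,
        progChar χ k n b (d * z) * ∑' h : ℤ, poissonTerm ψ M m₀ q d b (n ^ k / b) ω z h := by
  classical
  set F : ℕ → ℕ → ℕ → ℤ → ℂ := fun b ω z m =>
    (if ∃ j : ℤ, m = b * (q * ω * (n ^ k / b : ℕ) + d * z + d * q * j) then
      progChar χ k n b (d * z) else 0) * ψ (((m : ℝ) - m₀) / M) with hF
  have hsum : ∀ b ω z, Summable (F b ω z) := fun b ω z =>
    summable_ite_dilate hR hM m₀ _ _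
  have h1 : innerSum ψ χ M m₀ v d (n ^ k) = ∑' m : ℤ, v * ∑ b ∈ n.divisors, (μ b : ℂ) *
      ∑ ω ∈ rootSet q d, ∑ z ∈ Finset.range q, F b ω z m := by
    rw [innerSum]
    refine tsum_congr fun m => ?_
    have h2 := sum_divisors_sum_rootSet hk hn hd hq hdq hnd m χ
    have h3 : ∑ b ∈ n.divisors, (μ b : ℂ) * ∑ ω ∈ rootSet q d, ∑ z ∈ Finset.range q, F b ω z m =
        (∑ b ∈ n.divisors, (μ b : ℂ) * ∑ ω ∈ rootSet q d, ∑ z ∈ Finset.range q,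
          (if ∃ j : ℤ, m = b * (q * ω * (n ^ k / b : ℕ) + d * z + d * q * j) then
            progChar χ k n b (d * z) else 0)) * ψ (((m : ℝ) - m₀) / M) := by
      rw [Finset.sum_mul]
      refine Finset.sum_congr rfl fun b _ => ?_
      rw [mul_assoc, Finset.sum_mul]
      congr 1
      refine Finset.sum_congr rfl fun ω _ => ?_
      rw [Finset.sum_mul]
    rw [h3]
    simp only [progChar]
    rw [h2]
    split_ifs
    · ring
    · ring
  have hsum3 : ∀ b, Summable fun m => ∑ ω ∈ rootSet q d, ∑ z ∈ Finset.range q, F b ω z m :=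
    fun b => summable_sum fun ω _ => summable_sum fun z _ => hsum b ω z
  rw [h1, tsum_mul_left, Summable.tsum_finsetSum fun b _ => (hsum3 b).mul_left _]
  congr 1
  refine Finset.sum_congr rfl fun b hb => ?_
  have hb0 : 0 < b := Nat.pos_of_mem_divisors hb
  rw [tsum_mul_left, Summable.tsum_finsetSum fun ω _ => summable_sum fun z _ => hsum b ω z]
  congr 1
  refine Finset.sum_congr rfl fun ω _ => ?_
  rw [Summable.tsum_finsetSum fun z _ => hsum b ω z]
  refine Finset.sum_congr rfl fun z _ => ?_
  exact tsum_progression_eq hψ hR hM m₀ hb0 hd hq ω (n ^ k / b) z _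

/-- The positive integers `n` with `L < n ^ k ≤ 2 L`. -/
def powerRange (k : ℕ) (L : ℝ) : Finset ℕ :=
  (Finset.Icc 1 ⌊(2 * L) ^ (1 / (k : ℝ))⌋₊).filter fun n => n ^ k ∈ dyadic L

theorem sum_dyadic_eq_sum_powerRange {k : ℕ} (hk : 1 ≤ k) {L : ℝ} (hL : 0 < L) (F : ℕ → ℂ)
    (hF : ∀ l, (¬ ∃ n : ℕ, l = n ^ k) → F l = 0) :
    ∑ l ∈ dyadic L, F l = ∑ n ∈ powerRange k L, F (n ^ k) := by
  rw [← Finset.sum_image (f := F) (g := fun n => n ^ k)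
    (fun a _ b _ h => Nat.pow_left_injective (by omega) h)]
  refine (Finset.sum_subset ?_ ?_).symm
  · intro l hl
    obtain ⟨n, hn, rfl⟩ := Finset.mem_image.1 hl
    exact (Finset.mem_filter.1 hn).2
  · intro l hl hl2
    refine hF l ?_
    rintro ⟨n, rfl⟩
    refine hl2 (Finset.mem_image.2 ⟨n, Finset.mem_filter.2 ⟨?_, hl⟩, rfl⟩)
    rw [mem_dyadic hL.le] at hl
    rw [Finset.mem_Icc]
    constructor
    · rcases Nat.eq_zero_or_pos n with rfl | h
      · rw [zero_pow (by omega), Nat.cast_zero] at hl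
        linarith [hl.1]
      · exact h
    · refine Nat.le_floor ?_
      have hk0 : (0 : ℝ) < k := by exact_mod_cast hk
      have h1 : (n : ℝ) = ((n : ℝ) ^ k) ^ (1 / (k : ℝ)) := by
        rw [← Real.rpow_natCast, ← Real.rpow_mul (Nat.cast_nonneg n), mul_one_div_cancel hk0.ne',
          Real.rpow_one]
      rw [h1]
      refine Real.rpow_le_rpow (by positivity) ?_ (by positivity)
      exact_mod_cast hl.2

/-- The integers `d` with `D < d ≤ 2 D` that are coprime to `q`. -/
def coprimeRange (q : ℕ) (D : ℝ) : Finset ℕ := (dyadic D).filter fun d => d.Coprime q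

/-- The contribution of the zero frequency. -/
def mainPart (α lam : ℕ → ℂ) (ψ : ℝ → ℂ) {q : ℕ} (χ : DirichletCharacter ℂ q) (k : ℕ)
    (M L D m₀ : ℝ) : ℂ :=
  ∑ d ∈ coprimeRange q D, ∑ n ∈ (powerRange k L).filter fun n => n.Coprime d,
    ∑ b ∈ n.divisors, ∑ ω ∈ rootSet q d, ∑ z ∈ Finset.range q,
      (μ b : ℂ) * (α d * (lam (n ^ k) * progChar χ k n b (d * z) *
        poissonTerm ψ M m₀ q d b (n ^ k / b) ω z 0))

/-- The contribution of the nonzero frequencies. -/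
def errorPart (α lam : ℕ → ℂ) (ψ : ℝ → ℂ) {q : ℕ} (χ : DirichletCharacter ℂ q) (k : ℕ)
    (M L D m₀ : ℝ) : ℂ :=
  ∑ d ∈ coprimeRange q D, ∑ n ∈ (powerRange k L).filter fun n => n.Coprime d,
    ∑ b ∈ n.divisors, ∑ ω ∈ rootSet q d, ∑ z ∈ Finset.range q,
      (μ b : ℂ) * (α d * (lam (n ^ k) * progChar χ k n b (d * z) *
        ∑' h : ℤ, if h = 0 then 0 else poissonTerm ψ M m₀ q d b (n ^ k / b) ω z h))

theorem twistedSum_eq_mainPart_add_errorPart {α lam : ℕ → ℂ} {ψ : ℝ → ℂ}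
    (hψ : ContDiff ℝ ((⊤ : ℕ∞) : WithTop ℕ∞) ψ) {R : ℝ} (hR : ∀ u, R < |u| → ψ u = 0) {q : ℕ}
    (hq : 0 < q) (χ : DirichletCharacter ℂ q) {k : ℕ} (hk : 1 ≤ k)
    (hlam : IsPowerCoefficient k lam) {M L D : ℝ} (hM : 0 < M) (hL : 0 < L) (hD : 0 < D) (m₀ : ℝ) :
    twistedSum α lam ψ χ M L D m₀ =
      mainPart α lam ψ χ k M L D m₀ + errorPart α lam ψ χ k M L D m₀ := by
  classical
  have : NeZero q := ⟨hq.ne'⟩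
  have h1 : twistedSum α lam ψ χ M L D m₀ = ∑ d ∈ dyadic D, α d *
      ∑ l ∈ dyadic L, innerSum ψ χ M m₀ (lam l) d l := rfl
  have h2 : ∀ d, ∑ l ∈ dyadic L, innerSum ψ χ M m₀ (lam l) d l =
      ∑ n ∈ powerRange k L, innerSum ψ χ M m₀ (lam (n ^ k)) d (n ^ k) := by
    intro d
    refine sum_dyadic_eq_sum_powerRange hk hL _ fun l hl => ?_
    have h3 : lam l = 0 := by
      have h4 := hlam l
      rw [Set.indicator_of_notMem (by exact hl)] at h4
      exact norm_le_zero_iff.1 h4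
    rw [innerSum, h3]
    refine (tsum_congr fun m => ?_).trans tsum_zero
    simp
  rw [h1, mainPart, errorPart, ← Finset.sum_add_distrib, coprimeRange, Finset.sum_filter]
  refine Finset.sum_congr rfl fun d hd => ?_
  rw [h2]
  have hd0 : 0 < d := by
    rw [mem_dyadic hD.le] at hd
    exact_mod_cast hD.trans hd.1
  by_cases hdq : d.Coprime q
  swap
  · rw [if_neg hdq, Finset.sum_eq_zero, mul_zero]
    intro n _
    exact innerSum_eq_zero_of_not_coprime ψ χ M m₀ _ _ hdq
  rw [if_pos hdq, ← Finset.sum_add_distrib, Finset.sum_filter, Finset.mul_sum]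
  refine Finset.sum_congr rfl fun n hn => ?_
  by_cases hnd : n.Coprime d
  swap
  · rw [if_neg hnd, innerSum_pow_eq_zero_of_not_coprime ψ χ M m₀ _ hk hnd, mul_zero]
  have hn0 : 0 < n := (Finset.mem_Icc.1 (Finset.mem_filter.1 hn).1).1
  rw [if_pos hnd, innerSum_pow_eq hψ hR hM m₀ hk hn0 hd0 hq hdq hnd, ← Finset.sum_add_distrib,
    Finset.mul_sum, Finset.mul_sum]
  refine Finset.sum_congr rfl fun b hb => ?_
  have hb0 : 0 < b := Nat.pos_of_mem_divisors hb
  rw [← Finset.sum_add_distrib, Finset.mul_sum, Finset.mul_sum, Finset.mul_sum]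
  refine Finset.sum_congr rfl fun ω _ => ?_
  rw [← Finset.sum_add_distrib, Finset.mul_sum, Finset.mul_sum, Finset.mul_sum]
  refine Finset.sum_congr rfl fun z _ => ?_
  rw [(summable_poissonTerm hψ hR hM m₀ hb0 hd0 hq _ ω z).tsum_eq_add_tsum_ite 0]
  ring

theorem sum_range_natCast_zmod {q : ℕ} [NeZero q] (f : ZMod q → ℂ) :
    ∑ z ∈ Finset.range q, f (z : ZMod q) = ∑ a : ZMod q, f a :=
  Finset.sum_nbij' (fun z => (z : ZMod q)) ZMod.val (fun _ _ => Finset.mem_univ _)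
    (fun a _ => Finset.mem_range.2 (ZMod.val_lt a))
    (fun _ hz => ZMod.val_natCast_of_lt (Finset.mem_range.1 hz))
    (fun a _ => ZMod.natCast_zmod_val a) (fun _ _ => rfl)

theorem norm_sum_progChar_le {q : ℕ} [NeZero q] {χ : DirichletCharacter ℂ q}
    (hχp : χ.IsPrimitive) (hχ : χ.IsQuadratic) {k n b d : ℕ} (hk : 1 ≤ k) (hb : b ∣ n)
    (hdq : d.Coprime q) :
    ‖∑ z ∈ Finset.range q, progChar χ k n b (d * z)‖ ≤ 8 * (Nat.gcd n q : ℝ) := by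
  by_cases hbq : b.Coprime q
  · set u := ZMod.unitOfCoprime (b * d) (Nat.Coprime.mul_left hbq hdq) with hu
    have hu' : (u : ZMod q) = (b : ZMod q) * d := by
      rw [hu, ZMod.coe_unitOfCoprime, Nat.cast_mul]
    have h1 : ∀ z ∈ Finset.range q, progChar χ k n b (d * z) =
        (fun a : ZMod q => χ (((n ^ k : ℕ) : ZMod q) ^ 2 + (u * a) ^ 2)) (z : ZMod q) := by
      intro z _
      have h2 : b * (n ^ k / b) = n ^ k := Nat.mul_div_cancel' (hb.trans (dvd_pow_self n (by omega)))
      have h4 : ((n ^ k : ℕ) : ZMod q) = b * ((n ^ k / b : ℕ) : ZMod q) := by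
        rw [← Nat.cast_mul, h2]
      rw [progChar, hu', h4]
      congr 1
      push_cast
      ring
    rw [Finset.sum_congr rfl h1, sum_range_natCast_zmod
      (fun a : ZMod q => χ (((n ^ k : ℕ) : ZMod q) ^ 2 + (u * a) ^ 2))]
    have h3 : ∑ a : ZMod q, χ (((n ^ k : ℕ) : ZMod q) ^ 2 + (u * a) ^ 2) =
        sumOfSquaresCharSum χ ((n ^ k : ℕ) : ZMod q) :=
      Equiv.sum_comp (Units.mulLeft u) (fun a => χ (((n ^ k : ℕ) : ZMod q) ^ 2 + a ^ 2))
    rw [h3]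
    exact norm_sumOfSquaresCharSum_le (fun p hp h => hp.dvd_of_dvd_pow h) q hχ
      (isLocallyNontrivial_of_isPrimitive hχp)
  · have h1 : ∀ y, progChar χ k n b y = 0 := by
      intro y
      rw [progChar]
      refine χ.map_nonunit fun h => hbq ?_
      have h2 := isUnit_of_mul_isUnit_left h
      rw [isUnit_pow_iff two_ne_zero] at h2
      exact (ZMod.isUnit_iff_coprime b q).1 h2
    simp [h1]

theorem norm_moebius_le_one (b : ℕ) : ‖((μ b : ℤ) : ℂ)‖ ≤ 1 := by
  rw [Complex.norm_intCast]
  exact_mod_cast ArithmeticFunction.abs_moebius_le_one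

theorem norm_powerCoefficient_le_one {k : ℕ} {lam : ℕ → ℂ} (h : IsPowerCoefficient k lam) (l : ℕ) :
    ‖lam l‖ ≤ 1 :=
  (h l).trans (Set.indicator_le_self' (fun _ _ => zero_le_one) l)

theorem sum_divisors_inv_le {n Y : ℕ} (hn : n ≤ Y) :
    ∑ b ∈ n.divisors, (b : ℝ)⁻¹ ≤ 1 + Real.log Y := by
  refine (Finset.sum_le_sum_of_subset_of_nonneg (t := Finset.Icc 1 Y) ?_
    fun _ _ _ => by positivity).trans (sum_Icc_inv_le Y)
  intro b hb
  exact Finset.mem_Icc.2 ⟨Nat.pos_of_mem_divisors hb, (Nat.divisor_le hb).trans hn⟩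

theorem norm_mainPart_le {α lam : ℕ → ℂ} {ψ : ℝ → ℂ} {G : ℝ} (hG : ‖∫ u, ψ u‖ ≤ G)
    {q : ℕ} (hq : 0 < q) {χ : DirichletCharacter ℂ q} (hχp : χ.IsPrimitive) (hχ : χ.IsQuadratic)
    {k : ℕ} (hk : 1 ≤ k) (hlam : IsPowerCoefficient k lam) {M L D : ℝ} (hM : 0 < M)
    (hD : 0 < D) (m₀ : ℝ) {Y : ℕ} (hY : ⌊(2 * L) ^ (1 / (k : ℝ))⌋₊ = Y) :
    ‖mainPart α lam ψ χ k M L D m₀‖ ≤ 8 * G * M / q *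
      (∑ d ∈ coprimeRange q D, ‖α d‖ * (rootSet q d).card / d) *
        ((1 + Real.log Y) * (Y * q.divisors.card)) := by
  have : NeZero q := ⟨hq.ne'⟩
  have hqr : (0 : ℝ) < q := by exact_mod_cast hq
  have hG0 : 0 ≤ G := (norm_nonneg _).trans hG
  have hlog := one_le_one_add_log Y
  have hterm : ∀ d ∈ coprimeRange q D, ∀ n ∈ powerRange k L, ∀ b ∈ n.divisors, ∀ ω ∈ rootSet q d,
      ‖∑ z ∈ Finset.range q, (μ b : ℂ) * (α d * (lam (n ^ k) * progChar χ k n b (d * z) *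
        poissonTerm ψ M m₀ q d b (n ^ k / b) ω z 0))‖ ≤
      8 * G * M / q * (‖α d‖ / d) * (Nat.gcd n q * (b : ℝ)⁻¹) := by
    intro d hd n hn b hb ω _
    rw [coprimeRange, Finset.mem_filter, mem_dyadic hD.le] at hd
    have hd0 : (0 : ℝ) < d := hD.trans hd.1.1
    have hb0 : 0 < b := Nat.pos_of_mem_divisors hb
    have hbr : (0 : ℝ) < b := by exact_mod_cast hb0
    have h1 : ∀ z ∈ Finset.range q, (μ b : ℂ) * (α d * (lam (n ^ k) * progChar χ k n b (d * z) *
        poissonTerm ψ M m₀ q d b (n ^ k / b) ω z 0)) =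
        ((μ b : ℂ) * (α d * (lam (n ^ k) * (((M / (b * d * q) : ℝ) : ℂ) * ∫ u, ψ u)))) *
          progChar χ k n b (d * z) := by
      intro z _
      rw [poissonTerm, fcoeff_dilate_zero ψ (by positivity) hM]
      simp only [Int.cast_zero, zero_mul, ex_zero, mul_one]
      ring
    rw [Finset.sum_congr rfl h1, ← Finset.mul_sum, norm_mul, norm_mul, norm_mul, norm_mul, norm_mul,
      Complex.norm_real, Real.norm_of_nonneg (by positivity)]
    have h2 := norm_sum_progChar_le hχp hχ hk (Nat.dvd_of_mem_divisors hb) hd.2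
    have h3 := norm_moebius_le_one b
    have h4 := norm_powerCoefficient_le_one hlam (n ^ k)
    calc _ ≤ (1 * (‖α d‖ * (1 * (M / (b * d * q) * G)))) * (8 * (Nat.gcd n q : ℝ)) := by gcongr
      _ = _ := by
        field_simp
  rw [mainPart]
  calc _ ≤ ∑ d ∈ coprimeRange q D, ∑ n ∈ (powerRange k L).filter fun n => n.Coprime d,
        ∑ b ∈ n.divisors, ∑ ω ∈ rootSet q d,
          8 * G * M / q * (‖α d‖ / d) * (Nat.gcd n q * (b : ℝ)⁻¹) := by
        refine (norm_sum_le _ _).trans (Finset.sum_le_sum fun d hd => ?_)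
        refine (norm_sum_le _ _).trans (Finset.sum_le_sum fun n hn => ?_)
        refine (norm_sum_le _ _).trans (Finset.sum_le_sum fun b hb => ?_)
        refine (norm_sum_le _ _).trans (Finset.sum_le_sum fun ω hω => ?_)
        exact hterm d hd n (Finset.mem_filter.1 hn).1 b hb ω hω
    _ ≤ ∑ d ∈ coprimeRange q D, ∑ n ∈ Finset.Icc 1 Y,
          8 * G * M / q * (‖α d‖ * (rootSet q d).card / d) *
            (Nat.gcd n q * (1 + Real.log Y)) := by
        refine Finset.sum_le_sum fun d _ => ?_
        refine (Finset.sum_le_sum (g := fun n : ℕ => 8 * G * M / q *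
          (‖α d‖ * (rootSet q d).card / d) * (Nat.gcd n q * (1 + Real.log Y))) fun n hn => ?_).trans
          (Finset.sum_le_sum_of_subset_of_nonneg ?_ fun _ _ _ => by positivity)
        · have hnY : n ≤ Y := by
            rw [← hY]
            exact (Finset.mem_Icc.1 (Finset.mem_filter.1 (Finset.mem_filter.1 hn).1).1).2
          simp_rw [Finset.sum_const, nsmul_eq_mul]
          calc _ = 8 * G * M / q * (‖α d‖ * (rootSet q d).card / d) *
                (Nat.gcd n q * ∑ b ∈ n.divisors, (b : ℝ)⁻¹) := by
                rw [Finset.mul_sum, Finset.mul_sum]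
                exact Finset.sum_congr rfl fun b _ => by ring
            _ ≤ _ := by
                gcongr
                exact sum_divisors_inv_le hnY
        · intro n hn
          rw [← hY]
          exact (Finset.mem_filter.1 (Finset.mem_filter.1 hn).1).1
    _ = 8 * G * M / q * (∑ d ∈ coprimeRange q D, ‖α d‖ * (rootSet q d).card / d) *
          ((1 + Real.log Y) * ((∑ n ∈ Finset.Icc 1 Y, Nat.gcd n q : ℕ) : ℝ)) := by
        push_cast
        rw [← Finset.sum_mul_sum, ← Finset.mul_sum, ← Finset.sum_mul]
        ring
    _ ≤ _ := by
        have h5 := sum_gcd_le q Y hq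
        have h6 : ((∑ n ∈ Finset.Icc 1 Y, Nat.gcd n q : ℕ) : ℝ) ≤ Y * q.divisors.card := by
          exact_mod_cast h5
        gcongr

/-- The pairs `(d, ω)` with `d` in a residue class modulo `q`, divisible by `e`, coprime to `b`,
and `ω` a root modulo `d`. -/
def pairSet (q : ℕ) (D : ℝ) (δ b e : ℕ) : Finset (Σ _ : ℕ, ℕ) :=
  ((coprimeRange q D).filter fun d => d % q = δ ∧ e ∣ d ∧ b.Coprime d).sigma fun d => rootSet q d

theorem sum_divisors_eq_sum_Icc {n d Y : ℕ} (hn : 0 < n) (hnY : n ≤ Y) (f : ℕ → ℂ) :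
    (if n.Coprime d then ∑ b ∈ n.divisors, f b else 0) =
      ∑ b ∈ Finset.Icc 1 Y, ∑ e ∈ Finset.Icc 1 Y,
        (if (e ∣ d ∧ b.Coprime d) ∧ b ∣ n ∧ e ∣ n then (μ e : ℂ) * f b else 0) := by
  have hdiv : n.divisors = (Finset.Icc 1 Y).filter (fun b => b ∣ n) := by
    ext b
    rw [Nat.mem_divisors, Finset.mem_filter, Finset.mem_Icc]
    exact ⟨fun h => ⟨⟨Nat.pos_of_dvd_of_pos h.1 hn, (Nat.le_of_dvd hn h.1).trans hnY⟩, h.1⟩,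
      fun h => ⟨h.2, hn.ne'⟩⟩
  have h1 : ∀ b ∈ Finset.Icc 1 Y, ∑ e ∈ Finset.Icc 1 Y,
      (if (e ∣ d ∧ b.Coprime d) ∧ b ∣ n ∧ e ∣ n then (μ e : ℂ) * f b else 0) =
      if n.Coprime d then (if b ∣ n then f b else 0) else 0 := by
    intro b _
    by_cases hb : b.Coprime d ∧ b ∣ n
    · have h2 : ∑ e ∈ Finset.Icc 1 Y,
          (if (e ∣ d ∧ b.Coprime d) ∧ b ∣ n ∧ e ∣ n then (μ e : ℂ) * f b else 0) =
          (∑ e ∈ n.divisors, (if e ∣ d then (μ e : ℂ) else 0)) * f b := by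
        rw [hdiv, Finset.sum_filter, Finset.sum_mul]
        refine Finset.sum_congr rfl fun e _ => ?_
        by_cases he : e ∣ n <;> by_cases he' : e ∣ d <;> simp [he, he', hb.1, hb.2]
      rw [h2, sum_moebius_divisors_filter hn, if_pos hb.2]
      split_ifs <;> simp
    · rw [Finset.sum_eq_zero]
      · by_cases hnd : n.Coprime d
        · rw [if_pos hnd, if_neg]
          exact fun h => hb ⟨Nat.Coprime.coprime_dvd_left h hnd, h⟩
        · rw [if_neg hnd]
      · intro e _
        rw [if_neg]
        exact fun h => hb ⟨h.1.2, h.2.1⟩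
  rw [Finset.sum_congr rfl h1, hdiv, Finset.sum_filter]
  split_ifs <;> simp

theorem sum_coprime_divisors_eq {q : ℕ} (hq : 0 < q) (D : ℝ) {N : Finset ℕ} {Y : ℕ}
    (hN : N ⊆ Finset.Icc 1 Y) (X : ℕ → ℕ → ℕ → ℕ → ℕ → ℂ) :
    ∑ d ∈ coprimeRange q D, ∑ n ∈ N.filter fun n => n.Coprime d,
      ∑ b ∈ n.divisors, ∑ ω ∈ rootSet q d, ∑ z ∈ Finset.range q, (μ b : ℂ) * X d n b ω z =
    ∑ r ∈ Finset.range q ×ˢ Finset.range q, ∑ p ∈ Finset.Icc 1 Y ×ˢ Finset.Icc 1 Y,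
      (μ p.1 : ℂ) * (μ p.2 : ℂ) * ∑ i ∈ pairSet q D r.2 p.1 p.2,
        ∑ n ∈ N.filter fun n => p.1 ∣ n ∧ p.2 ∣ n, X i.1 n p.1 i.2 r.1 := by
  set Φ : (ℕ × ℕ) × (ℕ × ℕ) → ℕ × ℕ → ℂ := fun s t =>
    if (t.1 % q = s.1.2 ∧ s.2.2 ∣ t.1 ∧ s.2.1.Coprime t.1) ∧ s.2.1 ∣ t.2 ∧ s.2.2 ∣ t.2 then
      (μ s.2.1 : ℂ) * (μ s.2.2 : ℂ) * ∑ ω ∈ rootSet q t.1, X t.1 t.2 s.2.1 ω s.1.1 else 0 with hΦ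
  have hR : ∑ r ∈ Finset.range q ×ˢ Finset.range q, ∑ p ∈ Finset.Icc 1 Y ×ˢ Finset.Icc 1 Y,
      (μ p.1 : ℂ) * (μ p.2 : ℂ) * ∑ i ∈ pairSet q D r.2 p.1 p.2,
        ∑ n ∈ N.filter fun n => p.1 ∣ n ∧ p.2 ∣ n, X i.1 n p.1 i.2 r.1 =
      ∑ s ∈ (Finset.range q ×ˢ Finset.range q) ×ˢ (Finset.Icc 1 Y ×ˢ Finset.Icc 1 Y),
        ∑ t ∈ coprimeRange q D ×ˢ N, Φ s t := by
    rw [Finset.sum_product (s := Finset.range q ×ˢ Finset.range q)]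
    refine Finset.sum_congr rfl fun r _ => Finset.sum_congr rfl fun p _ => ?_
    rw [Finset.sum_product, pairSet, Finset.sum_sigma, Finset.sum_filter, Finset.mul_sum]
    refine Finset.sum_congr rfl fun d _ => ?_
    by_cases hd : d % q = r.2 ∧ p.2 ∣ d ∧ p.1.Coprime d
    · rw [if_pos hd, Finset.sum_comm, Finset.sum_filter, Finset.mul_sum]
      refine Finset.sum_congr rfl fun n _ => ?_
      simp only [hΦ]
      by_cases hn : p.1 ∣ n ∧ p.2 ∣ n
      · rw [if_pos hn, if_pos ⟨hd, hn⟩]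
      · rw [if_neg hn, if_neg fun h => hn h.2, mul_zero]
    · rw [if_neg hd, mul_zero, Finset.sum_eq_zero]
      intro n _
      simp only [hΦ]
      rw [if_neg fun h => hd h.1]
  rw [hR, Finset.sum_comm, Finset.sum_product]
  refine Finset.sum_congr rfl fun d _ => ?_
  rw [Finset.sum_filter]
  refine Finset.sum_congr rfl fun n hn => ?_
  have hnY := Finset.mem_Icc.1 (hN hn)
  rw [sum_divisors_eq_sum_Icc hnY.1 hnY.2, ← Finset.sum_product',
    Finset.sum_product_right (s := Finset.range q ×ˢ Finset.range q)]
  refine Finset.sum_congr rfl fun p _ => ?_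
  have hdq : d % q ∈ Finset.range q := Finset.mem_range.2 (Nat.mod_lt _ hq)
  rw [Finset.sum_product]
  by_cases hc : (p.2 ∣ d ∧ p.1.Coprime d) ∧ p.1 ∣ n ∧ p.2 ∣ n
  · rw [if_pos hc, Finset.sum_comm, Finset.mul_sum]
    refine Finset.sum_congr rfl fun z _ => ?_
    have h1 : ∀ δ ∈ Finset.range q, Φ ((z, δ), p) (d, n) = if d % q = δ then
        (μ p.1 : ℂ) * (μ p.2 : ℂ) * ∑ ω ∈ rootSet q d, X d n p.1 ω z else 0 := by
      intro δ _
      simp only [hΦ]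
      refine if_congr ⟨fun h => h.1.1, fun h => ⟨⟨h, hc.1⟩, hc.2⟩⟩ rfl rfl
    rw [Finset.sum_congr rfl h1, Finset.sum_ite_eq, if_pos hdq, ← Finset.mul_sum]
    ring
  · rw [if_neg hc]
    refine (Finset.sum_eq_zero fun z _ => Finset.sum_eq_zero fun δ _ => ?_).symm
    simp only [hΦ]
    rw [if_neg fun h => hc ⟨h.1.2, h.2⟩]

/-- The part of `errorPart` with fixed divisors `b`, `e` and fixed residue classes. -/
def errorBlock (α lam : ℕ → ℂ) (ψ : ℝ → ℂ) {q : ℕ} (χ : DirichletCharacter ℂ q) (k : ℕ)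
    (M L D m₀ : ℝ) (z δ b e : ℕ) : ℂ :=
  ∑ i ∈ pairSet q D δ b e, ∑ n ∈ (powerRange k L).filter fun n => b ∣ n ∧ e ∣ n,
    α i.1 * (lam (n ^ k) * progChar χ k n b (δ * z) *
      ∑' h : ℤ, if h = 0 then 0 else poissonTerm ψ M m₀ q i.1 b (n ^ k / b) i.2 z h)

theorem progChar_mod {q : ℕ} (χ : MulChar (ZMod q) ℂ) (k n b d z : ℕ) :
    progChar χ k n b (d % q * z) = progChar χ k n b (d * z) := by
  rw [progChar, progChar]
  push_cast
  rw [ZMod.natCast_mod]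

theorem errorPart_eq (α lam : ℕ → ℂ) (ψ : ℝ → ℂ) {q : ℕ} (hq : 0 < q) (χ : DirichletCharacter ℂ q)
    (k : ℕ) (M L D m₀ : ℝ) {Y : ℕ} (hY : ⌊(2 * L) ^ (1 / (k : ℝ))⌋₊ = Y) :
    errorPart α lam ψ χ k M L D m₀ =
      ∑ r ∈ Finset.range q ×ˢ Finset.range q, ∑ p ∈ Finset.Icc 1 Y ×ˢ Finset.Icc 1 Y,
        (μ p.1 : ℂ) * (μ p.2 : ℂ) * errorBlock α lam ψ χ k M L D m₀ r.1 r.2 p.1 p.2 := by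
  rw [errorPart, sum_coprime_divisors_eq hq D (N := powerRange k L) (Y := Y)
    (by rw [← hY]; exact Finset.filter_subset _ _) (fun d n b ω z =>
      α d * (lam (n ^ k) * progChar χ k n b (d * z) *
        ∑' h : ℤ, if h = 0 then 0 else poissonTerm ψ M m₀ q d b (n ^ k / b) ω z h))]
  refine Finset.sum_congr rfl fun r _ => Finset.sum_congr rfl fun p _ => ?_
  rw [errorBlock]
  congr 1
  refine Finset.sum_congr rfl fun i hi => Finset.sum_congr rfl fun n _ => ?_
  rw [pairSet, Finset.mem_sigma, Finset.mem_filter] at hi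
  rw [← hi.1.2.1, progChar_mod]

theorem isSpacedMod_pairSet {q : ℕ} (hq : 0 < q) {D : ℝ} (hD : 0 < D) (δ b e : ℕ) :
    IsSpacedMod (pairSet q D δ b e) (fun i => (i.2 : ℝ) / i.1) (1 / (3 * D * q)) := by
  rintro ⟨d, ω⟩ hi ⟨d', ω'⟩ hj hij r
  rw [pairSet, Finset.mem_sigma, Finset.mem_filter, coprimeRange, Finset.mem_filter,
    mem_dyadic hD.le] at hi hj
  refine le_abs_sub_of_mem_rootSet hD hq hi.1.1.1.1 hi.1.1.1.2 hj.1.1.1.1 hj.1.1.1.2 hi.2 hj.2 ?_ r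
  rintro ⟨rfl, rfl⟩
  exact hij rfl

theorem norm_progChar_le_one {q : ℕ} {χ : MulChar (ZMod q) ℂ} (hχ : χ.IsQuadratic) (k n b y : ℕ) :
    ‖progChar χ k n b y‖ ≤ 1 := norm_mulChar_le_one hχ _

theorem errorBlock_eq_tsum (α lam : ℕ → ℂ) {ψ : ℝ → ℂ}
    (hψ : ContDiff ℝ ((⊤ : ℕ∞) : WithTop ℕ∞) ψ) {R : ℝ} (hR : ∀ u, R < |u| → ψ u = 0) {q : ℕ}
    (hq : 0 < q) (χ : DirichletCharacter ℂ q) (k : ℕ) {M L D : ℝ} (hM : 0 < M) (hD : 0 < D) (m₀ : ℝ)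
    (z δ e : ℕ) {b : ℕ} (hb : 0 < b) :
    errorBlock α lam ψ χ k M L D m₀ z δ b e =
      ∑' h : ℤ, if h = 0 then 0 else ∑ i ∈ pairSet q D δ b e, α i.1 *
        ∑ n ∈ (powerRange k L).filter fun n => b ∣ n ∧ e ∣ n,
          (lam (n ^ k) * progChar χ k n b (δ * z) * ex (h * (z / q))) *
            ex (h * (n ^ k / b : ℕ) * ((i.2 : ℝ) / i.1)) *
              fcoeff (dilate ψ (b * i.1 * q) M m₀) h := by
  set f : (Σ _ : ℕ, ℕ) → ℕ → ℤ → ℂ := fun i n h => α i.1 *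
    (lam (n ^ k) * progChar χ k n b (δ * z) *
      if h = 0 then 0 else poissonTerm ψ M m₀ q i.1 b (n ^ k / b) i.2 z h) with hf
  have hsum : ∀ i ∈ pairSet q D δ b e, ∀ n, Summable (f i n) := by
    intro i hi n
    rw [pairSet, Finset.mem_sigma, Finset.mem_filter, coprimeRange, Finset.mem_filter,
      mem_dyadic hD.le] at hi
    have hd0 : 0 < i.1 := by exact_mod_cast hD.trans hi.1.1.1.1
    refine Summable.mul_left _ (Summable.mul_left _ ?_)
    refine Summable.of_norm_bounded (summable_poissonTerm hψ hR hM m₀ hb hd0 hq (n ^ k / b) i.2 z).norm ?_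
    intro h
    split_ifs
    · simp
    · exact le_rfl
  have h1 : errorBlock α lam ψ χ k M L D m₀ z δ b e = ∑' h : ℤ, ∑ i ∈ pairSet q D δ b e,
      ∑ n ∈ (powerRange k L).filter fun n => b ∣ n ∧ e ∣ n, f i n h := by
    rw [errorBlock, Summable.tsum_finsetSum fun i hi => summable_sum fun n _ => hsum i hi n]
    refine Finset.sum_congr rfl fun i hi => ?_
    rw [Summable.tsum_finsetSum fun n _ => hsum i hi n]
    refine Finset.sum_congr rfl fun n _ => ?_
    rw [tsum_mul_left, tsum_mul_left]
  rw [h1]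
  refine tsum_congr fun h => ?_
  by_cases h0 : h = 0
  · simp [hf, h0]
  · rw [if_neg h0]
    refine Finset.sum_congr rfl fun i _ => ?_
    rw [Finset.mul_sum]
    refine Finset.sum_congr rfl fun n _ => ?_
    simp only [hf]
    rw [if_neg h0, poissonTerm]
    ring

theorem sum_pairSet_le (α : ℕ → ℂ) (q : ℕ) (D : ℝ) (δ b e : ℕ) :
    ∑ i ∈ pairSet q D δ b e, ‖α i.1‖ ^ 2 ≤
      ∑ d ∈ coprimeRange q D, if e ∣ d then ‖α d‖ ^ 2 * (rootSet q d).card else 0 := by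
  rw [pairSet, Finset.sum_sigma, ← Finset.sum_filter]
  refine (Finset.sum_le_sum_of_subset_of_nonneg (t := (coprimeRange q D).filter fun d => e ∣ d)
    ?_ fun _ _ _ => by positivity).trans (Finset.sum_le_sum fun d _ => ?_)
  · intro d hd
    rw [Finset.mem_filter] at hd ⊢
    exact ⟨hd.1, hd.2.2.1⟩
  · simp only
    rw [Finset.sum_const, nsmul_eq_mul, mul_comm]

theorem norm_errorBlock_le {α lam : ℕ → ℂ} {ψ : ℝ → ℂ}
    (hψ : ContDiff ℝ ((⊤ : ℕ∞) : WithTop ℕ∞) ψ) {R G : ℝ} (hR0 : 0 ≤ R) (hG0 : 0 ≤ G)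
    (hR : ∀ u, R < |u| → ψ u = 0) (hR3 : ∀ u, R < |u| → iteratedDeriv 3 ψ u = 0)
    (hG : ∀ u, ‖ψ u‖ ≤ G) (hG3 : ∀ u, ‖iteratedDeriv 3 ψ u‖ ≤ G)
    {q : ℕ} (hq : 1 < q) {χ : DirichletCharacter ℂ q} (hχ : χ.IsQuadratic)
    {k : ℕ} (hk : 1 ≤ k) (hlam : IsPowerCoefficient k lam) {M L D : ℝ} (hM : 0 < M) (hL : 0 < L)
    (hD : 1 / 2 ≤ D) {m₀ V Λ : ℝ} (hV : |m₀| + R * M ≤ V * M) (hΛ : 1 ≤ Λ)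
    (hΛD : 1 + Real.log (3 * D * q) ≤ Λ) (z δ e : ℕ) {b : ℕ} (hb : 0 < b)
    (hΛM : 1 + Real.log (b * D * q / M) ≤ Λ) :
    ‖errorBlock α lam ψ χ k M L D m₀ z δ b e‖ ≤ 20 * V * G * Λ ^ 2 * (Real.sqrt (L + M) *
      (Real.sqrt ((b : ℝ)⁻¹ * ∑ d ∈ coprimeRange q D,
          if e ∣ d then ‖α d‖ ^ 2 * (rootSet q d).card else 0) *
        Real.sqrt (∑ n ∈ (powerRange k L).filter fun n => b ∣ n ∧ e ∣ n,
          (n.divisors.card : ℝ) ^ k))) := by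
  have hq0 : 0 < q := by omega
  have hqr : (2 : ℝ) ≤ q := by exact_mod_cast hq
  have hbr : (0 : ℝ) < b := by exact_mod_cast hb
  have hD0 : 0 < D := by linarith
  have hT : 0 < b * D * q := by positivity
  have hV0 : 0 ≤ V := by
    have : 0 ≤ V * M := le_trans (by positivity) hV
    exact nonneg_of_mul_nonneg_left this hM
  set P := (powerRange k L).filter fun n => b ∣ n ∧ e ∣ n with hP
  set W := ⌊2 * L / b⌋₊ with hW
  have hPmem : ∀ n ∈ P, 0 < n ∧ (b : ℝ) * (n ^ k / b : ℕ) = (n : ℝ) ^ k ∧ (n : ℝ) ^ k ≤ 2 * L ∧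
      b ∣ n ^ k := by
    intro n hn
    rw [hP, powerRange, Finset.mem_filter, Finset.mem_filter, Finset.mem_Icc, mem_dyadic hL.le] at hn
    have hbn : b ∣ n ^ k := hn.2.1.trans (dvd_pow_self n (by omega))
    refine ⟨hn.1.1.1, ?_, by exact_mod_cast hn.1.2.2, hbn⟩
    exact_mod_cast Nat.mul_div_cancel' hbn
  have hw0 : ∀ n ∈ P, 0 < n ^ k / b := fun n hn =>
    Nat.div_pos (Nat.le_of_dvd (pow_pos (hPmem n hn).1 k) (hPmem n hn).2.2.2) hb
  have hinj : Set.InjOn (fun n => n ^ k / b) (P : Set ℕ) := by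
    intro n hn n' hn' h
    have h1 : n ^ k = n' ^ k := by
      rw [← Nat.mul_div_cancel' (hPmem n hn).2.2.2, ← Nat.mul_div_cancel' (hPmem n' hn').2.2.2]
      exact congrArg _ h
    exact Nat.pow_left_injective (by omega) h1
  have hwW : ∀ n ∈ P, n ^ k / b ≤ W := by
    intro n hn
    obtain ⟨_, h1, h2, _⟩ := hPmem n hn
    refine Nat.le_floor ?_
    rw [le_div_iff₀ hbr, mul_comm, h1]
    exact h2
  have hΔ2 : 1 / (3 * D * q) ≤ 1 / 2 := by
    rw [div_le_div_iff₀ (by positivity) (by norm_num)]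
    nlinarith
  have hΔlog : 1 + Real.log (1 / (1 / (3 * D * q))) ≤ Λ := by rwa [one_div_one_div]
  have ht : ∀ i ∈ pairSet q D δ b e, b * D * q ≤ (b : ℝ) * i.1 * q ∧
      (b : ℝ) * i.1 * q ≤ 2 * (b * D * q) := by
    intro i hi
    rw [pairSet, Finset.mem_sigma, Finset.mem_filter, coprimeRange, Finset.mem_filter,
      mem_dyadic hD0.le] at hi
    obtain ⟨h1, h2⟩ := hi.1.1.1
    constructor
    · gcongr
    · have : (b : ℝ) * i.1 * q ≤ b * (2 * D) * q := by gcongr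
      linarith
  have hmain := norm_tsum_nonzero_frequencies_le (Δ := 1 / (3 * D * q)) (by positivity) hΔ2
    (isSpacedMod_pairSet hq0 hD0 δ b e) (fun i => α i.1) P (fun n => n ^ k / b) hw0 hinj W hwW
    (fun h n => lam (n ^ k) * progChar χ k n b (δ * z) * ex (h * (z / q)))
    (fun h n => by
      rw [norm_mul, norm_mul, norm_ex, mul_one]
      exact mul_le_one₀ (norm_powerCoefficient_le_one hlam _) (norm_nonneg _)
        (norm_progChar_le_one hχ _ _ _ _))
    hψ hR0 hG0 hR hR3 hG hG3 hT hM (fun i => (b : ℝ) * i.1 * q) ht hV hΛ hΔlog hΛM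
  rw [← errorBlock_eq_tsum α lam hψ hR hq0 χ k hM hD0 m₀ z δ e hb] at hmain
  set C := ∑ i ∈ pairSet q D δ b e, ‖α i.1‖ ^ 2 with hC
  set C' := ∑ d ∈ coprimeRange q D, if e ∣ d then ‖α d‖ ^ 2 * ((rootSet q d).card : ℝ) else 0
  set S := ∑ n ∈ P, ((n ^ k / b).divisors.card : ℝ) with hS
  set S' := ∑ n ∈ P, (n.divisors.card : ℝ) ^ k with hS'
  have hCC : C ≤ C' := sum_pairSet_le α q D δ b e
  have hC0 : 0 ≤ C := Finset.sum_nonneg fun _ _ => sq_nonneg _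
  have hS0 : 0 ≤ S := Finset.sum_nonneg fun _ _ => Nat.cast_nonneg _
  have hSS : S ≤ S' := by
    refine Finset.sum_le_sum fun n hn => ?_
    have h1 : (n ^ k / b).divisors.card ≤ n.divisors.card ^ k :=
      (Finset.card_le_card (Nat.divisors_subset_of_dvd (pow_pos (hPmem n hn).1 k).ne'
        (Nat.div_dvd_of_dvd (hPmem n hn).2.2.2))).trans (card_divisors_pow_le n k)
    exact_mod_cast h1
  clear_value C C' S S'
  refine hmain.trans ?_
  set T := b * D * q with hTdef
  have h2 : M / T * Real.sqrt (2 * (T / M) * (2 * (T / M) * W + 3 * Λ / (1 / (3 * D * q))) *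
      (C * S)) ≤ 5 * Λ * (Real.sqrt (L + M) * (Real.sqrt ((b : ℝ)⁻¹ * C') * Real.sqrt S')) := by
    have e1 : M / T = Real.sqrt ((M / T) ^ 2) := (Real.sqrt_sq (by positivity)).symm
    have e2 : 5 * Λ = Real.sqrt ((5 * Λ) ^ 2) := (Real.sqrt_sq (by positivity)).symm
    rw [e1, e2, ← Real.sqrt_mul (by positivity), ← Real.sqrt_mul (mul_nonneg (by positivity)
      (hC0.trans hCC)), ← Real.sqrt_mul (by positivity), ← Real.sqrt_mul (by positivity)]
    refine Real.sqrt_le_sqrt ?_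
    have h3 : (M / T) ^ 2 * (2 * (T / M) * (2 * (T / M) * W + 3 * Λ / (1 / (3 * D * q)))) =
        4 * W + 18 * Λ * M / b := by
      rw [hTdef]
      field_simp
      ring
    have h4 : (W : ℝ) ≤ 2 * L / b := Nat.floor_le (by positivity)
    have h5 : 4 * (W : ℝ) + 18 * Λ * M / b ≤ (5 * Λ) ^ 2 * (L + M) * (b : ℝ)⁻¹ := by
      have h6 : 4 * (W : ℝ) + 18 * Λ * M / b ≤ (8 * L + 18 * Λ * M) * (b : ℝ)⁻¹ := by
        calc 4 * (W : ℝ) + 18 * Λ * M / b ≤ 4 * (2 * L / b) + 18 * Λ * M / b := by linarith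
          _ = _ := by ring
      refine h6.trans (mul_le_mul_of_nonneg_right ?_ (by positivity))
      have h7 : 18 * Λ * M ≤ (5 * Λ) ^ 2 * M := by
        refine mul_le_mul_of_nonneg_right ?_ hM.le
        nlinarith
      have h8 : 8 * L ≤ (5 * Λ) ^ 2 * L := by
        refine mul_le_mul_of_nonneg_right ?_ hL.le
        nlinarith
      linarith
    calc (M / T) ^ 2 * (2 * (T / M) * (2 * (T / M) * W + 3 * Λ / (1 / (3 * D * q))) * (C * S))
        = (4 * W + 18 * Λ * M / b) * (C * S) := by rw [← h3]; ring
      _ ≤ ((5 * Λ) ^ 2 * (L + M) * (b : ℝ)⁻¹) * (C' * S') :=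
          mul_le_mul h5 (mul_le_mul hCC hSS hS0 (hC0.trans hCC)) (mul_nonneg hC0 hS0)
            (by positivity)
      _ = _ := by ring
  calc 4 * (V * M / T) * G * (Λ * Real.sqrt (2 * (T / M) * (2 * (T / M) * W +
        3 * Λ / (1 / (3 * D * q))) * (C * S)))
      = 4 * V * G * Λ * (M / T * Real.sqrt (2 * (T / M) * (2 * (T / M) * W +
        3 * Λ / (1 / (3 * D * q))) * (C * S))) := by ring
    _ ≤ 4 * V * G * Λ * (5 * Λ * (Real.sqrt (L + M) * (Real.sqrt ((b : ℝ)⁻¹ * C') *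
          Real.sqrt S'))) := mul_le_mul_of_nonneg_left h2 (by positivity)
    _ = _ := by ring

theorem sum_Icc_ite_dvd_le {n : ℕ} (hn : 0 < n) (Y : ℕ) {v : ℝ} (hv : 0 ≤ v) :
    ∑ e ∈ Finset.Icc 1 Y, (if e ∣ n then v else 0) ≤ v * n.divisors.card := by
  rw [← Finset.sum_filter, Finset.sum_const, nsmul_eq_mul, mul_comm]
  refine mul_le_mul_of_nonneg_left ?_ hv
  refine Nat.cast_le.2 (Finset.card_le_card fun e he => ?_)
  exact Nat.mem_divisors.2 ⟨(Finset.mem_filter.1 he).2, hn.ne'⟩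

theorem norm_errorPart_le {α lam : ℕ → ℂ} {ψ : ℝ → ℂ}
    (hψ : ContDiff ℝ ((⊤ : ℕ∞) : WithTop ℕ∞) ψ) {R G : ℝ} (hR0 : 0 ≤ R) (hG0 : 0 ≤ G)
    (hR : ∀ u, R < |u| → ψ u = 0) (hR3 : ∀ u, R < |u| → iteratedDeriv 3 ψ u = 0)
    (hG : ∀ u, ‖ψ u‖ ≤ G) (hG3 : ∀ u, ‖iteratedDeriv 3 ψ u‖ ≤ G)
    {q : ℕ} (hq : 1 < q) {χ : DirichletCharacter ℂ q} (hχ : χ.IsQuadratic)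
    {k : ℕ} (hk : 1 ≤ k) (hlam : IsPowerCoefficient k lam) {M L D : ℝ} (hM : 0 < M) (hL : 0 < L)
    (hD : 1 / 2 ≤ D) {m₀ V Λ : ℝ} (hV : |m₀| + R * M ≤ V * M) (hΛ : 1 ≤ Λ)
    (hΛD : 1 + Real.log (3 * D * q) ≤ Λ) {Y : ℕ} (hY : ⌊(2 * L) ^ (1 / (k : ℝ))⌋₊ = Y)
    (hΛY : 1 + Real.log Y ≤ Λ) (hΛM : 1 + Real.log (Y * D * q / M) ≤ Λ) :
    ‖errorPart α lam ψ χ k M L D m₀‖ ≤ (q : ℝ) ^ 2 * (20 * V * G * Λ ^ 2 * (Real.sqrt (L + M) *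
      (Real.sqrt (Λ * ∑ d ∈ coprimeRange q D, ‖α d‖ ^ 2 * (rootSet q d).card * d.divisors.card) *
        Real.sqrt (∑ n ∈ Finset.Icc 1 Y, (n.divisors.card : ℝ) ^ (k + 2))))) := by
  have hq0 : 0 < q := by omega
  have hqr : (0 : ℝ) < q := by exact_mod_cast hq0
  have hD0 : 0 < D := by linarith
  have hV0 : 0 ≤ V := by
    have : 0 ≤ V * M := le_trans (by positivity) hV
    exact nonneg_of_mul_nonneg_left this hM
  set c : ℕ → ℝ := fun d => ‖α d‖ ^ 2 * ((rootSet q d).card : ℝ) with hc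
  have hc0 : ∀ d, 0 ≤ c d := fun d => by positivity
  set CE : ℕ → ℝ := fun e => ∑ d ∈ coprimeRange q D, if e ∣ d then c d else 0 with hCE
  set SE : ℕ × ℕ → ℝ := fun p => ∑ n ∈ (powerRange k L).filter fun n => p.1 ∣ n ∧ p.2 ∣ n,
    (n.divisors.card : ℝ) ^ k with hSE
  have hCE0 : ∀ e, 0 ≤ CE e := fun e =>
    Finset.sum_nonneg fun d _ => by
      split_ifs
      · exact hc0 d
      · exact le_rfl
  have hSE0 : ∀ p, 0 ≤ SE p := fun p => Finset.sum_nonneg fun n _ => by positivity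
  have hblock : ∀ r : ℕ × ℕ, ∀ p ∈ Finset.Icc 1 Y ×ˢ Finset.Icc 1 Y,
      ‖(μ p.1 : ℂ) * (μ p.2 : ℂ) * errorBlock α lam ψ χ k M L D m₀ r.1 r.2 p.1 p.2‖ ≤
      20 * V * G * Λ ^ 2 * (Real.sqrt (L + M) *
        (Real.sqrt ((p.1 : ℝ)⁻¹ * CE p.2) * Real.sqrt (SE p))) := by
    intro r p hp
    rw [Finset.mem_product, Finset.mem_Icc, Finset.mem_Icc] at hp
    have hb0 : (0 : ℝ) < p.1 := by exact_mod_cast hp.1.1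
    have hbY : (p.1 : ℝ) ≤ Y := by exact_mod_cast hp.1.2
    have h1 := norm_errorBlock_le (α := α) hψ hR0 hG0 hR hR3 hG hG3 hq hχ hk hlam hM hL hD hV hΛ hΛD
      r.1 r.2 p.2 hp.1.1 (le_trans (by gcongr) hΛM)
    rw [norm_mul, norm_mul]
    calc _ ≤ 1 * 1 * (20 * V * G * Λ ^ 2 * (Real.sqrt (L + M) *
        (Real.sqrt ((p.1 : ℝ)⁻¹ * CE p.2) * Real.sqrt (SE p)))) := by
          refine mul_le_mul ?_ h1 (norm_nonneg _) (by norm_num)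
          exact mul_le_mul (norm_moebius_le_one _) (norm_moebius_le_one _) (norm_nonneg _)
            zero_le_one
      _ = _ := by ring
  have hsumC : ∑ p ∈ Finset.Icc 1 Y ×ˢ Finset.Icc 1 Y, (p.1 : ℝ)⁻¹ * CE p.2 ≤
      Λ * ∑ d ∈ coprimeRange q D, c d * d.divisors.card := by
    rw [Finset.sum_product]
    simp only
    rw [← Finset.sum_mul_sum]
    refine mul_le_mul ((sum_Icc_inv_le Y).trans hΛY) ?_ (Finset.sum_nonneg fun e _ => hCE0 e)
      (by linarith)
    rw [hCE, Finset.sum_comm]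
    refine Finset.sum_le_sum fun d hd => sum_Icc_ite_dvd_le ?_ Y (hc0 d)
    rw [coprimeRange, Finset.mem_filter, mem_dyadic hD0.le] at hd
    exact_mod_cast hD0.trans hd.1.1
  have hsumS : ∑ p ∈ Finset.Icc 1 Y ×ˢ Finset.Icc 1 Y, SE p ≤
      ∑ n ∈ Finset.Icc 1 Y, (n.divisors.card : ℝ) ^ (k + 2) := by
    have hsub : powerRange k L ⊆ Finset.Icc 1 Y := by
      rw [← hY]; exact Finset.filter_subset _ _
    simp_rw [hSE, Finset.sum_filter]
    rw [Finset.sum_comm]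
    refine (Finset.sum_le_sum (g := fun n : ℕ => (n.divisors.card : ℝ) ^ (k + 2))
      fun n hn => ?_).trans (Finset.sum_le_sum_of_subset_of_nonneg hsub fun _ _ _ => by positivity)
    have hn0 : 0 < n := (Finset.mem_Icc.1 (hsub hn)).1
    rw [Finset.sum_product]
    simp only [ite_and]
    calc ∑ b ∈ Finset.Icc 1 Y, ∑ e ∈ Finset.Icc 1 Y,
          (if b ∣ n then (if e ∣ n then (n.divisors.card : ℝ) ^ k else 0) else 0)
        ≤ ∑ b ∈ Finset.Icc 1 Y, (if b ∣ n then (n.divisors.card : ℝ) ^ (k + 1) else 0) := by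
          refine Finset.sum_le_sum fun b _ => ?_
          split_ifs
          · rw [pow_succ]
            exact sum_Icc_ite_dvd_le hn0 Y (by positivity)
          · simp
      _ ≤ (n.divisors.card : ℝ) ^ (k + 1) * n.divisors.card :=
          sum_Icc_ite_dvd_le hn0 Y (by positivity)
      _ = _ := by ring
  have hCS : ∑ p ∈ Finset.Icc 1 Y ×ˢ Finset.Icc 1 Y,
      Real.sqrt ((p.1 : ℝ)⁻¹ * CE p.2) * Real.sqrt (SE p) ≤
      Real.sqrt (Λ * ∑ d ∈ coprimeRange q D, c d * d.divisors.card) *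
        Real.sqrt (∑ n ∈ Finset.Icc 1 Y, (n.divisors.card : ℝ) ^ (k + 2)) := by
    refine (Real.sum_sqrt_mul_sqrt_le _ (fun p => mul_nonneg (by positivity) (hCE0 _)) hSE0).trans ?_
    exact mul_le_mul (Real.sqrt_le_sqrt hsumC) (Real.sqrt_le_sqrt hsumS) (Real.sqrt_nonneg _)
      (Real.sqrt_nonneg _)
  rw [errorPart_eq α lam ψ hq0 χ k M L D m₀ hY]
  calc _ ≤ ∑ r ∈ Finset.range q ×ˢ Finset.range q, ∑ p ∈ Finset.Icc 1 Y ×ˢ Finset.Icc 1 Y,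
        20 * V * G * Λ ^ 2 * (Real.sqrt (L + M) *
          (Real.sqrt ((p.1 : ℝ)⁻¹ * CE p.2) * Real.sqrt (SE p))) :=
        (norm_sum_le _ _).trans (Finset.sum_le_sum fun r _ => (norm_sum_le _ _).trans
          (Finset.sum_le_sum fun p hp => hblock r p hp))
    _ = (q : ℝ) ^ 2 * (20 * V * G * Λ ^ 2 * (Real.sqrt (L + M) *
          ∑ p ∈ Finset.Icc 1 Y ×ˢ Finset.Icc 1 Y,
            Real.sqrt ((p.1 : ℝ)⁻¹ * CE p.2) * Real.sqrt (SE p))) := by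
        rw [Finset.sum_const, nsmul_eq_mul, Finset.card_product, Finset.card_range,
          ← Finset.mul_sum, ← Finset.mul_sum]
        push_cast
        ring
    _ ≤ _ := by
        refine mul_le_mul_of_nonneg_left (mul_le_mul_of_nonneg_left
          (mul_le_mul_of_nonneg_left hCS (Real.sqrt_nonneg _)) ?_) (by positivity)
        have : 0 ≤ Λ ^ 2 := sq_nonneg Λ
        positivity

theorem one_add_log_le {κ Ξ x : ℝ} (hκ : 1 ≤ κ) (hΞ0 : 0 < Ξ) (hΞ : 1 ≤ Real.log Ξ) (hx : 0 ≤ x)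
    (h : x ≤ κ * Ξ) : 1 + Real.log x ≤ (2 + Real.log κ) * Real.log Ξ := by
  have hκl := Real.log_nonneg hκ
  rcases hx.eq_or_lt with rfl | hx
  · rw [Real.log_zero]
    nlinarith
  · have h1 : Real.log x ≤ Real.log κ + Real.log Ξ := by
      rw [← Real.log_mul (by linarith) hΞ0.ne']
      exact Real.log_le_log hx h
    nlinarith

theorem one_le_paramLog {M L D : ℝ} {q : ℕ} (h : 0 ≤ M * L * D * q) : 1 ≤ paramLog M L D q := by
  rw [paramLog, Real.le_log_iff_exp_le (by linarith)]
  have := Real.exp_one_lt_d9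
  linarith

theorem exists_log_bound {c : ℝ} (hc : 0 < c) : ∃ C₁ : ℝ, 1 ≤ C₁ ∧ ∀ (M L D : ℝ) (q : ℕ),
    c ≤ M → c ≤ L → c ≤ D → 1 < q → ∀ k : ℕ, 1 ≤ k → ∀ Y : ℕ, ⌊(2 * L) ^ (1 / (k : ℝ))⌋₊ = Y →
      1 + Real.log (3 * D * q) ≤ C₁ * paramLog M L D q ∧
      1 + Real.log Y ≤ C₁ * paramLog M L D q ∧
      1 + Real.log (Y * D * q / M) ≤ C₁ * paramLog M L D q ∧
      1 + Real.log (2 * D + 2) ≤ C₁ * paramLog M L D q ∧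
      1 + Real.log ⌊2 * D⌋₊ ≤ C₁ * paramLog M L D q := by
  set κ : ℝ := 2 + 3 / c ^ 2 + 1 / c ^ 3 with hκ
  have hκ1 : 1 ≤ κ := by
    have : 0 ≤ 3 / c ^ 2 + 1 / c ^ 3 := by positivity
    linarith
  have hκl := Real.log_nonneg hκ1
  refine ⟨2 + Real.log κ, by linarith, fun M L D q hM hL hD hq k hk Y hY => ?_⟩
  have hM0 : 0 < M := by linarith
  have hL0 : 0 < L := by linarith
  have hD0 : 0 < D := by linarith
  have hq1 : (1 : ℝ) ≤ q := by exact_mod_cast hq.le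
  have hq0 : (0 : ℝ) < q := by linarith
  set Ξ := 3 + M * L * D * q with hΞ
  have hP : 0 ≤ M * L * D * q := by positivity
  have hlog : 1 ≤ Real.log Ξ := one_le_paramLog hP
  have hΞ1 : 1 ≤ Ξ := by linarith
  have hDq : D * q ≤ 1 / c ^ 2 * Ξ := by
    rw [one_div, ← div_eq_inv_mul, le_div_iff₀ (by positivity)]
    have : c * c ≤ M * L := by gcongr
    calc D * q * c ^ 2 = c * c * (D * q) := by ring
      _ ≤ M * L * (D * q) := by gcongr
      _ ≤ Ξ := by rw [hΞ]; linarith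
  have hL' : L ≤ 1 / c ^ 2 * Ξ := by
    rw [one_div, ← div_eq_inv_mul, le_div_iff₀ (by positivity)]
    have : c * c ≤ M * D := by gcongr
    calc L * c ^ 2 = c * c * L * 1 := by ring
      _ ≤ M * D * L * q := by gcongr
      _ ≤ Ξ := by rw [hΞ]; linarith
  have hDqM : D * q / M ≤ 1 / c ^ 3 * Ξ := by
    calc D * q / M ≤ D * q / c := by gcongr
      _ ≤ (1 / c ^ 2 * Ξ) / c := by gcongr
      _ = _ := by field_simp
  have hLDqM : L * (D * q / M) ≤ 1 / c ^ 2 * Ξ := by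
    have h1 : L * (D * q / M) = M * L * D * q / M ^ 2 := by field_simp
    rw [h1, one_div, ← div_eq_inv_mul]
    exact div_le_div₀ (by linarith) (by linarith) (by positivity) (by gcongr)
  have hD' : D ≤ 1 / c ^ 2 * Ξ := (le_mul_of_one_le_right hD0.le hq1).trans hDq
  have hYL : (Y : ℝ) ≤ 1 + 2 * L := by
    rw [← hY]
    refine (Nat.floor_le (by positivity)).trans ?_
    have hk' : 1 / (k : ℝ) ≤ 1 := by
      rw [div_le_one (by positivity)]
      exact_mod_cast hk
    calc (2 * L) ^ (1 / (k : ℝ)) ≤ (1 + 2 * L) ^ (1 / (k : ℝ)) := by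
          gcongr
          linarith
      _ ≤ (1 + 2 * L) ^ (1 : ℝ) := Real.rpow_le_rpow_of_exponent_le (by linarith) hk'
      _ = _ := Real.rpow_one _
  have hκΞ : κ * Ξ = 2 * Ξ + 3 * (1 / c ^ 2 * Ξ) + 1 / c ^ 3 * Ξ := by rw [hκ]; ring
  have h2 : 0 ≤ 1 / c ^ 2 * Ξ := by positivity
  have h3 : 0 ≤ 1 / c ^ 3 * Ξ := by positivity
  have hfl : (⌊2 * D⌋₊ : ℝ) ≤ 2 * D := Nat.floor_le (by positivity)
  refine ⟨one_add_log_le hκ1 (by linarith) hlog (by positivity) (by linarith),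
    one_add_log_le hκ1 (by linarith) hlog (by positivity) (by linarith),
    one_add_log_le hκ1 (by linarith) hlog (by positivity) ?_,
    one_add_log_le hκ1 (by linarith) hlog (by positivity) (by linarith),
    one_add_log_le hκ1 (by linarith) hlog (by positivity) (by linarith)⟩
  calc (Y : ℝ) * D * q / M = Y * (D * q / M) := by ring
    _ ≤ (1 + 2 * L) * (D * q / M) := by gcongr
    _ = D * q / M + 2 * (L * (D * q / M)) := by ring
    _ ≤ κ * Ξ := by linarith

theorem sum_coprimeRange_card_pow_le (q : ℕ) {D Λ : ℝ} (hD : 0 < D)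
    (hΛ : 1 + Real.log ⌊2 * D⌋₊ ≤ Λ) (j : ℕ) :
    ∑ d ∈ coprimeRange q D, (d.divisors.card : ℝ) ^ j ≤ 2 * D * Λ ^ 2 ^ j := by
  have hsub : coprimeRange q D ⊆ Finset.Icc 1 ⌊2 * D⌋₊ := by
    intro d hd
    rw [coprimeRange, Finset.mem_filter, dyadic, Finset.mem_Ioc] at hd
    exact Finset.mem_Icc.2 ⟨by omega, hd.1.2⟩
  have h1 := one_le_one_add_log ⌊2 * D⌋₊
  calc _ ≤ ∑ d ∈ Finset.Icc 1 ⌊2 * D⌋₊, (d.divisors.card : ℝ) ^ j :=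
        Finset.sum_le_sum_of_subset_of_nonneg hsub fun _ _ _ => by positivity
    _ ≤ ⌊2 * D⌋₊ * (1 + Real.log ⌊2 * D⌋₊) ^ 2 ^ j := sum_card_divisors_pow_le j _
    _ ≤ _ := by
        refine mul_le_mul (Nat.floor_le (by positivity)) (pow_le_pow_left₀ (by linarith) hΛ _)
          (pow_nonneg (by linarith) _) (by positivity)

theorem pos_and_coprime_of_mem_coprimeRange {q d : ℕ} {D : ℝ} (hD : 0 < D)
    (hd : d ∈ coprimeRange q D) : D < d ∧ 0 < d ∧ d.Coprime q ∧ (d : ℝ) ≤ 2 * D := by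
  rw [coprimeRange, Finset.mem_filter, mem_dyadic hD.le] at hd
  exact ⟨hd.1.1, by exact_mod_cast hD.trans hd.1.1, hd.2, hd.1.2⟩

theorem sum_norm_sq_mul_card_rootSet_le {α : ℕ → ℂ} {q K : ℕ} {D Λ β : ℝ} (hD : 0 < D)
    (hΛ : 1 + Real.log ⌊2 * D⌋₊ ≤ Λ)
    (hα : ∀ d ∈ coprimeRange q D, ‖α d‖ ≤ β * (d.divisors.card : ℝ) ^ K) :
    ∑ d ∈ coprimeRange q D, ‖α d‖ ^ 2 * (rootSet q d).card * d.divisors.card ≤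
      4 * β ^ 2 * D * Λ ^ 2 ^ (2 * K + 2) := by
  calc _ ≤ ∑ d ∈ coprimeRange q D, 2 * β ^ 2 * (d.divisors.card : ℝ) ^ (2 * K + 2) := by
        refine Finset.sum_le_sum fun d hd => ?_
        obtain ⟨_, h1, h2, _⟩ := pos_and_coprime_of_mem_coprimeRange hD hd
        have h3 : ((rootSet q d).card : ℝ) ≤ 2 * d.divisors.card := by
          exact_mod_cast card_rootSet_le h1 h2
        calc ‖α d‖ ^ 2 * (rootSet q d).card * d.divisors.card
            ≤ (β * (d.divisors.card : ℝ) ^ K) ^ 2 * (2 * d.divisors.card) * d.divisors.card := by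
              gcongr
              exact hα d hd
          _ = _ := by ring
    _ = 2 * β ^ 2 * ∑ d ∈ coprimeRange q D, (d.divisors.card : ℝ) ^ (2 * K + 2) := by
        rw [Finset.mul_sum]
    _ ≤ 2 * β ^ 2 * (2 * D * Λ ^ 2 ^ (2 * K + 2)) :=
        mul_le_mul_of_nonneg_left (sum_coprimeRange_card_pow_le q hD hΛ _) (by positivity)
    _ = _ := by ring

theorem sum_norm_mul_card_rootSet_div_le {α : ℕ → ℂ} {q K : ℕ} {D Λ β : ℝ} (hD : 0 < D)
    (hβ : 0 ≤ β) (hΛ : 1 + Real.log ⌊2 * D⌋₊ ≤ Λ)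
    (hα : ∀ d ∈ coprimeRange q D, ‖α d‖ ≤ β * (d.divisors.card : ℝ) ^ K) :
    ∑ d ∈ coprimeRange q D, ‖α d‖ * (rootSet q d).card / d ≤ 4 * β * Λ ^ 2 ^ (K + 1) := by
  calc _ ≤ ∑ d ∈ coprimeRange q D, 2 * β / D * (d.divisors.card : ℝ) ^ (K + 1) := by
        refine Finset.sum_le_sum fun d hd => ?_
        obtain ⟨h0, h1, h2, _⟩ := pos_and_coprime_of_mem_coprimeRange hD hd
        have h3 : ((rootSet q d).card : ℝ) ≤ 2 * d.divisors.card := by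
          exact_mod_cast card_rootSet_le h1 h2
        calc ‖α d‖ * (rootSet q d).card / d
            ≤ (β * (d.divisors.card : ℝ) ^ K) * (2 * d.divisors.card) / D := by
              gcongr
              exact hα d hd
          _ = _ := by ring
    _ = 2 * β / D * ∑ d ∈ coprimeRange q D, (d.divisors.card : ℝ) ^ (K + 1) := by
        rw [Finset.mul_sum]
    _ ≤ 2 * β / D * (2 * D * Λ ^ 2 ^ (K + 1)) :=
        mul_le_mul_of_nonneg_left (sum_coprimeRange_card_pow_le q hD hΛ _) (by positivity)
    _ = _ := by field_simp; ring

theorem norm_le_of_isDivisorBounded {α : ℕ → ℂ} {K : ℕ} {B D Λ : ℝ} (hB : 0 < B)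
    (hα : IsDivisorBounded K B α) (hΛ : 1 + Real.log (2 * D + 2) ≤ Λ) {d : ℕ} (hd : 0 < d)
    (hdD : (d : ℝ) ≤ 2 * D) : ‖α d‖ ≤ B * Λ ^ B * (d.divisors.card : ℝ) ^ K := by
  have h0 : 0 ≤ Real.log ((d : ℝ) + 2) := Real.log_nonneg (by linarith [d.cast_nonneg (α := ℝ)])
  have h1 : Real.log ((d : ℝ) + 2) ≤ Λ := by
    have : Real.log ((d : ℝ) + 2) ≤ Real.log (2 * D + 2) :=
      Real.log_le_log (by positivity) (by linarith)
    linarith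
  calc ‖α d‖ ≤ B * (d.divisors.card : ℝ) ^ K * Real.log ((d : ℝ) + 2) ^ B := hα d hd
    _ ≤ B * (d.divisors.card : ℝ) ^ K * Λ ^ B := by gcongr
    _ = _ := by ring

theorem sqrt_pow_le {x : ℝ} (hx : 1 ≤ x) (n : ℕ) : Real.sqrt (x ^ n) ≤ x ^ n := by
  rw [Real.sqrt_le_left (by positivity)]
  exact le_self_pow₀ (one_le_pow₀ hx) two_ne_zero

theorem floor_two_mul_rpow_le {L : ℝ} (hL : 0 < L) {k Y : ℕ} (hk : 1 ≤ k)
    (hY : ⌊(2 * L) ^ (1 / (k : ℝ))⌋₊ = Y) : (Y : ℝ) ≤ 2 * L ^ (1 / (k : ℝ)) := by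
  rw [← hY]
  refine (Nat.floor_le (by positivity)).trans ?_
  rw [Real.mul_rpow (by norm_num) hL.le]
  have hk' : 1 / (k : ℝ) ≤ 1 := by
    rw [div_le_one (by positivity)]
    exact_mod_cast hk
  have : (2 : ℝ) ^ (1 / (k : ℝ)) ≤ 2 ^ (1 : ℝ) :=
    Real.rpow_le_rpow_of_exponent_le (by norm_num) hk'
  rw [Real.rpow_one] at this
  gcongr

theorem sum_Icc_card_pow_le {Y : ℕ} {Λ : ℝ} (hΛ : 1 + Real.log Y ≤ Λ) (j : ℕ) :
    ∑ n ∈ Finset.Icc 1 Y, (n.divisors.card : ℝ) ^ j ≤ Y * Λ ^ 2 ^ j := by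
  have h1 := one_le_one_add_log Y
  exact (sum_card_divisors_pow_le j Y).trans (mul_le_mul_of_nonneg_left
    (pow_le_pow_left₀ (by linarith) hΛ _) (Nat.cast_nonneg _))

theorem norm_twistedSum_le {α lam : ℕ → ℂ} {ψ : ℝ → ℂ}
    (hψ : ContDiff ℝ ((⊤ : ℕ∞) : WithTop ℕ∞) ψ) {R G : ℝ} (hR0 : 0 ≤ R) (hG0 : 0 ≤ G)
    (hR : ∀ u, R < |u| → ψ u = 0) (hR3 : ∀ u, R < |u| → iteratedDeriv 3 ψ u = 0)
    (hG : ∀ u, ‖ψ u‖ ≤ G) (hG3 : ∀ u, ‖iteratedDeriv 3 ψ u‖ ≤ G) (hGi : ‖∫ u, ψ u‖ ≤ G)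
    {q : ℕ} (hq : 1 < q) {χ : DirichletCharacter ℂ q} (hχp : χ.IsPrimitive) (hχ : χ.IsQuadratic)
    {k : ℕ} (hk : 1 ≤ k) (hlam : IsPowerCoefficient k lam) {M L D : ℝ} (hM : 0 < M) (hL : 0 < L)
    (hD : 1 / 2 ≤ D) {m₀ V Λ β : ℝ} {K : ℕ} (hV : |m₀| + R * M ≤ V * M) (hV0 : 0 ≤ V)
    (hβ : 0 ≤ β) (hΛ : 1 ≤ Λ)
    (hΛD : 1 + Real.log (3 * D * q) ≤ Λ) {Y : ℕ} (hY : ⌊(2 * L) ^ (1 / (k : ℝ))⌋₊ = Y)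
    (hΛY : 1 + Real.log Y ≤ Λ) (hΛM : 1 + Real.log (Y * D * q / M) ≤ Λ)
    (hΛd : 1 + Real.log ⌊2 * D⌋₊ ≤ Λ)
    (hα : ∀ d ∈ coprimeRange q D, ‖α d‖ ≤ β * (d.divisors.card : ℝ) ^ K) :
    ‖twistedSum α lam ψ χ M L D m₀‖ ≤
      128 * G * β * (V + 1) * Λ ^ (3 + 2 ^ (2 * K + 2) + 2 ^ (k + 2)) *
        ((q : ℝ) ^ 2 * (L + M) ^ ((1 : ℝ) / 2) * D ^ ((1 : ℝ) / 2) * L ^ (1 / (2 * (k : ℝ))) +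
          (q : ℝ) ^ (-(1 / 2) : ℝ) * M * L ^ (1 / (k : ℝ))) := by
  have hq0 : 0 < q := by omega
  have hqr : (0 : ℝ) < q := by exact_mod_cast hq0
  have hD0 : 0 < D := by linarith
  have hYL := floor_two_mul_rpow_le hL hk hY
  have hΛ0 : 0 < Λ := by linarith
  set E := 3 + 2 ^ (2 * K + 2) + 2 ^ (k + 2) with hE
  have hmain : ‖mainPart α lam ψ χ k M L D m₀‖ ≤ 128 * G * β * Λ ^ E *
      ((q : ℝ) ^ (-(1 / 2) : ℝ) * M * L ^ (1 / (k : ℝ))) := by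
    have hτ : (q.divisors.card : ℝ) ≤ 2 * Real.sqrt q := by
      rw [← Real.sqrt_sq (Nat.cast_nonneg _), ← Real.sqrt_sq (zero_le_two (α := ℝ)),
        ← Real.sqrt_mul (by norm_num)]
      refine Real.sqrt_le_sqrt ?_
      have : ((q.divisors.card : ℝ)) ^ 2 ≤ 4 * q := by exact_mod_cast card_divisors_sq_le q
      linarith
    have hqs : Real.sqrt q / q = (q : ℝ) ^ (-(1 / 2) : ℝ) := by
      rw [Real.sqrt_eq_rpow, Real.rpow_neg hqr.le, ← Real.sqrt_eq_rpow]
      field_simp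
      exact Real.sq_sqrt hqr.le
    have hpow : Λ ^ 2 ^ (K + 1) * Λ ≤ Λ ^ E := by
      rw [← pow_succ]
      refine pow_le_pow_right₀ hΛ ?_
      have : 2 ^ (K + 1) ≤ 2 ^ (2 * K + 2) := Nat.pow_le_pow_right (by norm_num) (by omega)
      have := Nat.zero_le (2 ^ (k + 2))
      omega
    have h1 := norm_mainPart_le (α := α) hGi hq0 hχp hχ hk hlam hM hD0 m₀ hY
    have h2 := sum_norm_mul_card_rootSet_div_le hD0 hβ hΛd hα
    have h3 : 1 ≤ 1 + Real.log Y := one_le_one_add_log Y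
    calc _ ≤ _ := h1
      _ ≤ 8 * G * M / q * (4 * β * Λ ^ 2 ^ (K + 1)) *
          (Λ * (2 * L ^ (1 / (k : ℝ)) * (2 * Real.sqrt q))) := by gcongr
      _ = 128 * G * β * (Λ ^ 2 ^ (K + 1) * Λ) * (Real.sqrt q / q * M * L ^ (1 / (k : ℝ))) := by ring
      _ ≤ _ := by
          rw [hqs]
          gcongr
  have herr : ‖errorPart α lam ψ χ k M L D m₀‖ ≤ 80 * G * β * V * Λ ^ E *
      ((q : ℝ) ^ 2 * (L + M) ^ ((1 : ℝ) / 2) * D ^ ((1 : ℝ) / 2) * L ^ (1 / (2 * (k : ℝ)))) := by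
    have h1 := norm_errorPart_le (α := α) hψ hR0 hG0 hR hR3 hG hG3 hq hχ hk hlam hM hL hD hV hΛ hΛD
      hY hΛY hΛM
    have h2 := sum_norm_sq_mul_card_rootSet_le hD0 hΛd hα
    have h3 : Real.sqrt (Λ * ∑ d ∈ coprimeRange q D,
        ‖α d‖ ^ 2 * (rootSet q d).card * d.divisors.card) ≤
        2 * β * Real.sqrt D * Λ ^ (1 + 2 ^ (2 * K + 2)) := by
      calc _ ≤ Real.sqrt ((2 * β) ^ 2 * D * Λ ^ (1 + 2 ^ (2 * K + 2))) := by
            refine Real.sqrt_le_sqrt ((mul_le_mul_of_nonneg_left h2 hΛ0.le).trans_eq ?_)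
            rw [pow_add]
            ring
        _ = 2 * β * Real.sqrt D * Real.sqrt (Λ ^ (1 + 2 ^ (2 * K + 2))) := by
            rw [Real.sqrt_mul (by positivity), Real.sqrt_mul (by positivity),
              Real.sqrt_sq (by positivity)]
        _ ≤ _ := mul_le_mul_of_nonneg_left (sqrt_pow_le hΛ _) (by positivity)
    have hLs : Real.sqrt (L ^ (1 / (k : ℝ))) = L ^ (1 / (2 * (k : ℝ))) := by
      rw [Real.sqrt_eq_rpow, ← Real.rpow_mul hL.le]
      congr 1
      field_simp
    have h4 : Real.sqrt (∑ n ∈ Finset.Icc 1 Y, (n.divisors.card : ℝ) ^ (k + 2)) ≤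
        2 * L ^ (1 / (2 * (k : ℝ))) * Λ ^ 2 ^ (k + 2) := by
      calc _ ≤ Real.sqrt (2 ^ 2 * L ^ (1 / (k : ℝ)) * Λ ^ 2 ^ (k + 2)) := by
            refine Real.sqrt_le_sqrt ((sum_Icc_card_pow_le hΛY _).trans ?_)
            have : (0 : ℝ) ≤ L ^ (1 / (k : ℝ)) := by positivity
            gcongr
            linarith
        _ = 2 * L ^ (1 / (2 * (k : ℝ))) * Real.sqrt (Λ ^ 2 ^ (k + 2)) := by
            rw [Real.sqrt_mul (by positivity), Real.sqrt_mul (by positivity),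
              Real.sqrt_sq (by positivity), hLs]
        _ ≤ _ := mul_le_mul_of_nonneg_left (sqrt_pow_le hΛ _) (by positivity)
    refine h1.trans ?_
    have h5 := mul_le_mul h3 h4 (Real.sqrt_nonneg _) (by positivity)
    have h6 : Λ ^ E = Λ ^ 2 * Λ ^ (1 + 2 ^ (2 * K + 2)) * Λ ^ 2 ^ (k + 2) := by
      rw [← pow_add, ← pow_add, hE]
      congr 1
      ring
    rw [← Real.sqrt_eq_rpow, ← Real.sqrt_eq_rpow, h6]
    calc _ ≤ (q : ℝ) ^ 2 * (20 * V * G * Λ ^ 2 * (Real.sqrt (L + M) *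
          (2 * β * Real.sqrt D * Λ ^ (1 + 2 ^ (2 * K + 2)) *
            (2 * L ^ (1 / (2 * (k : ℝ))) * Λ ^ 2 ^ (k + 2))))) :=
          mul_le_mul_of_nonneg_left (mul_le_mul_of_nonneg_left
            (mul_le_mul_of_nonneg_left h5 (Real.sqrt_nonneg _)) (by positivity)) (by positivity)
      _ = _ := by ring
  rw [twistedSum_eq_mainPart_add_errorPart hψ hR hq0 χ hk hlam hM hL hD0 m₀]
  refine (norm_add_le _ _).trans ((add_le_add hmain herr).trans ?_)
  set S := (q : ℝ) ^ 2 * (L + M) ^ ((1 : ℝ) / 2) * D ^ ((1 : ℝ) / 2) * L ^ (1 / (2 * (k : ℝ)))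
  set T := (q : ℝ) ^ (-(1 / 2) : ℝ) * M * L ^ (1 / (k : ℝ))
  have hS : 0 ≤ S := by positivity
  have hT : 0 ≤ T := by positivity
  have hX : 0 ≤ G * β * Λ ^ E := by positivity
  clear_value S T
  have e1 : 0 ≤ G * β * Λ ^ E * V * T := by positivity
  have e2 : 0 ≤ G * β * Λ ^ E * V * S := by positivity
  have e3 : 0 ≤ G * β * Λ ^ E * S := by positivity
  linarith

end

theorem proposition4 (k : ℕ) (hk : 1 ≤ k) :
    ∃ η : ℝ, 0 < η ∧
      ∀ (ε : ℝ) (c : ℝ) (A : ℝ) (K : ℕ) (B : ℝ) (ψ : ℝ → ℂ),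
        0 < ε → 0 < c → 0 < A → 0 < B →
        ContDiff ℝ ((⊤ : ℕ∞) : WithTop ℕ∞) ψ → HasCompactSupport ψ →
        ∃ C : ℝ, 0 < C ∧
          ∀ (M L D : ℝ), c ≤ M → c ≤ L → c ≤ D →
          ∀ (q : ℕ), 1 < q →
          ∀ (χ : DirichletCharacter ℂ q), χ.IsPrimitive → χ.IsQuadratic →
          ∀ (lam : ℕ → ℂ), IsPowerCoefficient k lam →
          ∀ (α : ℕ → ℂ), IsDivisorBounded K B α →
          ∀ (m₀ : ℝ), |m₀| ≤ A * M * paramLog M L D q ^ A →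
            ‖twistedSum α lam ψ χ M L D m₀‖ ≤
              C * paramLog M L D q ^ C *
                ((q : ℝ) ^ 2 * M ^ ε * (L + M) ^ ((1 : ℝ) / 2) * D ^ ((1 : ℝ) / 2) *
                    L ^ (1 / (2 * (k : ℝ))) +
                  (q : ℝ) ^ (-η) * M * L ^ (1 / (k : ℝ))) := by
  refine ⟨1 / 2, by norm_num, fun ε c A K B ψ hε hc hA hB hψ hψc => ?_⟩
  obtain ⟨R, G, hR1, hG1, hR, hR3, hG, hG3, hGi⟩ := exists_support_bound hψ hψc
  obtain ⟨C₁, hC₁, hlog⟩ := exists_log_bound hc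
  set e : ℕ := 3 + 2 ^ (2 * K + 2) + 2 ^ (k + 2) with he
  set E : ℝ := B + A + e with hE
  have hE0 : 0 < E := by positivity
  set F : ℝ := 128 * G * B * (A + R + 1) * C₁ ^ E * (1 + c ^ (-ε)) with hF
  have hF0 : 0 < F := by positivity
  refine ⟨F + E, by positivity, fun M L D hM hL hD q hq χ hχp hχ lam hlam α hα m₀ hm₀ => ?_⟩
  have hM0 : 0 < M := by linarith
  have hL0 : 0 < L := by linarith
  have hD0 : 0 < D := by linarith
  have hℓ : 1 ≤ paramLog M L D q := one_le_paramLog (by positivity)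
  set ℓ := paramLog M L D q with hℓdef
  have hℓ0 : 0 < ℓ := by linarith
  rcases lt_or_ge D (1 / 2) with hDlt | hD2
  · have : dyadic D = ∅ := by
      rw [dyadic, Nat.floor_eq_zero.2 (show 2 * D < 1 by linarith)]
      simp
    rw [twistedSum, this, Finset.sum_empty, norm_zero]
    positivity
  obtain ⟨h1, h2, h3, h4, h5⟩ := hlog M L D q hM hL hD hq k hk _ rfl
  set Λ := C₁ * ℓ with hΛdef
  have hℓΛ : ℓ ≤ Λ := le_mul_of_one_le_left hℓ0.le hC₁
  have hΛ : 1 ≤ Λ := hℓ.trans hℓΛ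
  have hΛ0 : 0 < Λ := by linarith
  have hΛA : 1 ≤ Λ ^ A := Real.one_le_rpow hΛ hA.le
  have hV : |m₀| + R * M ≤ (A + R) * Λ ^ A * M := by
    have e1 : |m₀| ≤ A * M * Λ ^ A := hm₀.trans (by gcongr)
    have e2 : R * M * 1 ≤ R * M * Λ ^ A := by gcongr
    linarith
  have hαβ : ∀ d ∈ coprimeRange q D, ‖α d‖ ≤ B * Λ ^ B * (d.divisors.card : ℝ) ^ K := fun d hd => by
    obtain ⟨_, e1, _, e2⟩ := pos_and_coprime_of_mem_coprimeRange hD0 hd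
    exact norm_le_of_isDivisorBounded hB hα h4 e1 e2
  have hbound := norm_twistedSum_le hψ (by linarith) (by linarith) hR hR3 hG hG3 hGi hq hχp hχ hk hlam
    hM0 hL0 hD2 hV (by positivity) (by positivity) hΛ h1 rfl h2 h3 h5 hαβ
  refine hbound.trans ?_
  rw [← he]
  have hfac : 128 * G * (B * Λ ^ B) * ((A + R) * Λ ^ A + 1) * Λ ^ e ≤
      128 * G * B * (A + R + 1) * C₁ ^ E * ℓ ^ E := by
    have e1 : Λ ^ B * Λ ^ A * Λ ^ e = C₁ ^ E * ℓ ^ E := by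
      rw [← Real.mul_rpow (by linarith) hℓ0.le, ← Real.rpow_natCast, ← Real.rpow_add hΛ0,
        ← Real.rpow_add hΛ0]
    have e2 : (A + R) * Λ ^ A + 1 ≤ (A + R + 1) * Λ ^ A := by linarith
    calc _ ≤ 128 * G * (B * Λ ^ B) * ((A + R + 1) * Λ ^ A) * Λ ^ e := by gcongr
      _ = 128 * G * B * (A + R + 1) * (Λ ^ B * Λ ^ A * Λ ^ e) := by ring
      _ = _ := by rw [e1]; ring
  have hMε : 1 ≤ c ^ (-ε) * M ^ ε := by
    rw [Real.rpow_neg hc.le, ← div_eq_inv_mul, one_le_div (by positivity)]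
    gcongr
  have hℓE : ℓ ^ E ≤ ℓ ^ (F + E) := Real.rpow_le_rpow_of_exponent_le hℓ (by linarith)
  set S := (q : ℝ) ^ 2 * (L + M) ^ ((1 : ℝ) / 2) * D ^ ((1 : ℝ) / 2) * L ^ (1 / (2 * (k : ℝ)))
    with hS
  set T := (q : ℝ) ^ (-(1 / 2) : ℝ) * M * L ^ (1 / (k : ℝ)) with hT
  have hS0 : 0 ≤ S := by positivity
  have hT0 : 0 ≤ T := by positivity
  have hST : S + T ≤ (1 + c ^ (-ε)) * (M ^ ε * S + T) := by
    have e1 : 1 * S ≤ c ^ (-ε) * M ^ ε * S := by gcongr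
    have e2 : 0 ≤ M ^ ε * S := by positivity
    have e3 : 0 ≤ c ^ (-ε) * T := by positivity
    linarith
  have hMS : (q : ℝ) ^ 2 * M ^ ε * (L + M) ^ ((1 : ℝ) / 2) * D ^ ((1 : ℝ) / 2) *
      L ^ (1 / (2 * (k : ℝ))) = M ^ ε * S := by rw [hS]; ring
  rw [hMS]
  have hMS0 : 0 ≤ M ^ ε * S + T := by positivity
  clear_value S T
  calc _ ≤ 128 * G * B * (A + R + 1) * C₁ ^ E * ℓ ^ E * ((1 + c ^ (-ε)) * (M ^ ε * S + T)) := by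
        gcongr
    _ = F * ℓ ^ E * (M ^ ε * S + T) := by rw [hF]; ring
    _ ≤ _ := by
        gcongr
        linarith
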